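/- Setting. Let $k,n\ge 0$ and $r\ge 1$ be integers, let $R>0$, $\varepsilon_1>0$, $\lambda<1$, let $X=Y$ be the closed ball of radius $R$ about the origin in $\mathbb R^{k}$, and let $D\subset\mathbb R^{n}$ be a bounded domain. Put $\Sigma=X\times Y\times D$. For $c,c'\in\{a,b\}$ and $\varepsilon\in[0,\varepsilon_1]$ let $\Pi_{cc'}=\Pi_{cc'}^{\varepsilon}$ be a partially defined map from $\Sigma$ to $\Sigma$ which is written in cross-form with slow drift: for $(x,y,z),(\bar x,\bar y,\bar z)\in\Sigma$, $$\Pi_{cc'}(x,y,z)=(\bar x,\bar y,\bar z)\iff \bar x=f_{cc'}(x,\bar y,z,\varepsilon),\quad y=g_{cc'}(x,\bar y,z,\varepsilon),\quad \bar z=z+\varepsilon\,\phi_{cc'}(x,\bar y,z,\varepsilon).$$ Here $f_{cc'},g_{cc'}$ (with values in the ball of radius $R$) and $\phi_{cc'}$ (with values in $\mathbb R^n$) are of class $C^r$ on $X\times Y\times D\times[0,\varepsilon_1]$ and are bounded there together with their derivatives up to order $r$. Assume the hyperbolicity condition $$\Bigl\|\frac{\partial(f_{cc'},g_{cc'})}{\partial(x,\bar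 y)}\Bigr\|\le\lambda<1$$ on this set, where the norm corresponds to $\max\{\|x\|,\|y\|\}$. Assume also that $\phi_{cc'}$ is continuous on $X\times Y\times\overline D\times[0,\varepsilon_1]$ and vanishes for $z\in\partial D$. Lemma. There are constants $\varepsilon_0\in(0,\varepsilon_1]$, $C\ge 0$ and $B$, independent of the code, with $\lambda+C\varepsilon_0<1$, such that for every code $\xi\in\{a,b\}^{\mathbb Z}$ and every $\varepsilon\in[0,\varepsilon_0]$ there is a sequence of $C^r$ surfaces $$\mathcal L_i(\xi,\varepsilon)=\{(x,y,z)\in\Sigma:\ (x,y)=(x_i(z,\xi,\varepsilon),y_i(z,\xi,\varepsilon)),\ z\in D\},\qquad i\in\mathbb Z,$$ for which $\Pi_{\xi_i\xi_{i+1}}$ is defined on all of $\mathcal L_i$ and $\Pi_{\xi_i\xi_{i+1}}\mathcal L_i=\mathcal L_{i+1}$ for all $i$. This sequence is unique, even among all sequences of graphs over $D$ with this invariance property. Moreover: 1. for all $i$, $\xi$, all $\varepsilon\in[0,\varepsilon_0]$ and all $z\in D$, the derivatives of $x_i$ and $y_i$ with respect to $z$ of orders $0,1,\dots,r$ are bounded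 in norm by $B$; 2. if two codes satisfy $\xi^{(1)}_i=\xi^{(2)}_i$ for $|i|\le N$, then for $|i|\le N$, $\varepsilon\in[0,\varepsilon_0]$ and $z\in D$ $$\max\bigl\{\|x_i(z,\xi^{(1)},\varepsilon)-x_i(z,\xi^{(2)},\varepsilon)\|,\ \|y_i(z,\xi^{(1)},\varepsilon)-y_i(z,\xi^{(2)},\varepsilon)\|\bigr\}\le 2R\,(\lambda+C\varepsilon)^{N-|i|};$$ 3. for all $i\in\mathbb Z$, all $\xi$, $\varepsilon\in[0,\varepsilon_0]$ and $z\in D$ $$\bigl\|\bigl(x_i(z,\xi,\varepsilon)-x_i(z,\xi,0),\ y_i(z,\xi,\varepsilon)-y_i(z,\xi,0)\bigr)\bigr\|\le C\varepsilon .$$ -/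

import Mathlib

open Set Metric

/-- The two symbols labelling the two families of saddle periodic orbits. -/
inductive Letter : Type
  | a : Letter
  | b : Letter

/-- A code: a bi-infinite sequence of symbols. -/
abbrev Code : Type := ℤ → Letter

/-- `ℝ^k` with its Euclidean norm. -/
abbrev Euc (k : ℕ) : Type := EuclideanSpace ℝ (Fin k)

/-- Coordinates `(x, y, z)` on a cross-section: `x, y` are fast, `z` is slow. -/
abbrev Pt (k n : ℕ) : Type := Euc k × Euc k × Euc n

/-- Arguments `(x, ȳ, z, ε)` of the functions in a cross-form. -/
abbrev Arg (k n : ℕ) : Type := Euc k × Euc k × Euc n × ℝ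

/-- The cross-section `X × Y × D`, where `X` and `Y` are the balls of radius `R` about `0`. -/
def crossSection (k n : ℕ) (R : ℝ) (D : Set (Euc n)) : Set (Pt k n) :=
  closedBall 0 R ×ˢ closedBall 0 R ×ˢ D

/-- The set `X × Y × D × [0, ε₁]` of arguments of the functions in a cross-form. -/
def argDomain (k n : ℕ) (R ε₁ : ℝ) (D : Set (Euc n)) : Set (Arg k n) :=
  closedBall 0 R ×ˢ closedBall 0 R ×ˢ D ×ˢ Icc 0 ε₁

/-- `h` is of class `C^r` on `K` and is bounded there with its derivatives up to order `r`. -/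
def BoundedCr {V W : Type*} [NormedAddCommGroup V] [NormedSpace ℝ V]
    [NormedAddCommGroup W] [NormedSpace ℝ W] (r : ℕ) (h : V → W) (K : Set V) : Prop :=
  ContDiffOn ℝ r h K ∧
    ∃ B : ℝ, ∀ j : ℕ, j ≤ r → ∀ p ∈ K, ‖iteratedFDerivWithin ℝ j h K p‖ ≤ B

/-- The partial map `T` is given on the cross-sections by the cross-form
`x̄ = f(x, ȳ, z, ε)`, `y = g(x, ȳ, z, ε)`, `z̄ = z + ε φ(x, ȳ, z, ε)`. -/
def HasCrossForm {k n : ℕ} (R : ℝ) (D : Set (Euc n)) (ε : ℝ) (T : Pt k n →. Pt k n)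
    (f g : Arg k n → Euc k) (φ : Arg k n → Euc n) : Prop :=
  ∀ (x y x' y' : Euc k) (z z' : Euc n),
    (x', y', z') ∈ T (x, y, z) ↔
      (x, y, z) ∈ crossSection k n R D ∧ (x', y', z') ∈ crossSection k n R D ∧
        x' = f (x, y', z, ε) ∧ y = g (x, y', z, ε) ∧ z' = z + ε • φ (x, y', z, ε)

/-- The norm of the Jacobian of `(f, g)` with respect to `(x, ȳ)` is at most `lam`; the norm on
the product is `max (‖x‖, ‖y‖)`. -/
def IsHyperbolicBy {k n : ℕ} (R ε₁ : ℝ) (D : Set (Euc n)) (lam : ℝ)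
    (f g : Arg k n → Euc k) : Prop :=
  ∀ x ∈ closedBall (0 : Euc k) R, ∀ y' ∈ closedBall (0 : Euc k) R, ∀ z ∈ D, ∀ ε ∈ Icc 0 ε₁,
    ‖fderivWithin ℝ
        (fun p : Euc k × Euc k => (f (p.1, p.2, z, ε), g (p.1, p.2, z, ε)))
        (closedBall 0 R ×ˢ closedBall 0 R) (x, y')‖ ≤ lam

/-- The surface `(x, y) = (X(z), Y(z))`, `z ∈ D`. -/
def surface {k n : ℕ} (D : Set (Euc n)) (X Y : Euc n → Euc k) : Set (Pt k n) :=
  (fun z => (X z, Y z, z)) '' D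

/-- The sequence of sets `L i` satisfies `Π_{ξ_i ξ_{i+1}} (L i) = L (i+1)`, the map being
defined on all of `L i`. -/
def IsInvariantSeq {k n : ℕ} (T : Letter → Letter → (Pt k n →. Pt k n)) (ξ : Code)
    (L : ℤ → Set (Pt k n)) : Prop :=
  ∀ i : ℤ, L i ⊆ (T (ξ i) (ξ (i + 1))).Dom ∧ (T (ξ i) (ξ (i + 1))).image (L i) = L (i + 1)

/-!
The invariant graphs are first found among Lipschitz graphs, by a contraction argument that treats
the motion of the base `D` as an unknown of its own, and are then shown to be smooth by studying
the orbits that make them up.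

*Lipschitz invariant graphs.* For fixed `ε` the maps have the form `x̄ = F (x, ȳ, z)`,
`y = G (x, ȳ, z)`, `z̄ = z + Φ (x, ȳ, z)` with `Φ = ε φ`. Since `φ` is Lipschitz in `z` and vanishes
on the boundary of `D`, it is bounded by a multiple of the distance to the complement of `D`
(`norm_le_mul_gap`). So a step over the base is short compared with that distance: the base never
leaves `D`, and every estimate along a segment takes place inside `D`, which need not be convex.
The unknowns are the graphs `x i, y i` together with the map `b i` of the base from time `i` to
time `i + 1` and the map `a i` back. The `x i` are transported forwards and the `y i` backwards,
which contracts by hyperbolicity (`exists_graphsInvariant`).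
Uniqueness, the dependence on the code and the dependence on `ε` all come from one comparison of two
invariant sequences, only one of which is Lipschitz (`GraphsInvariant.compare`): the orbits through
the same base point of two graphs at distance `δ` are at distance at most `(λ + O(ε)) δ + O(η)` one
step later (for `x`) or earlier (for `y`), if the maps differ by at most `η`.

*Smoothness.* Let `(X m z, Y m z, Z m z)`, `m ∈ ℤ`, be the orbit that passes at time `0` through the
point of the graph over `z`. It solves the equations
`X (m + 1) = f (X m, Y (m + 1), Z m, ε)`, `Y m = g (X m, Y (m + 1), Z m, ε)`,
`Z (m + 1) = Z m + ε φ (X m, Y (m + 1), Z m, ε)`, with `Z 0 = z`. No maps are composed with the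
unknowns here, so no derivative is lost on differentiating in `z`. The derivatives of order `s`
solve an affine equation with the linear part of the first variation. They grow with `|m|`, and are
sought with a bound `O(μ ^ (s |m|))`, where `μ > 1` is close to `1`. In this norm the equation for
`Z` contracts by `μ⁻¹ + O(ε)`, and the equations for `X` and `Y` contract by `(λ + small) μ ^ s`,
where the coupling to `Z` is made small by rescaling `Z` (`weightContracts_orbit`). The general
statement on families of functions solving such an equation is `exists_hasFDerivAt_weightedCr`. All
codes, parameters and times are treated as one family, so the bounds are uniform.
-/

open Filter Topology Asymptotics

/-! ### Weighted families of `C^t` functions -/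

section Weighted

variable {ι ι' V W W₁ W₂ : Type*}
  [NormedAddCommGroup V] [NormedSpace ℝ V] [NormedAddCommGroup W] [NormedSpace ℝ W]
  [NormedAddCommGroup W₁] [NormedSpace ℝ W₁] [NormedAddCommGroup W₂] [NormedSpace ℝ W₂]
  {ω : ι → ℝ} {D : Set V}

/-- A family `h i`, `i ∈ ι`, of `C^t` functions on `D` whose derivatives of order `τ ≤ t` are
bounded by a multiple of `ω i ^ (s + τ)`, with one constant for the whole family. For `ω = 1` this
is uniform boundedness in `C^t`; a weight that grows with the number of iterations makes room for
the growth of derivatives along orbits, and is graded so that the chain rule respects it. -/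
def WeightedCr (ω : ι → ℝ) (D : Set V) (t s : ℕ) (h : ι → V → W) : Prop :=
  (∀ i, ContDiffOn ℝ t (h i) D) ∧
    ∃ B : ℝ, 0 ≤ B ∧ ∀ i, ∀ τ ≤ t, ∀ z ∈ D,
      ‖iteratedFDerivWithin ℝ τ (h i) D z‖ ≤ B * ω i ^ (s + τ)

namespace WeightedCr

theorem mono {t t' s : ℕ} {h : ι → V → W} (hh : WeightedCr ω D t s h) (ht : t' ≤ t) :
    WeightedCr ω D t' s h := by
  obtain ⟨h1, B, hB, h2⟩ := hh
  exact ⟨fun i => (h1 i).of_le (by exact_mod_cast ht), B, hB,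
    fun i τ hτ z hz => h2 i τ (hτ.trans ht) z hz⟩

theorem norm_le {t s : ℕ} {h : ι → V → W} (hh : WeightedCr ω D t s h) :
    ∃ B : ℝ, 0 ≤ B ∧ ∀ i, ∀ z ∈ D, ‖h i z‖ ≤ B * ω i ^ s := by
  obtain ⟨h1, B, hB, h2⟩ := hh
  refine ⟨B, hB, fun i z hz => ?_⟩
  simpa using h2 i 0 (Nat.zero_le _) z hz

theorem const (hω : ∀ i, 1 ≤ ω i) (t s : ℕ) {v : ι → W} {C : ℝ}
    (hv : ∀ i, ‖v i‖ ≤ C) : WeightedCr ω D t s (fun i _ => v i) := by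
  refine ⟨fun i => contDiffOn_const, max C 0, le_max_right _ _, fun i τ _ z hz => ?_⟩
  have h1 : 1 ≤ ω i ^ (s + τ) := one_le_pow₀ (hω i)
  have h2 : ‖iteratedFDerivWithin ℝ τ (fun _ : V => v i) D z‖ ≤ max C 0 := by
    rcases Nat.eq_zero_or_pos τ with rfl | hτ
    · simpa using Or.inl (hv i)
    · rw [iteratedFDerivWithin_const_of_ne (𝕜 := ℝ) hτ.ne' (v i) D]
      simp
  nlinarith [le_max_right C 0]

theorem add (hD : UniqueDiffOn ℝ D) {t s : ℕ} {f g : ι → V → W}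
    (hf : WeightedCr ω D t s f) (hg : WeightedCr ω D t s g) :
    WeightedCr ω D t s (fun i z => f i z + g i z) := by
  obtain ⟨f1, A, hA, f2⟩ := hf
  obtain ⟨g1, B, hB, g2⟩ := hg
  refine ⟨fun i => (f1 i).add (g1 i), A + B, add_nonneg hA hB, fun i τ hτ z hz => ?_⟩
  have hle : ((τ : ℕ) : WithTop ℕ∞) ≤ (t : ℕ) := by exact_mod_cast hτ
  have h := iteratedFDerivWithin_add_apply (((f1 i).of_le hle) z hz) (((g1 i).of_le hle) z hz) hD hz
  have h' : iteratedFDerivWithin ℝ τ (fun z => f i z + g i z) D z =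
    iteratedFDerivWithin ℝ τ (f i) D z + iteratedFDerivWithin ℝ τ (g i) D z := h
  rw [h', add_mul]
  exact (norm_add_le _ _).trans (add_le_add (f2 i τ hτ z hz) (g2 i τ hτ z hz))

theorem sum {κ : Type*} (hD : UniqueDiffOn ℝ D) (hω : ∀ i, 1 ≤ ω i) {t s : ℕ}
    (S : Finset κ) {f : κ → ι → V → W} (hf : ∀ k, WeightedCr ω D t s (f k)) :
    WeightedCr ω D t s (fun i z => ∑ k ∈ S, f k i z) := by
  classical
  induction S using Finset.induction_on with
  | empty =>
    simpa using const (W := W) hω t s (v := fun _ => 0) (C := 0) (by simp)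
  | insert a S ha ih =>
    simp only [Finset.sum_insert ha]
    exact (hf a).add hD ih

theorem bilin (hD : UniqueDiffOn ℝ D) (L : W₁ →L[ℝ] W₂ →L[ℝ] W) {t s₁ s₂ : ℕ}
    {f : ι → V → W₁} {g : ι → V → W₂} (hω : ∀ i, 1 ≤ ω i)
    (hf : WeightedCr ω D t s₁ f) (hg : WeightedCr ω D t s₂ g) :
    WeightedCr ω D t (s₁ + s₂) (fun i z => L (f i z) (g i z)) := by
  obtain ⟨f1, A, hA, f2⟩ := hf
  obtain ⟨g1, B, hB, g2⟩ := hg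
  refine ⟨fun i => L.isBoundedBilinearMap.contDiff.comp_contDiffOn ((f1 i).prodMk (g1 i)),
    ‖L‖ * (2 ^ t * (A * B)), by positivity, fun i τ hτ z hz => ?_⟩
  have hle : ((τ : ℕ) : WithTop ℕ∞) ≤ (t : ℕ) := by exact_mod_cast hτ
  have hpos : 0 < ω i := one_pos.trans_le (hω i)
  refine (L.norm_iteratedFDerivWithin_le_of_bilinear (f1 i) (g1 i) hD hz hle).trans ?_
  rw [mul_assoc]
  refine mul_le_mul_of_nonneg_left ?_ (norm_nonneg L)
  have key : ∀ j ∈ Finset.range (τ + 1),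
      (τ.choose j : ℝ) * ‖iteratedFDerivWithin ℝ j (f i) D z‖ *
        ‖iteratedFDerivWithin ℝ (τ - j) (g i) D z‖ ≤
      (τ.choose j : ℝ) * (A * B * ω i ^ (s₁ + s₂ + τ)) := by
    intro j hj
    have hj' : j ≤ τ := Nat.lt_succ_iff.mp (Finset.mem_range.mp hj)
    have e1 := f2 i j (hj'.trans hτ) z hz
    have e2 := g2 i (τ - j) ((Nat.sub_le _ _).trans hτ) z hz
    rw [mul_assoc]
    refine mul_le_mul_of_nonneg_left ?_ (Nat.cast_nonneg _)
    calc _ ≤ (A * ω i ^ (s₁ + j)) * (B * ω i ^ (s₂ + (τ - j))) :=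
          mul_le_mul e1 e2 (norm_nonneg _) (by positivity)
      _ = A * B * ω i ^ ((s₁ + j) + (s₂ + (τ - j))) := by rw [pow_add]; ring
      _ = A * B * ω i ^ (s₁ + s₂ + τ) := by
          congr 2; omega
  refine (Finset.sum_le_sum key).trans ?_
  rw [← Finset.sum_mul]
  have hs : (∑ j ∈ Finset.range (τ + 1), (τ.choose j : ℝ)) = 2 ^ τ := by
    exact_mod_cast Nat.sum_range_choose τ
  rw [hs]
  have h2 : (2 : ℝ) ^ τ ≤ 2 ^ t := pow_le_pow_right₀ one_le_two hτ
  calc (2 : ℝ) ^ τ * (A * B * ω i ^ (s₁ + s₂ + τ)) ≤ 2 ^ t * (A * B * ω i ^ (s₁ + s₂ + τ)) :=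
        mul_le_mul_of_nonneg_right h2 (by positivity)
    _ = _ := by ring

theorem clm (hD : UniqueDiffOn ℝ D) (hω : ∀ i, 1 ≤ ω i) (L : W₁ →L[ℝ] W) {t s : ℕ}
    {f : ι → V → W₁} (hf : WeightedCr ω D t s f) : WeightedCr ω D t s (fun i z => L (f i z)) := by
  have h := bilin hD (ContinuousLinearMap.id ℝ (W₁ →L[ℝ] W)) hω
    (const hω t 0 (v := fun _ => L) (fun _ => le_rfl)) hf
  rwa [zero_add] at h

theorem fderivWithin (hD : UniqueDiffOn ℝ D) {t s : ℕ} {h : ι → V → W}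
    (hh : WeightedCr ω D (t + 1) s h) :
    WeightedCr ω D t (s + 1) (fun i => fderivWithin ℝ (h i) D) := by
  obtain ⟨h1, B, hB, h2⟩ := hh
  refine ⟨fun i => (h1 i).fderivWithin hD (by exact_mod_cast le_rfl), B, hB,
    fun i τ hτ z hz => ?_⟩
  rw [norm_iteratedFDerivWithin_fderivWithin hD hz]
  have := h2 i (τ + 1) (by omega) z hz
  rwa [show s + 1 + τ = s + (τ + 1) by omega]

/-- Only the derivatives of positive order enter the conclusion, so no bound on the functions
themselves is needed. -/
theorem contDiffOn_of_hasFDerivAt (hD : IsOpen D) {t s : ℕ} {h : ι → V → W}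
    {Q : ι → V → V →L[ℝ] W} (hh : ∀ i, ∀ z ∈ D, HasFDerivAt (h i) (Q i z) z)
    (hQ : WeightedCr ω D t (s + 1) Q) :
    (∀ i, ContDiffOn ℝ (t + 1 : ℕ) (h i) D) ∧
      ∃ B : ℝ, 0 ≤ B ∧ ∀ i, ∀ τ, 1 ≤ τ → τ ≤ t + 1 → ∀ z ∈ D,
        ‖iteratedFDerivWithin ℝ τ (h i) D z‖ ≤ B * ω i ^ (s + τ) := by
  obtain ⟨h1, B, hB, h2⟩ := hQ
  have heq : ∀ i, EqOn (_root_.fderivWithin ℝ (h i) D) (Q i) D := fun i z hz => by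
    rw [fderivWithin_of_isOpen hD hz, (hh i z hz).fderiv]
  refine ⟨fun i => ?_, B, hB, fun i τ hτ1 hτ z hz => ?_⟩
  · push_cast
    rw [contDiffOn_succ_iff_fderivWithin hD.uniqueDiffOn]
    exact ⟨fun z hz => (hh i z hz).differentiableAt.differentiableWithinAt,
      fun h => absurd h (by simp), (h1 i).congr (heq i)⟩
  · obtain ⟨τ, rfl⟩ : ∃ τ', τ = τ' + 1 := ⟨τ - 1, by omega⟩
    rw [← norm_iteratedFDerivWithin_fderivWithin hD.uniqueDiffOn hz,
      iteratedFDerivWithin_congr (heq i) hz]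
    have := h2 i τ (by omega) z hz
    rwa [show s + (τ + 1) = s + 1 + τ by omega]

theorem of_hasFDerivAt (hD : IsOpen D) {t s : ℕ} {h : ι → V → W}
    {Q : ι → V → V →L[ℝ] W} (hh : ∀ i, ∀ z ∈ D, HasFDerivAt (h i) (Q i z) z)
    (hω : ∀ i, 1 ≤ ω i) {C : ℝ} (hC : ∀ i, ∀ z ∈ D, ‖h i z‖ ≤ C * ω i ^ s)
    (hQ : WeightedCr ω D t (s + 1) Q) : WeightedCr ω D (t + 1) s h := by
  obtain ⟨h1, B, hB, h2⟩ := contDiffOn_of_hasFDerivAt hD hh hQ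
  refine ⟨h1, max B C, le_max_of_le_left hB, fun i τ hτ z hz => ?_⟩
  have hpos : 0 < ω i := one_pos.trans_le (hω i)
  rcases Nat.eq_zero_or_pos τ with rfl | hτ0
  · rw [norm_iteratedFDerivWithin_zero, add_zero]
    exact (hC i z hz).trans (mul_le_mul_of_nonneg_right (le_max_right _ _) (by positivity))
  · exact (h2 i τ hτ0 hτ z hz).trans
      (mul_le_mul_of_nonneg_right (le_max_left _ _) (by positivity))

theorem reindex {ω' : ι' → ℝ} {t s : ℕ} {h : ι → V → W} (hh : WeightedCr ω D t s h)
    (σ : ι' → ι) {m : ℝ} (hm : 1 ≤ m) (hω : ∀ i, 1 ≤ ω i) (hω' : ∀ i, 1 ≤ ω' i)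
    (hσ : ∀ i, ω (σ i) ≤ m * ω' i) :
    WeightedCr ω' D t s (fun i => h (σ i)) := by
  obtain ⟨h1, B, hB, h2⟩ := hh
  refine ⟨fun i => h1 _, B * m ^ (s + t), by positivity, fun i τ hτ z hz => ?_⟩
  refine (h2 (σ i) τ hτ z hz).trans ?_
  have p1 : 0 < ω (σ i) := one_pos.trans_le (hω _)
  have p2 : 0 < ω' i := one_pos.trans_le (hω' _)
  rw [mul_assoc]
  refine mul_le_mul_of_nonneg_left ?_ hB
  calc ω (σ i) ^ (s + τ) ≤ (m * ω' i) ^ (s + τ) := pow_le_pow_left₀ p1.le (hσ i) _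
    _ = m ^ (s + τ) * ω' i ^ (s + τ) := mul_pow _ _ _
    _ ≤ m ^ (s + t) * ω' i ^ (s + τ) :=
      mul_le_mul_of_nonneg_right (pow_le_pow_right₀ hm (by omega)) (by positivity)

/-- Faà di Bruno in weighted form: if the derivatives of `p i` of order `τ ≥ 1` are `O(ω i ^ τ)`,
so are those of `g ∘ p i`, for `g` in a family bounded in `C^t`. -/
theorem comp {γ : Type*} {K : Set W₁} (hD : UniqueDiffOn ℝ D) (hK : UniqueDiffOn ℝ K)
    (hω : ∀ i, 1 ≤ ω i) {t : ℕ} {g : γ → W₁ → W} (hg : WeightedCr (fun _ => (1 : ℝ)) K t 0 g)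
    (c : ι → γ) {p : ι → V → W₁} (hpK : ∀ i, MapsTo (p i) D K)
    (hp : ∀ i, ContDiffOn ℝ t (p i) D) {B : ℝ}
    (hB : ∀ i, ∀ τ, 1 ≤ τ → τ ≤ t → ∀ z ∈ D,
      ‖iteratedFDerivWithin ℝ τ (p i) D z‖ ≤ B * ω i ^ τ) :
    WeightedCr ω D t 0 (fun i z => g (c i) (p i z)) := by
  obtain ⟨g1, A, hA, g2⟩ := hg
  refine ⟨fun i => (g1 (c i)).comp (hp i) (hpK i), t.factorial * A * (max B 1) ^ t,
    by positivity, fun i τ hτ z hz => ?_⟩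
  have hpos : 0 < ω i := one_pos.trans_le (hω i)
  have h1 : 1 ≤ max B 1 := le_max_right _ _
  have := norm_iteratedFDerivWithin_comp_le (g1 (c i)) (hp i) (n := τ) (by exact_mod_cast hτ) hK hD
    (hpK i) hz (C := A) (D := max B 1 * ω i)
    (fun j hj => by simpa using g2 (c i) j (hj.trans hτ) _ (hpK i hz))
    (fun j hj1 hj => by
      refine (hB i j hj1 (hj.trans hτ) z hz).trans ?_
      rw [mul_pow]
      refine mul_le_mul_of_nonneg_right ?_ (by positivity)
      exact (le_max_left B 1).trans (le_self_pow₀ h1 (by omega)))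
  refine this.trans ?_
  rw [mul_pow, zero_add, ← mul_assoc]
  refine mul_le_mul_of_nonneg_right ?_ (by positivity)
  have f1 : (τ.factorial : ℝ) ≤ t.factorial := by exact_mod_cast Nat.factorial_le hτ
  have f2 : (max B 1) ^ τ ≤ (max B 1) ^ t := pow_le_pow_right₀ h1 hτ
  exact mul_le_mul (mul_le_mul_of_nonneg_right f1 hA) f2 (by positivity) (by positivity)

end WeightedCr

end Weighted

/-! ### Iterating contraction estimates -/

/-- If a bound `c` always improves to `θ c + η`, then there are bounds tending to `η / (1 - θ)`. -/
theorem exists_seq_of_contracting_bound {A : ℝ → Prop} {θ η c₀ : ℝ} (hθ0 : 0 ≤ θ) (hθ : θ < 1)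
    (hη : 0 ≤ η) (hc₀ : 0 ≤ c₀) (h₀ : A c₀) (step : ∀ c, 0 ≤ c → A c → A (θ * c + η)) :
    ∃ c : ℕ → ℝ, Tendsto c atTop (𝓝 (η / (1 - θ))) ∧ ∀ n, 0 ≤ c n ∧ A (c n) := by
  have hne : 1 - θ ≠ 0 := by linarith
  refine ⟨fun n => θ ^ n * (c₀ - η / (1 - θ)) + η / (1 - θ), ?_, fun n => ?_⟩
  · have := ((tendsto_pow_atTop_nhds_zero_of_lt_one hθ0 hθ).mul_const
      (c₀ - η / (1 - θ))).add_const (η / (1 - θ))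
    simpa using this
  · induction n with
    | zero => simpa using ⟨hc₀, h₀⟩
    | succ n ih =>
      have e : θ ^ (n + 1) * (c₀ - η / (1 - θ)) + η / (1 - θ) =
          θ * (θ ^ n * (c₀ - η / (1 - θ)) + η / (1 - θ)) + η := by
        field_simp; ring
      simp only at ih ⊢
      rw [e]
      exact ⟨add_nonneg (mul_nonneg hθ0 ih.1) hη, step _ ih.1 ih.2⟩

/-- A bound that improves from `c` to `θ c + η` for every `η > 0` improves to every `ε > 0`. -/
theorem exists_bound_lt_of_contracting {A : ℝ → Prop} {θ c₀ : ℝ} (hθ0 : 0 ≤ θ) (hθ : θ < 1)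
    (hc₀ : 0 ≤ c₀) (h₀ : A c₀) (step : ∀ η, 0 < η → ∀ c, 0 ≤ c → A c → A (θ * c + η))
    {ε : ℝ} (hε : 0 < ε) : ∃ c, 0 ≤ c ∧ c < ε ∧ A c := by
  have h1 : 0 < 1 - θ := by linarith
  have hη : 0 < (1 - θ) * (ε / 2) := by positivity
  obtain ⟨c, hc, hA⟩ := exists_seq_of_contracting_bound hθ0 hθ hη.le hc₀ h₀ (step _ hη)
  rw [mul_div_cancel_left₀ _ h1.ne'] at hc
  obtain ⟨n, hn⟩ := (hc.eventually (gt_mem_nhds (half_lt_self hε))).exists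
  exact ⟨c n, (hA n).1, hn, (hA n).2⟩

/-- Contraction principle for families `S : A → E` measured by a weighted supremum over `K`,
within a class of families closed under pointwise limits on `K`. -/
theorem exists_fixedPoint_of_contracting {A E : Type*} [NormedAddCommGroup E] [CompleteSpace E]
    {K : Set A} {wt : A → ℝ} (Γ : (A → E) → A → E) (Good : (A → E) → Prop)
    (hlim : ∀ (S : ℕ → A → E) (T : A → E), (∀ n, Good (S n)) →
      (∀ a ∈ K, Tendsto (fun n => S n a) atTop (𝓝 (T a))) → Good T)
    (hΓ : ∀ S, Good S → Good (Γ S)) {θ : ℝ} (hθ0 : 0 ≤ θ) (hθ : θ < 1)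
    (hcontr : ∀ S T, Good S → Good T → ∀ δ, 0 ≤ δ → (∀ a ∈ K, ‖S a - T a‖ ≤ δ * wt a) →
      ∀ a ∈ K, ‖Γ S a - Γ T a‖ ≤ θ * δ * wt a)
    {C : ℝ} (hC : 0 ≤ C) {S₀ : A → E} (hS₀ : Good S₀)
    (h₀ : ∀ a ∈ K, ‖S₀ a - Γ S₀ a‖ ≤ C * wt a) :
    ∃ S, Good S ∧ ∀ a ∈ K, Γ S a = S a := by
  have h1 : 0 < 1 - θ := by linarith
  set S : ℕ → A → E := fun n => Γ^[n] S₀ with hS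
  have hsucc : ∀ n, S (n + 1) = Γ (S n) := fun n => Function.iterate_succ_apply' Γ n S₀
  have hgood : ∀ n, Good (S n) := by
    intro n
    induction n with
    | zero => exact hS₀
    | succ n ih => rw [hsucc]; exact hΓ _ ih
  have hstep : ∀ n, ∀ a ∈ K, ‖S n a - S (n + 1) a‖ ≤ θ ^ n * C * wt a := by
    intro n
    induction n with
    | zero => simpa [hS] using h₀
    | succ n ih =>
      intro a ha
      rw [hsucc n, hsucc (n + 1)]
      have := hcontr _ _ (hgood n) (hgood (n + 1)) (θ ^ n * C) (by positivity) ih a ha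
      rw [← hsucc n] at this ⊢
      calc _ ≤ _ := this
        _ = _ := by ring
  have hdist : ∀ a ∈ K, ∀ n, dist (S n a) (S (n + 1) a) ≤ (C * wt a) * θ ^ n := by
    intro a ha n
    rw [dist_eq_norm]
    exact (hstep n a ha).trans_eq (by ring)
  have hex : ∀ a, ∃ x, a ∈ K → Tendsto (fun n => S n a) atTop (𝓝 x) := by
    intro a
    by_cases ha : a ∈ K
    · obtain ⟨x, hx⟩ :=
        cauchySeq_tendsto_of_complete (cauchySeq_of_le_geometric θ _ hθ (hdist a ha))
      exact ⟨x, fun _ => hx⟩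
    · exact ⟨0, fun h => absurd h ha⟩
  choose T hT using hex
  have hTgood : Good T := hlim S T hgood hT
  refine ⟨T, hTgood, fun a ha => ?_⟩
  have hclose : ∀ n, ∀ a ∈ K, ‖S n a - T a‖ ≤ (C * θ ^ n / (1 - θ)) * wt a := by
    intro n a ha
    have := dist_le_of_le_geometric_of_tendsto θ _ hθ (hdist a ha) (hT a ha) n
    rw [dist_eq_norm] at this
    exact this.trans_eq (by ring)
  have hlim2 : Tendsto (fun n => S (n + 1) a) atTop (𝓝 (Γ T a)) := by
    rw [tendsto_iff_norm_sub_tendsto_zero]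
    have h0 : Tendsto (fun n : ℕ => θ * (C * θ ^ n / (1 - θ)) * wt a) atTop (𝓝 0) := by
      have := ((((tendsto_pow_atTop_nhds_zero_of_lt_one hθ0 hθ).const_mul C).div_const
        (1 - θ)).const_mul θ).mul_const (wt a)
      simpa using this
    refine squeeze_zero (fun _ => norm_nonneg _) (fun n => ?_) h0
    rw [hsucc]
    exact hcontr _ _ (hgood n) hTgood _ (by positivity) (hclose n) a ha
  exact tendsto_nhds_unique hlim2 ((tendsto_add_atTop_iff_nat 1).2 (hT a ha))

/-! ### Affine equations that contract in a weighted norm -/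

section Affine

variable {ι κ : Type*} [Fintype κ] {ω : ι → ℝ} {σ : ι → κ → ι} {θ : ℝ}

/-- The linear operator `Q ↦ (∑ k, ℓ i k (Q (σ i k)))_i` on families indexed by `ι` contracts with
factor `θ` in the supremum norm with weight `ω ^ s`. -/
def WeightContracts {E : Type*} [NormedAddCommGroup E] [NormedSpace ℝ E] (ω : ι → ℝ)
    (σ : ι → κ → ι) (θ : ℝ) (s : ℕ) (ℓ : ι → κ → E →L[ℝ] E) : Prop :=
  ∀ i, ∀ Q : κ → E, (∀ k, ‖Q k‖ ≤ ω (σ i k) ^ s) → ‖∑ k, ℓ i k (Q k)‖ ≤ θ * ω i ^ s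

namespace WeightContracts

section

variable {E : Type*} [NormedAddCommGroup E] [NormedSpace ℝ E] {s : ℕ} {ℓ : ι → κ → E →L[ℝ] E}

theorem norm_sum_apply_le (h : WeightContracts ω σ θ s ℓ) {c : ℝ} (hc : 0 ≤ c)
    (i : ι) {Q : κ → E} (hQ : ∀ k, ‖Q k‖ ≤ c * ω (σ i k) ^ s) :
    ‖∑ k, ℓ i k (Q k)‖ ≤ θ * (c * ω i ^ s) := by
  rcases hc.eq_or_lt with rfl | hc
  · have : ∀ k, Q k = 0 := fun k => by simpa using hQ k
    simp [this]
  · have := h i (fun k => c⁻¹ • Q k) (fun k => by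
      rw [norm_smul, norm_inv, Real.norm_of_nonneg hc.le, inv_mul_le_iff₀ hc]
      exact hQ k)
    simp only [map_smul, ← Finset.smul_sum] at this
    rw [norm_smul, norm_inv, Real.norm_of_nonneg hc.le, inv_mul_le_iff₀ hc] at this
    linarith

/-- Contraction passes to linear maps with values in the original space. -/
theorem compL (h : WeightContracts ω σ θ s ℓ) (hω : ∀ i, 1 ≤ ω i) (hθ0 : 0 ≤ θ) (V : Type*)
    [NormedAddCommGroup V] [NormedSpace ℝ V] :
    WeightContracts ω σ θ s (fun i k => ContinuousLinearMap.compL ℝ V E E (ℓ i k)) := by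
  intro i Q hQ
  have hpos : 0 < ω i := one_pos.trans_le (hω i)
  refine ContinuousLinearMap.opNorm_le_bound _ (by positivity) fun v => ?_
  have e : (∑ k, ContinuousLinearMap.compL ℝ V E E (ℓ i k) (Q k)) v =
      ∑ k, ℓ i k (Q k v) := by
    simp
  rw [e]
  have := h.norm_sum_apply_le (norm_nonneg v) i (Q := fun k => Q k v) fun k => by
    refine ((Q k).le_opNorm v).trans ?_
    rw [mul_comm]
    exact mul_le_mul_of_nonneg_left (hQ k) (norm_nonneg v)
  exact this.trans_eq (by ring)

/-- An affine equation whose linear part contracts has a solution bounded by the weight. -/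
theorem exists_solution [CompleteSpace E] (h : WeightContracts ω σ θ s ℓ) (hω : ∀ i, 1 ≤ ω i)
    (hθ0 : 0 ≤ θ) (hθ : θ < 1) {c : ι → E} {C : ℝ} (hC : 0 ≤ C) (hc : ∀ i, ‖c i‖ ≤ C * ω i ^ s) :
    ∃ Q : ι → E, (∀ i, Q i = c i + ∑ k, ℓ i k (Q (σ i k))) ∧
      ∀ i, ‖Q i‖ ≤ C / (1 - θ) * ω i ^ s := by
  have h1 : 0 < 1 - θ := by linarith
  have hpos : ∀ i, 0 < ω i := fun i => one_pos.trans_le (hω i)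
  obtain ⟨Q, hQ, hfix⟩ := exists_fixedPoint_of_contracting (K := univ) (wt := fun i => ω i ^ s)
    (fun Q i => c i + ∑ k, ℓ i k (Q (σ i k))) (fun Q => ∀ i, ‖Q i‖ ≤ C / (1 - θ) * ω i ^ s)
    (fun S T hS hT i => le_of_tendsto (hT i trivial).norm (Eventually.of_forall fun n => hS n i))
    (fun S hS i => by
      refine (norm_add_le _ _).trans ((add_le_add (hc i)
        (h.norm_sum_apply_le (by positivity) i fun k => hS _)).trans_eq ?_)
      field_simp; ring)
    hθ0 hθ
    (fun S T hS hT δ hδ hST i _ => by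
      rw [add_sub_add_left_eq_sub, ← Finset.sum_sub_distrib]
      simp only [← map_sub]
      exact (h.norm_sum_apply_le hδ i fun k => hST _ trivial).trans_eq (by ring))
    hC (S₀ := fun _ => 0) (fun i => by
      have := hpos i
      rw [norm_zero]; positivity)
    (fun i _ => by simpa using hc i)
  exact ⟨Q, fun i => (hfix i trivial).symm, hQ⟩

/-- A family that satisfies a contracting affine equation up to `o(z' - z)` is differentiable at
`z`, and its derivatives are the solution of the linearised equation. The remainder of index `i`
is controlled only eventually, in a neighbourhood of `z` that may depend on `i`; the bound
`c ω ^ s ‖z' - z‖` for the remainders then improves to `(θ c + η) ω ^ s ‖z' - z‖` for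
every `η > 0`. -/
theorem hasFDerivAt {V : Type*} [NormedAddCommGroup V] [NormedSpace ℝ V]
    (h : WeightContracts ω σ θ s ℓ) (hω : ∀ i, 1 ≤ ω i) (hθ0 : 0 ≤ θ) (hθ : θ < 1)
    {z : V} {w : ι → V → E} {c Q : ι → V →L[ℝ] E}
    {B : ℝ} (hB : 0 ≤ B) (hw : ∀ i, ∀ᶠ z' in 𝓝 z, ‖w i z' - w i z‖ ≤ B * ω i ^ s * ‖z' - z‖)
    {C : ℝ} (hC : 0 ≤ C) (hQ : ∀ i, ‖Q i‖ ≤ C * ω i ^ s)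
    (hQeq : ∀ i, Q i = c i + ∑ k, (ℓ i k).comp (Q (σ i k)))
    (hlin : ∀ i, (fun z' => w i z' - w i z - (c i (z' - z) +
      ∑ k, ℓ i k (w (σ i k) z' - w (σ i k) z))) =o[𝓝 z] fun z' => z' - z) (i : ι) :
    HasFDerivAt (w i) (Q i) z := by
  have hpos : ∀ i, 0 < ω i := fun i => one_pos.trans_le (hω i)
  rw [hasFDerivAt_iff_isLittleO, isLittleO_iff]
  intro ε hε
  have hε' : 0 < ε / ω i ^ s := by have := hpos i; positivity
  obtain ⟨b, hb0, hb, hA⟩ := exists_bound_lt_of_contracting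
    (A := fun b => ∀ i, ∀ᶠ z' in 𝓝 z,
      ‖w i z' - w i z - Q i (z' - z)‖ ≤ b * ω i ^ s * ‖z' - z‖) (c₀ := B + C)
    hθ0 hθ (add_nonneg hB hC)
    (fun i => (hw i).mono fun z' hz' => by
      have e : ‖Q i (z' - z)‖ ≤ C * ω i ^ s * ‖z' - z‖ :=
        ((Q i).le_opNorm _).trans (mul_le_mul_of_nonneg_right (hQ i) (norm_nonneg _))
      calc _ ≤ _ := norm_sub_le _ _
        _ ≤ _ := add_le_add hz' e
        _ = _ := by ring)
    (fun η hη b hb hA i => by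
      have hall : ∀ᶠ z' in 𝓝 z, ∀ k, ‖w (σ i k) z' - w (σ i k) z - Q (σ i k) (z' - z)‖ ≤
          b * ω (σ i k) ^ s * ‖z' - z‖ := eventually_all.2 fun k => hA _
      filter_upwards [hall, (isLittleO_iff.1 (hlin i)) hη] with z' h1 h2
      have e : w i z' - w i z - Q i (z' - z) =
          (w i z' - w i z - (c i (z' - z) + ∑ k, ℓ i k (w (σ i k) z' - w (σ i k) z))) +
          ∑ k, ℓ i k (w (σ i k) z' - w (σ i k) z - Q (σ i k) (z' - z)) := by
        rw [hQeq i]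
        simp only [map_sub, Finset.sum_sub_distrib, add_apply,
          sum_apply, ContinuousLinearMap.comp_apply]
        abel
      rw [e]
      have h3 := h.norm_sum_apply_le (c := b * ‖z' - z‖) (by positivity) i
        (Q := fun k => w (σ i k) z' - w (σ i k) z - Q (σ i k) (z' - z))
        (fun k => (h1 k).trans_eq (by ring))
      have h4 : 1 ≤ ω i ^ s := one_le_pow₀ (hω i)
      have h5 : η * ‖z' - z‖ ≤ η * ‖z' - z‖ * ω i ^ s :=
        le_mul_of_one_le_right (by positivity) h4
      calc _ ≤ _ := norm_add_le _ _
        _ ≤ _ := add_le_add (h2.trans h5) h3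
        _ = _ := by ring) hε'
  filter_upwards [hA i] with z' hz'
  refine hz'.trans (mul_le_mul_of_nonneg_right ?_ (norm_nonneg _))
  have := (lt_div_iff₀ (by have := hpos i; positivity)).1 hb
  exact this.le

end

/-- Weight-bounded solutions of a contracting affine equation with continuous coefficients are
continuous. -/
theorem continuousOn {V E : Type*} [TopologicalSpace V] {D : Set V} [NormedAddCommGroup E]
    [NormedSpace ℝ E] {s : ℕ}
    {ℓ : ι → κ → V → E →L[ℝ] E} (h : ∀ z ∈ D, WeightContracts ω σ θ s fun i k => ℓ i k z)
    (hω : ∀ i, 1 ≤ ω i) (hθ0 : 0 ≤ θ) (hθ : θ < 1)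
    {c P : ι → V → E} (hP : ∀ i, ∀ z ∈ D, P i z = c i z + ∑ k, ℓ i k z (P (σ i k) z))
    {C : ℝ} (hC : 0 ≤ C) (hPC : ∀ i, ∀ z ∈ D, ‖P i z‖ ≤ C * ω i ^ s)
    (hc : ∀ i, ContinuousOn (c i) D) (hℓ : ∀ i k, ContinuousOn (ℓ i k) D) (i : ι) :
    ContinuousOn (P i) D := by
  have hpos : ∀ i, 0 < ω i := fun i => one_pos.trans_le (hω i)
  intro z hz
  rw [ContinuousWithinAt, tendsto_iff_norm_sub_tendsto_zero]
  rw [Metric.tendsto_nhds]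
  intro ε hε
  have hε' : 0 < ε / ω i ^ s := by have := hpos i; positivity
  obtain ⟨b, hb0, hb, hA⟩ := exists_bound_lt_of_contracting
    (A := fun b => ∀ i, ∀ᶠ z' in 𝓝[D] z, ‖P i z' - P i z‖ ≤ b * ω i ^ s) (c₀ := C + C)
    hθ0 hθ (add_nonneg hC hC)
    (fun i => by
      filter_upwards [self_mem_nhdsWithin] with z' hz'
      rw [add_mul]
      exact (norm_sub_le _ _).trans (add_le_add (hPC i z' hz') (hPC i z hz)))
    (fun η hη b hb hA i => by
      have hall : ∀ᶠ z' in 𝓝[D] z, ∀ k, ‖P (σ i k) z' - P (σ i k) z‖ ≤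
          b * ω (σ i k) ^ s := eventually_all.2 fun k => hA _
      -- The terms coming from the coefficients tend to zero because the solution is bounded.
      have hsmall : Tendsto (fun z' => ‖c i z' - c i z‖ +
          ∑ k, ‖ℓ i k z' - ℓ i k z‖ * (C * ω (σ i k) ^ s)) (𝓝[D] z) (𝓝 0) := by
        have t1 := tendsto_iff_norm_sub_tendsto_zero.1 (hc i z hz)
        have t2 : Tendsto (fun z' => ∑ k, ‖ℓ i k z' - ℓ i k z‖ * (C * ω (σ i k) ^ s))
            (𝓝[D] z) (𝓝 (∑ k : κ, 0 * (C * ω (σ i k) ^ s))) :=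
          tendsto_finsetSum _ fun k _ =>
            (tendsto_iff_norm_sub_tendsto_zero.1 (hℓ i k z hz)).mul_const _
        simpa using t1.add t2
      filter_upwards [hall, self_mem_nhdsWithin, hsmall.eventually (gt_mem_nhds hη)]
        with z' h1 hz' h2
      have e : P i z' - P i z = ((c i z' - c i z) +
          ∑ k, (ℓ i k z' - ℓ i k z) (P (σ i k) z')) +
          ∑ k, ℓ i k z (P (σ i k) z' - P (σ i k) z) := by
        rw [hP i z hz, hP i z' hz']
        simp only [map_sub, Finset.sum_sub_distrib, sub_apply]
        abel
      rw [e]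
      have h3 := h z hz |>.norm_sum_apply_le hb i (Q := fun k => P (σ i k) z' - P (σ i k) z) h1
      have h4 : 1 ≤ ω i ^ s := one_le_pow₀ (hω i)
      have h6 : ‖(c i z' - c i z) + ∑ k, (ℓ i k z' - ℓ i k z) (P (σ i k) z')‖ ≤ η := by
        refine (norm_add_le _ _).trans (le_trans ?_ h2.le)
        refine add_le_add le_rfl ((norm_sum_le _ _).trans (Finset.sum_le_sum fun k _ => ?_))
        exact (ContinuousLinearMap.le_opNorm _ _).trans
          (mul_le_mul_of_nonneg_left (hPC _ z' hz') (norm_nonneg _))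
      calc _ ≤ _ := norm_add_le _ _
        _ ≤ _ := add_le_add (h6.trans (le_mul_of_one_le_right hη.le h4)) h3
        _ = _ := by ring) hε'
  filter_upwards [hA i] with z' hz'
  rw [dist_zero_right, norm_norm]
  refine hz'.trans_lt ?_
  exact (lt_div_iff₀ (by have := hpos i; positivity)).1 hb

end WeightContracts

end Affine

/-! ### Regularity of solutions of contracting equations -/

theorem WeightedCr.exists_lipschitz {ι V W : Type*} [NormedAddCommGroup V] [NormedSpace ℝ V]
    [NormedAddCommGroup W] [NormedSpace ℝ W] {ω : ι → ℝ} {D : Set V} (hD : UniqueDiffOn ℝ D)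
    {t s : ℕ} {h : ι → V → W} (hh : WeightedCr ω D (t + 1) s h) :
    ∃ B : ℝ, 0 ≤ B ∧ ∀ i, ∀ S ⊆ D, Convex ℝ S → ∀ z ∈ S, ∀ z' ∈ S,
      ‖h i z' - h i z‖ ≤ B * ω i ^ (s + 1) * ‖z' - z‖ := by
  obtain ⟨B, hB, h2⟩ := (hh.fderivWithin hD).norm_le
  refine ⟨B, hB, fun i S hSD hS z hz z' hz' => ?_⟩
  have hd : DifferentiableOn ℝ (h i) D := (hh.1 i).differentiableOn (by simp)
  exact hS.norm_image_sub_le_of_norm_hasFDerivWithin_le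
    (fun x hx => (hd x (hSD hx)).hasFDerivWithinAt.mono hSD) (fun x hx => h2 i x (hSD hx)) hz hz'

section Regularity

universe u

variable {ι κ : Type*} [Fintype κ] {ω : ι → ℝ} {σ : ι → κ → ι} {θ m : ℝ}
  {V : Type u} [NormedAddCommGroup V] [NormedSpace ℝ V] {D : Set V}

/-- Weight-bounded solutions of an affine equation with `C^1` coefficients that contracts with the
weight `ω ^ (s + 1)` are Lipschitz with that weight. -/
theorem WeightContracts.exists_lipschitz {E : Type*} [NormedAddCommGroup E] [NormedSpace ℝ E]
    {s : ℕ} {ℓ : ι → κ → V → E →L[ℝ] E} (hD : IsOpen D)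
    (h : ∀ z ∈ D, WeightContracts ω σ θ (s + 1) fun i k => ℓ i k z)
    (hω : ∀ i, 1 ≤ ω i) (hθ0 : 0 ≤ θ) (hθ : θ < 1) (hm : 1 ≤ m)
    (hσ : ∀ i k, ω (σ i k) ≤ m * ω i)
    {c P : ι → V → E} (hP : ∀ i, ∀ z ∈ D, P i z = c i z + ∑ k, ℓ i k z (P (σ i k) z))
    {C : ℝ} (hC : 0 ≤ C) (hPC : ∀ i, ∀ z ∈ D, ‖P i z‖ ≤ C * ω i ^ s)
    (hc : WeightedCr ω D 1 s c) (hℓ : ∀ k, WeightedCr ω D 1 0 fun i => ℓ i k) :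
    ∃ B : ℝ, 0 ≤ B ∧ ∀ z ∈ D, ∀ᶠ z' in 𝓝 z, z' ∈ D ∧
      ∀ i, ‖P i z' - P i z‖ ≤ B * ω i ^ (s + 1) * ‖z' - z‖ := by
  have hpos : ∀ i, 0 < ω i := fun i => one_pos.trans_le (hω i)
  obtain ⟨Bc, hBc, hc'⟩ := hc.exists_lipschitz hD.uniqueDiffOn (t := 0)
  choose Bℓ hBℓ hℓ' using fun k => (hℓ k).exists_lipschitz hD.uniqueDiffOn (t := 0)
  set N : ℝ := Bc + ∑ k, Bℓ k * (C * m ^ s) with hN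
  have hN0 : 0 ≤ N := add_nonneg hBc (Finset.sum_nonneg fun k _ => by have := hBℓ k; positivity)
  have h1θ : 0 < 1 - θ := by linarith
  refine ⟨N / (1 - θ), by positivity, fun z hz => ?_⟩
  obtain ⟨ρ, hρ, hball⟩ := Metric.isOpen_iff.1 hD z hz
  filter_upwards [ball_mem_nhds z hρ] with z' hz'
  refine ⟨hball hz', fun i => ?_⟩
  obtain ⟨b, hb, hA⟩ := exists_seq_of_contracting_bound
    (A := fun b => ∀ i, ‖P i z' - P i z‖ ≤ b * ω i ^ (s + 1)) (c₀ := C + C) (η := N * ‖z' - z‖)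
    hθ0 hθ (by positivity) (add_nonneg hC hC)
    (fun i => by
      have e : ω i ^ s ≤ ω i ^ (s + 1) := pow_le_pow_right₀ (hω i) (Nat.le_succ s)
      calc _ ≤ _ := norm_sub_le _ _
        _ ≤ _ := add_le_add (hPC i z' (hball hz')) (hPC i z hz)
        _ = (C + C) * ω i ^ s := by ring
        _ ≤ _ := mul_le_mul_of_nonneg_left e (by positivity))
    (fun b hb hA i => by
      have e : P i z' - P i z = ((c i z' - c i z) +
          ∑ k, (ℓ i k z' - ℓ i k z) (P (σ i k) z')) +
          ∑ k, ℓ i k z (P (σ i k) z' - P (σ i k) z) := by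
        rw [hP i z hz, hP i z' (hball hz')]
        simp only [map_sub, Finset.sum_sub_distrib, sub_apply]
        abel
      rw [e]
      have h3 := (h z hz).norm_sum_apply_le hb i
        (Q := fun k => P (σ i k) z' - P (σ i k) z) (fun k => hA _)
      have h4 : ‖c i z' - c i z‖ ≤ Bc * ω i ^ (s + 1) * ‖z' - z‖ :=
        hc' i _ hball (convex_ball z ρ) z (mem_ball_self hρ) z' hz'
      have h5 : ∀ k, ‖(ℓ i k z' - ℓ i k z) (P (σ i k) z')‖ ≤
          Bℓ k * (C * m ^ s) * (ω i ^ (s + 1) * ‖z' - z‖) := fun k => by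
        have q1 : ‖ℓ i k z' - ℓ i k z‖ ≤ Bℓ k * ω i ^ (0 + 1) * ‖z' - z‖ :=
          hℓ' k i _ hball (convex_ball z ρ) z (mem_ball_self hρ) z' hz'
        have q2 : ‖P (σ i k) z'‖ ≤ C * (m * ω i) ^ s :=
          (hPC _ z' (hball hz')).trans
            (mul_le_mul_of_nonneg_left (pow_le_pow_left₀ (hpos _).le (hσ i k) s) hC)
        have := hpos i
        have := hBℓ k
        calc _ ≤ _ := ContinuousLinearMap.le_opNorm _ _
          _ ≤ (Bℓ k * ω i ^ (0 + 1) * ‖z' - z‖) * (C * (m * ω i) ^ s) :=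
            mul_le_mul q1 q2 (norm_nonneg _) (by positivity)
          _ = _ := by rw [mul_pow]; ring
      have h6 : ‖(c i z' - c i z) + ∑ k, (ℓ i k z' - ℓ i k z) (P (σ i k) z')‖ ≤
          N * (ω i ^ (s + 1) * ‖z' - z‖) := by
        rw [hN, add_mul, Finset.sum_mul]
        refine (norm_add_le _ _).trans (add_le_add (h4.trans_eq (by ring)) ?_)
        exact (norm_sum_le _ _).trans (Finset.sum_le_sum fun k _ => h5 k)
      calc _ ≤ _ := norm_add_le _ _
        _ ≤ _ := add_le_add h6 h3
        _ = _ := by ring)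
  have hlim : Tendsto (fun n => b n * ω i ^ (s + 1)) atTop
      (𝓝 (N * ‖z' - z‖ / (1 - θ) * ω i ^ (s + 1))) := hb.mul_const _
  refine (ge_of_tendsto' hlim fun n => (hA n).2 i).trans_eq ?_
  ring

/-- Weight-bounded solutions of a contracting affine equation inherit the regularity of its
coefficients. Differentiating the equation gives an affine equation of the same kind for the
derivatives, with the weight `ω ^ (s + 1)`, whence the induction on `t`. -/
theorem WeightContracts.weightedCr (hD : IsOpen D) (hω : ∀ i, 1 ≤ ω i) (hθ0 : 0 ≤ θ) (hθ : θ < 1)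
    (hm : 1 ≤ m) (hσ : ∀ i k, ω (σ i k) ≤ m * ω i) (t : ℕ) :
    ∀ {E : Type u} [NormedAddCommGroup E] [NormedSpace ℝ E] [CompleteSpace E]
      {s : ℕ} {ℓ : ι → κ → V → E →L[ℝ] E} {c P : ι → V → E} {C : ℝ},
      (∀ z ∈ D, ∀ s', s ≤ s' → s' ≤ s + t → WeightContracts ω σ θ s' fun i k => ℓ i k z) →
      (∀ i, ∀ z ∈ D, P i z = c i z + ∑ k, ℓ i k z (P (σ i k) z)) →
      0 ≤ C → (∀ i, ∀ z ∈ D, ‖P i z‖ ≤ C * ω i ^ s) →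
      WeightedCr ω D t s c → (∀ k, WeightedCr ω D t 0 fun i => ℓ i k) →
      WeightedCr ω D t s P := by
  have hpos : ∀ i, 0 < ω i := fun i => one_pos.trans_le (hω i)
  have hU : UniqueDiffOn ℝ D := hD.uniqueDiffOn
  induction t with
  | zero =>
    intro E _ _ _ s ℓ c P C h hP hC hPC hc hℓ
    have := WeightContracts.continuousOn (fun z hz => h z hz s le_rfl le_rfl) hω hθ0 hθ hP hC hPC
      (fun i => (hc.1 i).continuousOn) (fun i k => ((hℓ k).1 i).continuousOn)
    refine ⟨fun i => contDiffOn_zero.2 (this i), C, hC, fun i τ hτ z hz => ?_⟩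
    obtain rfl : τ = 0 := by omega
    simpa using hPC i z hz
  | succ t ih =>
    intro E _ _ _ s ℓ c P C h hP hC hPC hc hℓ
    have hPt : WeightedCr ω D t s P :=
      ih (fun z hz s' h1 h2 => h z hz s' h1 (by omega)) hP hC hPC (hc.mono (Nat.le_succ t))
        (fun k => (hℓ k).mono (Nat.le_succ t))
    obtain ⟨B, hB, hlip⟩ := WeightContracts.exists_lipschitz hD
      (fun z hz => h z hz (s + 1) (by omega) (by omega)) hω hθ0 hθ hm hσ hP hC hPC
      (hc.mono (by omega)) (fun k => (hℓ k).mono (by omega))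
    set c' : ι → V → V →L[ℝ] E := fun i z => fderivWithin ℝ (c i) D z +
      ∑ k, (fderivWithin ℝ (ℓ i k) D z).flip (P (σ i k) z) with hc'
    have hcW : WeightedCr ω D t (s + 1) c' := by
      refine (hc.fderivWithin hU).add hU (WeightedCr.sum hU hω _ fun k => ?_)
      have h1 := (hℓ k).fderivWithin hU
      have h2 := hPt.reindex (fun i => σ i k) hm hω hω (fun i => hσ i k)
      have h3 := WeightedCr.bilin hU
        ((ContinuousLinearMap.flipₗᵢ ℝ V E E :
          (V →L[ℝ] E →L[ℝ] E) →L[ℝ] (E →L[ℝ] V →L[ℝ] E))) hω h1 h2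
      rw [show s + 1 = 0 + 1 + s by omega]
      exact h3
    set ℓ' : ι → κ → V → (V →L[ℝ] E) →L[ℝ] (V →L[ℝ] E) :=
      fun i k z => ContinuousLinearMap.compL ℝ V E E (ℓ i k z) with hℓ'
    have hℓW : ∀ k, WeightedCr ω D t 0 fun i => ℓ' i k := fun k => by
      have h1 := WeightedCr.clm (W := (V →L[ℝ] E) →L[ℝ] (V →L[ℝ] E)) hU hω
        (ContinuousLinearMap.compL ℝ V E E) ((hℓ k).mono (Nat.le_succ t))
      exact h1
    have hℓC : ∀ z ∈ D, ∀ s', s + 1 ≤ s' → s' ≤ s + 1 + t →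
        WeightContracts ω σ θ s' fun i k => ℓ' i k z := fun z hz s' h1 h2 =>
      (h z hz s' (by omega) (by omega)).compL hω hθ0 V
    obtain ⟨A, hA, hcA⟩ := hcW.norm_le
    have hex : ∀ z, ∃ Q : ι → V →L[ℝ] E, z ∈ D →
        (∀ i, Q i = c' i z + ∑ k, ℓ' i k z (Q (σ i k))) ∧
        ∀ i, ‖Q i‖ ≤ A / (1 - θ) * ω i ^ (s + 1) := by
      intro z
      by_cases hz : z ∈ D
      · obtain ⟨Q, h1, h2⟩ := (hℓC z hz (s + 1) le_rfl (by omega)).exists_solution hω hθ0 hθ hA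
          (fun i => hcA i z hz)
        exact ⟨Q, fun _ => ⟨h1, h2⟩⟩
      · exact ⟨0, fun h => absurd h hz⟩
    choose Q hQ using hex
    have hA' : 0 ≤ A / (1 - θ) := div_nonneg hA (by linarith)
    have hQW : WeightedCr ω D t (s + 1) fun i z => Q z i :=
      ih hℓC (fun i z hz => (hQ z hz).1 i) hA' (fun i z hz => (hQ z hz).2 i) hcW hℓW
    have hder : ∀ i, ∀ z ∈ D, HasFDerivAt (P i) (Q z i) z := by
      intro i z hz
      refine (h z hz (s + 1) (by omega) (by omega)).hasFDerivAt hω hθ0 hθ hB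
        (fun i => (hlip z hz).mono fun z' hz' => hz'.2 i) hA' (hQ z hz).2
        (c := fun i => c' i z) (fun i => (hQ z hz).1 i) (fun i => ?_) i
      have hdc : HasFDerivAt (c i) (fderivWithin ℝ (c i) D z) z := by
        rw [fderivWithin_of_isOpen hD hz]
        exact (((hc.1 i).differentiableOn (by simp)).differentiableAt (hD.mem_nhds hz)).hasFDerivAt
      have hdℓ : ∀ k, HasFDerivAt (ℓ i k) (fderivWithin ℝ (ℓ i k) D z) z := fun k => by
        rw [fderivWithin_of_isOpen hD hz]
        exact ((((hℓ k).1 i).differentiableOn (by simp)).differentiableAt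
          (hD.mem_nhds hz)).hasFDerivAt
      -- `ℓ z' (P z') - ℓ z (P z)` is split so that only `ℓ` is differentiated.
      have ht1 : ∀ k, (fun z' => (ℓ i k z' - ℓ i k z - fderivWithin ℝ (ℓ i k) D z (z' - z))
          (P (σ i k) z')) =o[𝓝 z] fun z' => z' - z := fun k => by
        refine IsBigO.trans_isLittleO (g := fun z' => ℓ i k z' - ℓ i k z -
          fderivWithin ℝ (ℓ i k) D z (z' - z)) ?_ (hdℓ k).isLittleO
        refine IsBigO.of_bound (C * ω (σ i k) ^ s) ?_
        filter_upwards [hD.mem_nhds hz] with z' hz'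
        refine (ContinuousLinearMap.le_opNorm _ _).trans ?_
        rw [mul_comm]
        exact mul_le_mul_of_nonneg_right (hPC _ z' hz') (norm_nonneg _)
      have ht2 : ∀ k, (fun z' => fderivWithin ℝ (ℓ i k) D z (z' - z)
          (P (σ i k) z' - P (σ i k) z)) =o[𝓝 z] fun z' => z' - z := fun k => by
        rw [isLittleO_iff]
        intro ε hε
        have hcont : Tendsto (fun z' => ‖fderivWithin ℝ (ℓ i k) D z‖ *
            (B * ω (σ i k) ^ (s + 1) * ‖z' - z‖)) (𝓝 z) (𝓝 0) := by
          have : Continuous fun z' => ‖fderivWithin ℝ (ℓ i k) D z‖ *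
            (B * ω (σ i k) ^ (s + 1) * ‖z' - z‖) := by fun_prop
          simpa using this.tendsto z
        filter_upwards [hlip z hz, hcont.eventually (gt_mem_nhds hε)] with z' h1 h2
        calc _ ≤ ‖fderivWithin ℝ (ℓ i k) D z (z' - z)‖ * ‖P (σ i k) z' - P (σ i k) z‖ :=
              ContinuousLinearMap.le_opNorm _ _
          _ ≤ (‖fderivWithin ℝ (ℓ i k) D z‖ * ‖z' - z‖) *
              (B * ω (σ i k) ^ (s + 1) * ‖z' - z‖) :=
            mul_le_mul (ContinuousLinearMap.le_opNorm _ _) (h1.2 _) (norm_nonneg _) (by positivity)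
          _ = (‖fderivWithin ℝ (ℓ i k) D z‖ *
              (B * ω (σ i k) ^ (s + 1) * ‖z' - z‖)) * ‖z' - z‖ := by ring
          _ ≤ _ := mul_le_mul_of_nonneg_right h2.le (norm_nonneg _)
      have hsum := hdc.isLittleO.add (IsLittleO.fun_sum (s := Finset.univ)
        fun k _ => (ht1 k).add (ht2 k))
      refine hsum.congr' ?_ EventuallyEq.rfl
      filter_upwards [hD.mem_nhds hz] with z' hz'
      rw [hP i z hz, hP i z' hz']
      simp only [hc', map_sub, Finset.sum_sub_distrib, sub_apply, add_apply, sum_apply,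
        ContinuousLinearMap.flip_apply, Finset.sum_add_distrib]
      abel
    exact WeightedCr.of_hasFDerivAt hD hder hω hPC hQW

/-- Regularity of the solutions of a nonlinear equation
`w i = b i + ∑ k, (A i k (g (p (σ i k))) + C i k (w (σ i k)))`, where `p i` is an affine image
of `w i`, whose linearisation contracts in the norms with weights `ω, …, ω ^ (r + 1)`. -/
theorem exists_hasFDerivAt_weightedCr {γ : Type*} {E F H : Type u}
    [NormedAddCommGroup E] [NormedSpace ℝ E] [CompleteSpace E]
    [NormedAddCommGroup F] [NormedSpace ℝ F] [NormedAddCommGroup H] [NormedSpace ℝ H]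
    (hD : IsOpen D) (hω : ∀ i, 1 ≤ ω i) (hθ0 : 0 ≤ θ) (hθ : θ < 1)
    (hm : 1 ≤ m) (hσ : ∀ i k, ω (σ i k) ≤ m * ω i) {r : ℕ} {K : Set F} (hK : UniqueDiffOn ℝ K)
    {g : γ → F → H} (hg : WeightedCr (fun _ => (1 : ℝ)) K (r + 1) 0 g) (cc : ι → γ)
    {A : ι → κ → H →L[ℝ] E} {C : ι → κ → E →L[ℝ] E} {b : ι → V →L[ℝ] E} {M : ℝ}
    (hA : ∀ i k, ‖A i k‖ ≤ M) (hCM : ∀ i k, ‖C i k‖ ≤ M) (hb : ∀ i, ‖b i‖ ≤ M)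
    {w : ι → V → E} {p : ι → V → F} (hpK : ∀ i, MapsTo (p i) D K) {J : E →L[ℝ] F} {e : ι → F}
    (hp : ∀ i, ∀ z ∈ D, p i z = J (w i z) + e i)
    (hw : ∀ i, ∀ z ∈ D, w i z = b i z +
      ∑ k, (A i k (g (cc (σ i k)) (p (σ i k) z)) + C i k (w (σ i k) z)))
    {B : ℝ} (hB : 0 ≤ B)
    (hlip : ∀ i, ∀ z ∈ D, ∀ᶠ z' in 𝓝 z, ‖w i z' - w i z‖ ≤ B * ω i * ‖z' - z‖)
    (hcontr : ∀ z ∈ D, ∀ s, 1 ≤ s → s ≤ r + 1 → WeightContracts ω σ θ s fun i k =>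
      (A i k).comp ((fderivWithin ℝ (g (cc (σ i k))) K (p (σ i k) z)).comp J) + C i k) :
    ∃ Q : ι → V → V →L[ℝ] E, (∀ i, ∀ z ∈ D, HasFDerivAt (w i) (Q i z) z) ∧
      WeightedCr ω D r 1 Q := by
  have hpos : ∀ i, 0 < ω i := fun i => one_pos.trans_le (hω i)
  have hU : UniqueDiffOn ℝ D := hD.uniqueDiffOn
  set ℓ : ι → κ → V → E →L[ℝ] E := fun i k z =>
    (A i k).comp ((fderivWithin ℝ (g (cc (σ i k))) K (p (σ i k) z)).comp J) + C i k with hℓ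
  set ℓ' : ι → κ → V → (V →L[ℝ] E) →L[ℝ] (V →L[ℝ] E) :=
    fun i k z => ContinuousLinearMap.compL ℝ V E E (ℓ i k z) with hℓ'
  have hℓC : ∀ z ∈ D, ∀ s, 1 ≤ s → s ≤ r + 1 →
      WeightContracts ω σ θ s fun i k => ℓ' i k z := fun z hz s h1 h2 =>
    (hcontr z hz s h1 h2).compL hω hθ0 V
  have hbM : ∀ i, ‖b i‖ ≤ max M 0 * ω i ^ 1 := fun i => by
    rw [pow_one]
    exact ((hb i).trans (le_max_left _ _)).trans
      (le_mul_of_one_le_right (le_max_right _ _) (hω i))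
  have hex : ∀ z, ∃ Q : ι → V →L[ℝ] E, z ∈ D →
      (∀ i, Q i = b i + ∑ k, ℓ' i k z (Q (σ i k))) ∧
      ∀ i, ‖Q i‖ ≤ max M 0 / (1 - θ) * ω i ^ 1 := by
    intro z
    by_cases hz : z ∈ D
    · obtain ⟨Q, h1, h2⟩ := (hℓC z hz 1 le_rfl (by omega)).exists_solution hω hθ0 hθ
        (le_max_right M 0) hbM
      exact ⟨Q, fun _ => ⟨h1, h2⟩⟩
    · exact ⟨0, fun h => absurd h hz⟩
  choose Q hQ using hex
  have hM' : 0 ≤ max M 0 / (1 - θ) := div_nonneg (le_max_right _ _) (by linarith)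
  have hpB : ∀ i, ∀ z ∈ D, (fun z' => p i z' - p i z) =O[𝓝 z] fun z' => z' - z := by
    intro i z hz
    have h1 : (fun z' => w i z' - w i z) =O[𝓝 z] fun z' => z' - z := IsBigO.of_bound _ (hlip i z hz)
    refine ((J.isBigO_comp _ _).trans h1).congr' ?_ EventuallyEq.rfl
    filter_upwards [hD.mem_nhds hz] with z' hz'
    rw [hp i z' hz', hp i z hz, map_sub]; abel
  have hpc : ∀ i, ∀ z ∈ D, Tendsto (p i) (𝓝 z) (𝓝[K] (p i z)) := by
    intro i z hz
    refine tendsto_nhdsWithin_iff.2 ⟨?_, ?_⟩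
    · rw [tendsto_iff_norm_sub_tendsto_zero]
      refine ((hpB i z hz).norm_left.trans_tendsto ?_)
      have : Continuous fun z' : V => z' - z := by fun_prop
      simpa using this.tendsto z
    · filter_upwards [hD.mem_nhds hz] with z' hz' using hpK i hz'
  have hder : ∀ i, ∀ z ∈ D, HasFDerivAt (w i) (Q z i) z := by
    intro i z hz
    refine (hcontr z hz 1 le_rfl (by omega)).hasFDerivAt hω hθ0 hθ hB
      (fun i => by simpa using hlip i z hz) hM' (hQ z hz).2
      (c := b) (fun i => (hQ z hz).1 i) (fun i => ?_) i
    have hg' : ∀ k, (fun z' => A i k (g (cc (σ i k)) (p (σ i k) z') -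
        g (cc (σ i k)) (p (σ i k) z) - fderivWithin ℝ (g (cc (σ i k))) K (p (σ i k) z)
          (p (σ i k) z' - p (σ i k) z))) =o[𝓝 z] fun z' => z' - z := fun k => by
      have hd : HasFDerivWithinAt (g (cc (σ i k)))
          (fderivWithin ℝ (g (cc (σ i k))) K (p (σ i k) z)) K (p (σ i k) z) :=
        ((hg.1 (cc (σ i k))).differentiableOn (by simp) _ (hpK _ hz)).hasFDerivWithinAt
      exact ((A i k).isBigO_comp _ _).trans_isLittleO
        ((hd.isLittleO.comp_tendsto (hpc _ z hz)).trans_isBigO (hpB _ z hz))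
    refine (IsLittleO.fun_sum (s := Finset.univ) fun k _ => hg' k).congr' ?_ EventuallyEq.rfl
    filter_upwards [hD.mem_nhds hz] with z' hz'
    rw [hw i z hz, hw i z' hz']
    simp only [hp _ _ hz, hp _ _ hz', map_sub, map_add, Finset.sum_sub_distrib, add_apply,
      ContinuousLinearMap.comp_apply, Finset.sum_add_distrib]
    abel
  have hg1 : WeightedCr (fun _ => (1 : ℝ)) K r 0 fun c => fderivWithin ℝ (g c) K := by
    obtain ⟨h1, B, hB, h2⟩ := hg.fderivWithin hK
    exact ⟨h1, B, hB, fun i τ hτ z hz => by simpa using h2 i τ hτ z hz⟩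
  -- Bounds on `p` in `C^t` give bounds on the coefficients in `C^t`, and hence on `Q` in `C^t`.
  have hstep : ∀ t, t ≤ r → (∀ i, ContDiffOn ℝ t (p i) D) → ∀ B' : ℝ,
      (∀ i, ∀ τ, 1 ≤ τ → τ ≤ t → ∀ z ∈ D,
        ‖iteratedFDerivWithin ℝ τ (p i) D z‖ ≤ B' * ω i ^ τ) →
      WeightedCr ω D t 1 fun i z => Q z i := by
    intro t ht h1 B' h2
    have hcomp := WeightedCr.comp hU hK hω (hg1.mono ht) cc hpK h1 h2
    have hℓW : ∀ k, WeightedCr ω D t 0 fun i => ℓ i k := fun k => by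
      have a1 := hcomp.reindex (fun i => σ i k) hm hω hω fun i => hσ i k
      have a2 := WeightedCr.bilin hU (ContinuousLinearMap.compL ℝ E F H).flip hω
        (WeightedCr.const (D := D) (V := V) hω t 0 (v := fun _ : ι => J) (fun _ => le_rfl)) a1
      have a3 := WeightedCr.bilin hU (ContinuousLinearMap.compL ℝ E H E) hω
        (WeightedCr.const (D := D) (V := V) hω t 0 (v := fun i => A i k) (fun i => hA i k)) a2
      exact a3.add hU
        (WeightedCr.const (D := D) (V := V) hω t 0 (v := fun i => C i k) (fun i => hCM i k))
    have hℓ'W : ∀ k, WeightedCr ω D t 0 fun i => ℓ' i k := fun k => by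
      have h1 := WeightedCr.clm (W := (V →L[ℝ] E) →L[ℝ] (V →L[ℝ] E)) hU hω
        (ContinuousLinearMap.compL ℝ V E E) (hℓW k)
      exact h1
    exact WeightContracts.weightedCr hD hω hθ0 hθ hm hσ t
      (fun z hz s h1 h2 => hℓC z hz s h1 (by omega)) (fun i z hz => (hQ z hz).1 i) hM'
      (fun i z hz => (hQ z hz).2 i) (WeightedCr.const hω t 1 hb) hℓ'W
  have hpder : ∀ i, ∀ z ∈ D, HasFDerivAt (p i) (J.comp (Q z i)) z := by
    intro i z hz
    refine ((J.hasFDerivAt.comp z (hder i z hz)).add_const (e i)).congr_of_eventuallyEq ?_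
    filter_upwards [hD.mem_nhds hz] with z' hz' using hp i z' hz'
  have hall : ∀ t, t ≤ r → WeightedCr ω D t 1 fun i z => Q z i := by
    intro t
    induction t with
    | zero =>
      intro _
      exact hstep 0 (by omega) (fun i => contDiffOn_zero.2 fun z hz =>
        (hpder i z hz).continuousAt.continuousWithinAt) 0 (fun i τ h1 h2 => by omega)
    | succ t ih =>
      intro ht
      have a1 : WeightedCr ω D t (0 + 1) fun i z => J.comp (Q z i) := by
        have := WeightedCr.bilin hU (ContinuousLinearMap.compL ℝ V E F) hω
          (WeightedCr.const (D := D) (V := V) hω t 0 (v := fun _ : ι => J) (fun _ => le_rfl))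
          (ih (by omega))
        exact this
      obtain ⟨h1, B', _, h2⟩ := WeightedCr.contDiffOn_of_hasFDerivAt hD hpder a1
      exact hstep (t + 1) ht h1 B' (fun i τ h3 h4 z hz => by
        simpa using h2 i τ h3 h4 z hz)
  exact ⟨fun i z => Q z i, hder, hall r le_rfl⟩

end Regularity

/-! ### Functions that are Lipschitz on segments of `D` -/

/-- `u` is `c`-Lipschitz along every segment contained in `D`. For a domain that is not convex this
is what a bound `c` on the derivative of `u` gives. -/
def SegLip {V W : Type*} [NormedAddCommGroup V] [NormedSpace ℝ V] [NormedAddCommGroup W]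
    (D : Set V) (c : ℝ) (u : V → W) : Prop :=
  ∀ z z', segment ℝ z z' ⊆ D → ‖u z' - u z‖ ≤ c * ‖z' - z‖

section SegLip

variable {V W : Type*} [NormedAddCommGroup V] [NormedSpace ℝ V] [NormedAddCommGroup W]
  {D : Set V} {c : ℝ} {u : V → W}

theorem eventually_segment_subset (hD : IsOpen D) {z : V} (hz : z ∈ D) :
    ∀ᶠ z' in 𝓝 z, segment ℝ z z' ⊆ D := by
  obtain ⟨ρ, hρ, hball⟩ := Metric.isOpen_iff.1 hD z hz
  filter_upwards [ball_mem_nhds z hρ] with z' hz'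
  exact ((convex_ball z ρ).segment_subset (mem_ball_self hρ) hz').trans hball

theorem SegLip.eventually (h : SegLip D c u) (hD : IsOpen D) {z : V} (hz : z ∈ D) :
    ∀ᶠ z' in 𝓝 z, ‖u z' - u z‖ ≤ c * ‖z' - z‖ := by
  filter_upwards [eventually_segment_subset hD hz] with z' hz' using h z z' hz'

theorem continuousAt_of_eventually_lipschitz {V W : Type*} [NormedAddCommGroup V]
    [NormedAddCommGroup W] {c : ℝ} {u : V → W} {z : V}
    (h : ∀ᶠ z' in 𝓝 z, ‖u z' - u z‖ ≤ c * ‖z' - z‖) : ContinuousAt u z := by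
  rw [ContinuousAt, tendsto_iff_norm_sub_tendsto_zero]
  have h0 : Tendsto (fun z' => c * ‖z' - z‖) (𝓝 z) (𝓝 0) := by
    have : Continuous fun z' => c * ‖z' - z‖ := by fun_prop
    simpa using this.tendsto z
  exact squeeze_zero' (Eventually.of_forall fun _ => norm_nonneg _) h h0

theorem SegLip.continuousAt (h : SegLip D c u) (hD : IsOpen D) {z : V} (hz : z ∈ D) :
    ContinuousAt u z :=
  continuousAt_of_eventually_lipschitz (h.eventually hD hz)

/-- A pointwise Lipschitz bound at all points of `D` integrates along segments. -/
theorem segLip_of_eventually (h : ∀ z ∈ D, ∀ᶠ z' in 𝓝 z, ‖u z' - u z‖ ≤ c * ‖z' - z‖) :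
    SegLip D c u := by
  intro z z' hseg
  set γ : ℝ → V := fun t => z + t • (z' - z) with hγ
  have hγD : ∀ t ∈ Icc (0 : ℝ) 1, γ t ∈ D := fun t ht => by
    apply hseg
    rw [segment_eq_image']
    exact ⟨t, ht, rfl⟩
  have hγc : Continuous γ := by fun_prop
  have huc : ContinuousOn (fun t => ‖u (γ t) - u z‖) (Icc 0 1) := fun t ht =>
    (((continuousAt_of_eventually_lipschitz (h _ (hγD t ht))).comp
      hγc.continuousAt).sub continuousAt_const).norm.continuousWithinAt
  have key := image_le_of_liminf_slope_right_le_deriv_boundary huc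
    (B := fun t => c * ‖z' - z‖ * t) (B' := fun _ => c * ‖z' - z‖) (by simp [hγ])
    (by fun_prop) (fun t _ => by
      simpa using ((hasDerivAt_id t).const_mul (c * ‖z' - z‖)).hasDerivWithinAt)
    (fun t ht r hr => by
      refine Eventually.frequently ?_
      have e1 : ∀ᶠ s in 𝓝[>] t, ‖u (γ s) - u (γ t)‖ ≤ c * ‖γ s - γ t‖ :=
        (hγc.continuousAt.mono_left nhdsWithin_le_nhds).eventually
          (h _ (hγD t (Ico_subset_Icc_self ht)))
      filter_upwards [e1, self_mem_nhdsWithin] with s hs hts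
      have hts' : 0 < s - t := sub_pos.2 hts
      have e2 : γ s - γ t = (s - t) • (z' - z) := by
        simp only [hγ, sub_smul]; abel
      rw [e2, norm_smul, Real.norm_of_nonneg hts'.le] at hs
      rw [slope_def_field, div_lt_iff₀ hts']
      have e3 := norm_sub_norm_le (u (γ s) - u z) (u (γ t) - u z)
      rw [sub_sub_sub_cancel_right] at e3
      nlinarith)
  have := key (right_mem_Icc.2 zero_le_one)
  simpa [hγ] using this

theorem SegLip.of_tendsto {u : ℕ → V → W} {v : V → W} (h : ∀ n, SegLip D c (u n))
    (hv : ∀ z ∈ D, Tendsto (fun n => u n z) atTop (𝓝 (v z))) : SegLip D c v := by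
  intro z z' hseg
  exact le_of_tendsto ((hv z' (hseg (right_mem_segment ℝ z z'))).sub
    (hv z (hseg (left_mem_segment ℝ z z')))).norm (Eventually.of_forall fun n => h n z z' hseg)

theorem SegLip.norm_sub_le (h : SegLip D c u) {v : V → W} {z z' : V}
    (hseg : segment ℝ z z' ⊆ D) {δ : ℝ} (hδ : ‖v z - u z‖ ≤ δ) :
    ‖v z - u z'‖ ≤ δ + c * ‖z - z'‖ := by
  have h1 := h z' z (by rwa [segment_symm])
  calc ‖v z - u z'‖ = ‖(v z - u z) + (u z - u z')‖ := by rw [sub_add_sub_cancel]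
    _ ≤ _ := (norm_add_le _ _).trans (add_le_add hδ h1)

end SegLip

/-- The distance from `z` to the complement of `D` (`0` if the complement is empty). -/
noncomputable def gap {V : Type*} [PseudoMetricSpace V] (D : Set V) (z : V) : ℝ := infDist z Dᶜ

theorem gap_nonneg {V : Type*} [PseudoMetricSpace V] {D : Set V} (z : V) : 0 ≤ gap D z :=
  infDist_nonneg

theorem gap_le_add {V : Type*} [NormedAddCommGroup V] {D : Set V} (z z' : V) :
    gap D z' ≤ gap D z + ‖z' - z‖ := by
  rw [← dist_eq_norm]
  exact infDist_le_infDist_add_dist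

theorem closedBall_half_gap_subset {V : Type*} [NormedAddCommGroup V] {D : Set V} {z : V}
    (hz : z ∈ D) : closedBall z (gap D z / 2) ⊆ D := by
  intro z' hz'
  by_contra hcon
  have h1 : gap D z ≤ dist z z' := infDist_le_dist_of_mem hcon
  rw [mem_closedBall, dist_comm] at hz'
  have h2 : dist z z' = 0 := le_antisymm (by linarith) dist_nonneg
  rw [eq_of_dist_eq_zero h2] at hz
  exact hcon hz

theorem segment_subset_of_half_gap {V : Type*} [NormedAddCommGroup V] [NormedSpace ℝ V]
    {D : Set V} {z p q : V} (hz : z ∈ D) (hp : ‖p - z‖ ≤ gap D z / 2)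
    (hq : ‖q - z‖ ≤ gap D z / 2) : segment ℝ p q ⊆ D :=
  ((convex_closedBall z _).segment_subset (by rwa [mem_closedBall, dist_eq_norm])
    (by rwa [mem_closedBall, dist_eq_norm])).trans (closedBall_half_gap_subset hz)

/-! ### Maps in cross-form and invariant sequences of graphs -/

section Link

variable {k n : ℕ} {R lam M ν B μ : ℝ} {D : Set (Euc n)}

/-- The estimates on a map `x̄ = F (x, ȳ, z)`, `y = G (x, ȳ, z)`, `z̄ = z + Φ (x, ȳ, z)` in
cross-form that are needed for its invariant graphs. The bound on `‖Φ‖` by the distance to the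
complement of `D` keeps the segment from `z` to `z̄` inside `D`. -/
structure IsLink (R lam M ν : ℝ) (D : Set (Euc n)) (F G : Pt k n → Euc k) (Φ : Pt k n → Euc n) :
    Prop where
  norm_F_le : ∀ p ∈ crossSection k n R D, ‖F p‖ ≤ R
  norm_G_le : ∀ p ∈ crossSection k n R D, ‖G p‖ ≤ R
  norm_F_sub_le : ∀ p ∈ crossSection k n R D, ∀ q ∈ crossSection k n R D,
    segment ℝ p.2.2 q.2.2 ⊆ D →
      ‖F p - F q‖ ≤ lam * max ‖p.1 - q.1‖ ‖p.2.1 - q.2.1‖ + M * ‖p.2.2 - q.2.2‖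
  norm_G_sub_le : ∀ p ∈ crossSection k n R D, ∀ q ∈ crossSection k n R D,
    segment ℝ p.2.2 q.2.2 ⊆ D →
      ‖G p - G q‖ ≤ lam * max ‖p.1 - q.1‖ ‖p.2.1 - q.2.1‖ + M * ‖p.2.2 - q.2.2‖
  norm_Φ_sub_le : ∀ p ∈ crossSection k n R D, ∀ q ∈ crossSection k n R D,
    segment ℝ p.2.2 q.2.2 ⊆ D → ‖Φ p - Φ q‖ ≤ ν * ‖p - q‖
  norm_Φ_le : ∀ p ∈ crossSection k n R D, ‖Φ p‖ ≤ ν * gap D p.2.2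

theorem IsLink.mono {ν' : ℝ} {F G : Pt k n → Euc k} {Φ : Pt k n → Euc n}
    (h : IsLink R lam M ν D F G Φ) (hν : ν ≤ ν') : IsLink R lam M ν' D F G Φ :=
  ⟨h.norm_F_le, h.norm_G_le, h.norm_F_sub_le, h.norm_G_sub_le,
    fun p hp q hq hs => (h.norm_Φ_sub_le p hp q hq hs).trans
      (mul_le_mul_of_nonneg_right hν (norm_nonneg _)),
    fun p hp => (h.norm_Φ_le p hp).trans (mul_le_mul_of_nonneg_right hν (gap_nonneg _))⟩

theorem mem_crossSection {p : Pt k n} :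
    p ∈ crossSection k n R D ↔ ‖p.1‖ ≤ R ∧ ‖p.2.1‖ ≤ R ∧ p.2.2 ∈ D := by
  simp [crossSection, mem_prod]

/-- `(x', y', z')` is the image of `(x, y, z)` under the map in cross-form given by `F, G, Φ`. -/
def Connects (F G : Pt k n → Euc k) (Φ : Pt k n → Euc n) (x y : Euc k) (z : Euc n)
    (x' y' : Euc k) (z' : Euc n) : Prop :=
  x' = F (x, y', z) ∧ y = G (x, y', z) ∧ z' = z + Φ (x, y', z)

/-- The graphs over `D` of `(X i, Y i)` lie in the cross-section, and the `i`-th one is mapped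
onto the next one by the map in cross-form given by `F i, G i, Φ i`. -/
structure GraphsInvariant (R : ℝ) (D : Set (Euc n)) (F G : ℤ → Pt k n → Euc k)
    (Φ : ℤ → Pt k n → Euc n) (X Y : ℤ → Euc n → Euc k) : Prop where
  norm_X_le : ∀ i, ∀ z ∈ D, ‖X i z‖ ≤ R
  norm_Y_le : ∀ i, ∀ z ∈ D, ‖Y i z‖ ≤ R
  exists_image : ∀ i, ∀ z ∈ D, ∃ z' ∈ D,
    Connects (F i) (G i) (Φ i) (X i z) (Y i z) z (X (i + 1) z') (Y (i + 1) z') z'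
  exists_preimage : ∀ i, ∀ z' ∈ D, ∃ z ∈ D,
    Connects (F i) (G i) (Φ i) (X i z) (Y i z) z (X (i + 1) z') (Y (i + 1) z') z'

/-- Comparison of two steps, along arbitrary graphs `(X, Y)` and along Lipschitz graphs `(x, y)`,
that start over the same point or end over the same point, for maps differing by at most `η`. -/
theorem IsLink.compare {F₁ G₁ F₂ G₂ : Pt k n → Euc k} {Φ₁ Φ₂ : Pt k n → Euc n}
    (h₁ : IsLink R lam M ν D F₁ G₁ Φ₁) (h₂ : IsLink R lam M ν D F₂ G₂ Φ₂)
    (hlam0 : 0 ≤ lam) (hlam1 : lam ≤ 1) (hM : 0 ≤ M) (hB : 0 ≤ B) (hν0 : 0 ≤ ν)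
    (hν : ν ≤ 1 / 3) (hνB : ν * (B + 1) ≤ 1 / 2)
    {η δ : ℝ} (hδ : 0 ≤ δ)
    (hF : ∀ p ∈ crossSection k n R D, ‖F₁ p - F₂ p‖ ≤ η)
    (hG : ∀ p ∈ crossSection k n R D, ‖G₁ p - G₂ p‖ ≤ η)
    (hΦ : ∀ p ∈ crossSection k n R D, ‖Φ₁ p - Φ₂ p‖ ≤ η)
    {X Y x y : Euc n → Euc k} {z₁ z₁' z₂ z₂' : Euc n}
    (hx : SegLip D B x) (hy : SegLip D B y)
    (hp₁ : (X z₁, Y z₁', z₁) ∈ crossSection k n R D)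
    (hp₂ : (x z₂, y z₂', z₂) ∈ crossSection k n R D)
    (hz₁' : z₁' ∈ D) (e₁ : z₁' = z₁ + Φ₁ (X z₁, Y z₁', z₁)) (e₂ : z₂' = z₂ + Φ₂ (x z₂, y z₂', z₂))
    (hXx : ‖X z₁ - x z₁‖ ≤ δ) (hYy : ‖Y z₁' - y z₁'‖ ≤ δ) (hend : z₁ = z₂ ∨ z₁' = z₂') :
    ‖z₁ - z₂‖ ≤ 2 * ν * δ + 2 * η ∧ ‖z₁' - z₂'‖ ≤ 2 * ν * δ + 2 * η ∧
    ‖F₁ (X z₁, Y z₁', z₁) - F₂ (x z₂, y z₂', z₂)‖ ≤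
      (lam + 2 * (B + M) * ν) * δ + (2 * (B + M) + 1) * η ∧
    ‖G₁ (X z₁, Y z₁', z₁) - G₂ (x z₂, y z₂', z₂)‖ ≤
      (lam + 2 * (B + M) * ν) * δ + (2 * (B + M) + 1) * η := by
  have hz₁ : z₁ ∈ D := (mem_crossSection.1 hp₁).2.2
  have hz₂ : z₂ ∈ D := (mem_crossSection.1 hp₂).2.2
  have d₁ : ‖z₁' - z₁‖ ≤ ν * gap D z₁ := by
    rw [sub_eq_iff_eq_add'.2 e₁]; exact h₁.norm_Φ_le _ hp₁
  have d₂ : ‖z₂' - z₂‖ ≤ ν * gap D z₂ := by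
    rw [sub_eq_iff_eq_add'.2 e₂]; exact h₂.norm_Φ_le _ hp₂
  -- Both segments stay in `D` because a step is short compared with the distance to `Dᶜ`.
  have hshort : ∀ z z' : Euc n, ‖z' - z‖ ≤ ν * gap D z →
      ‖z' - z‖ ≤ gap D z / 2 ∧ ‖z - z'‖ ≤ gap D z' / 2 := by
    intro z z' hd
    have g0 := gap_nonneg (D := D) z
    have g1 := gap_le_add (D := D) z' z
    have g2 : ν * gap D z ≤ 1 / 3 * gap D z := mul_le_mul_of_nonneg_right hν g0
    rw [norm_sub_rev] at hd
    constructor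
    · rw [norm_sub_rev]; linarith
    · linarith
  have hseg : segment ℝ z₁ z₂ ⊆ D := by
    rcases hend with rfl | rfl
    · simpa using hz₁
    · exact segment_subset_of_half_gap hz₁' (hshort _ _ d₁).2 (hshort _ _ d₂).2
  have hseg' : segment ℝ z₁' z₂' ⊆ D := by
    rcases hend with rfl | rfl
    · exact segment_subset_of_half_gap hz₁ (hshort _ _ d₁).1 (hshort _ _ d₂).1
    · simpa using hz₁'
  set Δ : ℝ := max ‖z₁ - z₂‖ ‖z₁' - z₂'‖ with hΔ
  have hΔ0 : 0 ≤ Δ := le_max_of_le_left (norm_nonneg _)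
  have k1 : ‖X z₁ - x z₂‖ ≤ δ + B * Δ := (hx.norm_sub_le hseg hXx).trans
    (add_le_add le_rfl (mul_le_mul_of_nonneg_left (le_max_left _ _) hB))
  have k2 : ‖Y z₁' - y z₂'‖ ≤ δ + B * Δ := (hy.norm_sub_le hseg' hYy).trans
    (add_le_add le_rfl (mul_le_mul_of_nonneg_left (le_max_right _ _) hB))
  have k3 : ‖z₁ - z₂‖ ≤ Δ := le_max_left _ _
  have kΦ : ‖Φ₁ (X z₁, Y z₁', z₁) - Φ₂ (x z₂, y z₂', z₂)‖ ≤ ν * (δ + (B + 1) * Δ) + η := by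
    have a1 := h₁.norm_Φ_sub_le _ hp₁ _ hp₂ hseg
    have a2 : ‖((X z₁, Y z₁', z₁) : Pt k n) - (x z₂, y z₂', z₂)‖ ≤ δ + (B + 1) * Δ := by
      have : 0 ≤ B * Δ := mul_nonneg hB hΔ0
      refine norm_prod_le_iff.2 ⟨?_, norm_prod_le_iff.2 ⟨?_, ?_⟩⟩
      · exact k1.trans (by linarith)
      · exact k2.trans (by linarith)
      · exact k3.trans (by linarith)
    calc _ = ‖(Φ₁ (X z₁, Y z₁', z₁) - Φ₁ (x z₂, y z₂', z₂)) +
          (Φ₁ (x z₂, y z₂', z₂) - Φ₂ (x z₂, y z₂', z₂))‖ := by rw [sub_add_sub_cancel]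
      _ ≤ _ := norm_add_le _ _
      _ ≤ _ := add_le_add (a1.trans (mul_le_mul_of_nonneg_left a2 hν0)) (hΦ _ hp₂)
  have hΔle : Δ ≤ ν * (δ + (B + 1) * Δ) + η := by
    rcases hend with rfl | rfl
    · refine max_le (by simpa using (norm_nonneg _).trans kΦ) ?_
      have : z₁' - z₂' = Φ₁ (X z₁, Y z₁', z₁) - Φ₂ (x z₁, y z₂', z₁) := by
        conv_lhs => rw [e₁, e₂]
        abel
      rw [this]; exact kΦ
    · refine max_le ?_ (by simpa using (norm_nonneg _).trans kΦ)
      have : z₁ - z₂ = -(Φ₁ (X z₁, Y z₁', z₁) - Φ₂ (x z₂, y z₁', z₂)) := by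
        rw [neg_sub, sub_eq_sub_iff_add_eq_add, ← e₁, add_comm, ← e₂]
      rw [this, norm_neg]; exact kΦ
  have hΔ' : Δ ≤ 2 * ν * δ + 2 * η := by
    have : ν * (B + 1) * Δ ≤ 1 / 2 * Δ := mul_le_mul_of_nonneg_right hνB hΔ0
    nlinarith
  have hmax : max ‖X z₁ - x z₂‖ ‖Y z₁' - y z₂'‖ ≤ δ + B * Δ := max_le k1 k2
  have hfin : lam * (δ + B * Δ) + M * Δ + η ≤
      (lam + 2 * (B + M) * ν) * δ + (2 * (B + M) + 1) * η := by
    have b1 : lam * (B * Δ) ≤ 1 * (B * Δ) := mul_le_mul_of_nonneg_right hlam1 (by positivity)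
    have b2 : (B + M) * Δ ≤ (B + M) * (2 * ν * δ + 2 * η) :=
      mul_le_mul_of_nonneg_left hΔ' (by positivity)
    linarith
  refine ⟨(le_max_left _ _).trans hΔ', (le_max_right _ _).trans hΔ', ?_, ?_⟩
  · have a1 := h₁.norm_F_sub_le _ hp₁ _ hp₂ hseg
    refine le_trans ?_ hfin
    calc _ = ‖(F₁ (X z₁, Y z₁', z₁) - F₁ (x z₂, y z₂', z₂)) +
          (F₁ (x z₂, y z₂', z₂) - F₂ (x z₂, y z₂', z₂))‖ := by rw [sub_add_sub_cancel]
      _ ≤ _ := norm_add_le _ _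
      _ ≤ _ := add_le_add (a1.trans (add_le_add (mul_le_mul_of_nonneg_left hmax hlam0)
        (mul_le_mul_of_nonneg_left k3 hM))) (hF _ hp₂)
  · have a1 := h₁.norm_G_sub_le _ hp₁ _ hp₂ hseg
    refine le_trans ?_ hfin
    calc _ = ‖(G₁ (X z₁, Y z₁', z₁) - G₁ (x z₂, y z₂', z₂)) +
          (G₁ (x z₂, y z₂', z₂) - G₂ (x z₂, y z₂', z₂))‖ := by rw [sub_add_sub_cancel]
      _ ≤ _ := norm_add_le _ _
      _ ≤ _ := add_le_add (a1.trans (add_le_add (mul_le_mul_of_nonneg_left hmax hlam0)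
        (mul_le_mul_of_nonneg_left k3 hM))) (hG _ hp₂)

/-- One step of the comparison of two invariant sequences of graphs: bounds for `X` at time `i`
and `Y` at time `i + 1` give a smaller bound for `X` at time `i + 1` and `Y` at time `i`. -/
theorem GraphsInvariant.compare {F₁ G₁ F₂ G₂ : ℤ → Pt k n → Euc k} {Φ₁ Φ₂ : ℤ → Pt k n → Euc n}
    {X Y x y : ℤ → Euc n → Euc k} (I₁ : GraphsInvariant R D F₁ G₁ Φ₁ X Y)
    (I₂ : GraphsInvariant R D F₂ G₂ Φ₂ x y) {i : ℤ}
    (h₁ : IsLink R lam M ν D (F₁ i) (G₁ i) (Φ₁ i)) (h₂ : IsLink R lam M ν D (F₂ i) (G₂ i) (Φ₂ i))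
    (hlam0 : 0 ≤ lam) (hlam1 : lam ≤ 1) (hM : 0 ≤ M) (hB : 0 ≤ B) (hν0 : 0 ≤ ν)
    (hν : ν ≤ 1 / 3) (hνB : ν * (B + 1) ≤ 1 / 2)
    {η δ : ℝ} (hδ : 0 ≤ δ)
    (hF : ∀ p ∈ crossSection k n R D, ‖F₁ i p - F₂ i p‖ ≤ η)
    (hG : ∀ p ∈ crossSection k n R D, ‖G₁ i p - G₂ i p‖ ≤ η)
    (hΦ : ∀ p ∈ crossSection k n R D, ‖Φ₁ i p - Φ₂ i p‖ ≤ η)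
    (hx : ∀ i, SegLip D B (x i)) (hy : ∀ i, SegLip D B (y i))
    (hXx : ∀ z ∈ D, ‖X i z - x i z‖ ≤ δ) (hYy : ∀ z ∈ D, ‖Y (i + 1) z - y (i + 1) z‖ ≤ δ) :
    (∀ z ∈ D, ‖X (i + 1) z - x (i + 1) z‖ ≤
      (lam + 2 * (B + M) * ν) * δ + (2 * (B + M) + 1) * η) ∧
    (∀ z ∈ D, ‖Y i z - y i z‖ ≤ (lam + 2 * (B + M) * ν) * δ + (2 * (B + M) + 1) * η) := by
  have mem₁ : ∀ z ∈ D, ∀ z' ∈ D, (X i z, Y (i + 1) z', z) ∈ crossSection k n R D :=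
    fun z hz z' hz' => mem_crossSection.2 ⟨I₁.norm_X_le _ z hz, I₁.norm_Y_le _ z' hz', hz⟩
  have mem₂ : ∀ z ∈ D, ∀ z' ∈ D, (x i z, y (i + 1) z', z) ∈ crossSection k n R D :=
    fun z hz z' hz' => mem_crossSection.2 ⟨I₂.norm_X_le _ z hz, I₂.norm_Y_le _ z' hz', hz⟩
  constructor
  · intro w hw
    obtain ⟨z₁, hz₁, c₁, -, e₁⟩ := I₁.exists_preimage i w hw
    obtain ⟨z₂, hz₂, c₂, -, e₂⟩ := I₂.exists_preimage i w hw
    have := (h₁.compare h₂ hlam0 hlam1 hM hB hν0 hν hνB hδ hF hG hΦ (hx i) (hy (i + 1))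
      (mem₁ z₁ hz₁ w hw) (mem₂ z₂ hz₂ w hw) hw e₁ e₂ (hXx z₁ hz₁) (hYy w hw) (Or.inr rfl)).2.2.1
    rw [c₁, c₂]; exact this
  · intro z hz
    obtain ⟨w₁, hw₁, -, c₁, e₁⟩ := I₁.exists_image i z hz
    obtain ⟨w₂, hw₂, -, c₂, e₂⟩ := I₂.exists_image i z hz
    have := (h₁.compare h₂ hlam0 hlam1 hM hB hν0 hν hνB hδ hF hG hΦ (hx i) (hy (i + 1))
      (mem₁ z hz w₁ hw₁) (mem₂ z hz w₂ hw₂) hw₁ e₁ e₂ (hXx z hz) (hYy w₁ hw₁) (Or.inl rfl)).2.2.2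
    rw [c₁, c₂]; exact this

/-- Two invariant sequences of graphs, one of them Lipschitz, for maps differing by at most `η`
at all times, differ by `O(η)`. -/
theorem GraphsInvariant.norm_sub_le {F₁ G₁ F₂ G₂ : ℤ → Pt k n → Euc k}
    {Φ₁ Φ₂ : ℤ → Pt k n → Euc n}
    {X Y x y : ℤ → Euc n → Euc k} (I₁ : GraphsInvariant R D F₁ G₁ Φ₁ X Y)
    (I₂ : GraphsInvariant R D F₂ G₂ Φ₂ x y)
    (h₁ : ∀ i, IsLink R lam M ν D (F₁ i) (G₁ i) (Φ₁ i))
    (h₂ : ∀ i, IsLink R lam M ν D (F₂ i) (G₂ i) (Φ₂ i)) (hR : 0 ≤ R)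
    (hlam0 : 0 ≤ lam) (hlam1 : lam ≤ 1) (hM : 0 ≤ M) (hB : 0 ≤ B) (hν0 : 0 ≤ ν)
    (hν : ν ≤ 1 / 3) (hνB : ν * (B + 1) ≤ 1 / 2) (hq : lam + 2 * (B + M) * ν < 1)
    {η : ℝ} (hη : 0 ≤ η)
    (hF : ∀ i, ∀ p ∈ crossSection k n R D, ‖F₁ i p - F₂ i p‖ ≤ η)
    (hG : ∀ i, ∀ p ∈ crossSection k n R D, ‖G₁ i p - G₂ i p‖ ≤ η)
    (hΦ : ∀ i, ∀ p ∈ crossSection k n R D, ‖Φ₁ i p - Φ₂ i p‖ ≤ η)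
    (hx : ∀ i, SegLip D B (x i)) (hy : ∀ i, SegLip D B (y i)) (i : ℤ) {z : Euc n} (hz : z ∈ D) :
    ‖X i z - x i z‖ ≤ (2 * (B + M) + 1) * η / (1 - (lam + 2 * (B + M) * ν)) ∧
    ‖Y i z - y i z‖ ≤ (2 * (B + M) + 1) * η / (1 - (lam + 2 * (B + M) * ν)) := by
  obtain ⟨c, hc, hA⟩ := exists_seq_of_contracting_bound
    (A := fun δ => ∀ i, ∀ z ∈ D, ‖X i z - x i z‖ ≤ δ ∧ ‖Y i z - y i z‖ ≤ δ) (c₀ := R + R)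
    (θ := lam + 2 * (B + M) * ν) (η := (2 * (B + M) + 1) * η)
    (by positivity) hq (by positivity) (by positivity)
    (fun i z hz => ⟨(_root_.norm_sub_le _ _).trans
        (add_le_add (I₁.norm_X_le i z hz) (I₂.norm_X_le i z hz)),
      (_root_.norm_sub_le _ _).trans (add_le_add (I₁.norm_Y_le i z hz) (I₂.norm_Y_le i z hz))⟩)
    (fun δ hδ hA i z hz => by
      have step := fun i => I₁.compare I₂ (h₁ i) (h₂ i) hlam0 hlam1 hM hB hν0 hν hνB hδ
        (hF i) (hG i) (hΦ i) hx hy (fun z hz => (hA i z hz).1) (fun z hz => (hA (i + 1) z hz).2)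
      refine ⟨?_, (step i).2 z hz⟩
      have := (step (i - 1)).1 z hz
      rwa [sub_add_cancel] at this)
  exact ⟨ge_of_tendsto' hc fun n => ((hA n).2 i z hz).1,
    ge_of_tendsto' hc fun n => ((hA n).2 i z hz).2⟩

/-- Two invariant sequences of graphs, one of them Lipschitz, for maps that agree on the first
`N` steps in both directions, are exponentially close in the middle. -/
theorem GraphsInvariant.norm_sub_le_pow {F₁ G₁ F₂ G₂ : ℤ → Pt k n → Euc k}
    {Φ₁ Φ₂ : ℤ → Pt k n → Euc n}
    {X Y x y : ℤ → Euc n → Euc k} (I₁ : GraphsInvariant R D F₁ G₁ Φ₁ X Y)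
    (I₂ : GraphsInvariant R D F₂ G₂ Φ₂ x y)
    (h₁ : ∀ i, IsLink R lam M ν D (F₁ i) (G₁ i) (Φ₁ i))
    (h₂ : ∀ i, IsLink R lam M ν D (F₂ i) (G₂ i) (Φ₂ i)) (hR : 0 ≤ R)
    (hlam0 : 0 ≤ lam) (hlam1 : lam ≤ 1) (hM : 0 ≤ M) (hB : 0 ≤ B) (hν0 : 0 ≤ ν)
    (hν : ν ≤ 1 / 3) (hνB : ν * (B + 1) ≤ 1 / 2) {N : ℕ}
    (hF : ∀ i : ℤ, i.natAbs ≤ N → (i + 1).natAbs ≤ N → F₁ i = F₂ i ∧ G₁ i = G₂ i ∧ Φ₁ i = Φ₂ i)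
    (hx : ∀ i, SegLip D B (x i)) (hy : ∀ i, SegLip D B (y i)) (m : ℕ) :
    ∀ i : ℤ, i.natAbs + m ≤ N → ∀ z ∈ D,
      ‖X i z - x i z‖ ≤ 2 * R * (lam + 2 * (B + M) * ν) ^ m ∧
      ‖Y i z - y i z‖ ≤ 2 * R * (lam + 2 * (B + M) * ν) ^ m := by
  induction m with
  | zero =>
    intro i _ z hz
    rw [pow_zero, mul_one, two_mul]
    exact ⟨(_root_.norm_sub_le _ _).trans
        (add_le_add (I₁.norm_X_le i z hz) (I₂.norm_X_le i z hz)),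
      (_root_.norm_sub_le _ _).trans (add_le_add (I₁.norm_Y_le i z hz) (I₂.norm_Y_le i z hz))⟩
  | succ m ih =>
    intro i hi z hz
    have step : ∀ i : ℤ, i.natAbs + m ≤ N → (i + 1).natAbs + m ≤ N → _ := fun i hi hi' =>
      I₁.compare I₂ (h₁ i) (h₂ i) hlam0 hlam1 hM hB hν0 hν hνB (η := 0)
        (δ := 2 * R * (lam + 2 * (B + M) * ν) ^ m) (by positivity)
        (fun p _ => by simp [(hF i (by omega) (by omega)).1])
        (fun p _ => by simp [(hF i (by omega) (by omega)).2.1])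
        (fun p _ => by simp [(hF i (by omega) (by omega)).2.2])
        hx hy (fun z hz => (ih i hi z hz).1) (fun z hz => (ih (i + 1) hi' z hz).2)
    have e : (lam + 2 * (B + M) * ν) * (2 * R * (lam + 2 * (B + M) * ν) ^ m) +
        (2 * (B + M) + 1) * 0 = 2 * R * (lam + 2 * (B + M) * ν) ^ (m + 1) := by ring
    constructor
    · have := (step (i - 1) (by omega) (by omega)).1 z hz
      rwa [e, sub_add_cancel] at this
    · have := (step i (by omega) (by omega)).2 z hz
      rwa [e] at this

end Link

/-! ### Existence of Lipschitz invariant graphs -/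

section Existence

variable {k n : ℕ} {R lam M ν B μ : ℝ} {D : Set (Euc n)}

/-- The argument `(x, ȳ, z)` of a map in cross-form for a step from the point `α z` of the graph
`x = u` to the point `β z` of the graph `y = v`. -/
def stepArg (u v : Euc n → Euc k) (α β : Euc n → Euc n) (z : Euc n) : Pt k n :=
  (u (α z), v (β z), α z)

/-- A Lipschitz map of `D` that moves each point by at most half its distance to `Dᶜ`. -/
structure IsShortStep (D : Set (Euc n)) (μ : ℝ) (α : Euc n → Euc n) : Prop where
  norm_sub_le : ∀ z ∈ D, ‖α z - z‖ ≤ gap D z / 2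
  segLip : SegLip D μ α

theorem IsShortStep.mapsTo {α : Euc n → Euc n} (h : IsShortStep D μ α) : MapsTo α D D :=
  fun z hz => closedBall_half_gap_subset hz (by
    rw [mem_closedBall, dist_eq_norm]; exact h.norm_sub_le z hz)

theorem IsShortStep.id (hμ : 1 ≤ μ) : IsShortStep D μ (fun z => z) :=
  ⟨fun z _ => by simpa using div_nonneg (gap_nonneg z) zero_le_two,
    fun z z' _ => le_mul_of_one_le_left (norm_nonneg _) hμ⟩

theorem stepArg_mem {u v : Euc n → Euc k} (hu : ∀ z ∈ D, ‖u z‖ ≤ R) (hv : ∀ z ∈ D, ‖v z‖ ≤ R)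
    {α β : Euc n → Euc n} (hα : IsShortStep D μ α) (hβ : IsShortStep D μ β) {z : Euc n}
    (hz : z ∈ D) : stepArg u v α β z ∈ crossSection k n R D :=
  mem_crossSection.2 ⟨hu _ (hα.mapsTo hz), hv _ (hβ.mapsTo hz), hα.mapsTo hz⟩

theorem eventually_stepArg (hD : IsOpen D) (hB : 0 ≤ B) {u v : Euc n → Euc k}
    (hu : SegLip D B u) (hv : SegLip D B v) {α β : Euc n → Euc n} (hα : IsShortStep D μ α)
    (hβ : IsShortStep D μ β) {z : Euc n} (hz : z ∈ D) :
    ∀ᶠ z' in 𝓝 z, z' ∈ D ∧ segment ℝ (α z') (α z) ⊆ D ∧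
      ‖u (α z') - u (α z)‖ ≤ B * μ * ‖z' - z‖ ∧ ‖v (β z') - v (β z)‖ ≤ B * μ * ‖z' - z‖ ∧
      ‖α z' - α z‖ ≤ μ * ‖z' - z‖ := by
  filter_upwards [hD.mem_nhds hz, hα.segLip.eventually hD hz, hβ.segLip.eventually hD hz,
    (hα.segLip.continuousAt hD hz).eventually (eventually_segment_subset hD (hα.mapsTo hz)),
    (hβ.segLip.continuousAt hD hz).eventually (eventually_segment_subset hD (hβ.mapsTo hz))]
    with z' h0 h1 h2 h3 h4
  refine ⟨h0, by rwa [segment_symm], ?_, ?_, h1⟩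
  · rw [mul_assoc]
    exact (hu _ _ h3).trans (mul_le_mul_of_nonneg_left h1 hB)
  · rw [mul_assoc]
    exact (hv _ _ h4).trans (mul_le_mul_of_nonneg_left h2 hB)

/-- The constants `B` and `μ` are chosen so that a step preserves `B`-Lipschitz graphs and
`μ`-Lipschitz base maps. -/
theorem IsLink.segLip_step {F G : Pt k n → Euc k} {Φ : Pt k n → Euc n}
    (h : IsLink R lam M ν D F G Φ) (hD : IsOpen D) (hlam0 : 0 ≤ lam) (hM : 0 ≤ M) (hB : 0 ≤ B)
    (hν0 : 0 ≤ ν) (hμ : 1 ≤ μ) (hBμ : lam * (B * μ) + M * μ ≤ B)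
    (hνμ : ν * ((B + 1) * μ) ≤ μ - 1)
    {u v : Euc n → Euc k} (hu : ∀ z ∈ D, ‖u z‖ ≤ R) (hv : ∀ z ∈ D, ‖v z‖ ≤ R)
    (hul : SegLip D B u) (hvl : SegLip D B v) {α β : Euc n → Euc n} (hα : IsShortStep D μ α)
    (hβ : IsShortStep D μ β) :
    SegLip D B (fun z => F (stepArg u v α β z)) ∧ SegLip D B (fun z => G (stepArg u v α β z)) ∧
    SegLip D μ (fun z => z - Φ (stepArg u v α β z)) ∧
    SegLip D μ (fun z => z + Φ (stepArg u v α β z)) := by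
  have hΦ : ∀ z ∈ D, ∀ᶠ z' in 𝓝 z, ‖Φ (stepArg u v α β z') - Φ (stepArg u v α β z)‖ ≤
      (μ - 1) * ‖z' - z‖ := by
    intro z hz
    filter_upwards [eventually_stepArg hD hB hul hvl hα hβ hz] with z' ⟨h0, h1, h2, h3, h4⟩
    refine (h.norm_Φ_sub_le _ (stepArg_mem hu hv hα hβ h0) _
      (stepArg_mem hu hv hα hβ hz) h1).trans ?_
    have e : ‖stepArg u v α β z' - stepArg u v α β z‖ ≤ (B + 1) * μ * ‖z' - z‖ := by
      have p1 : 0 ≤ μ * ‖z' - z‖ := by positivity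
      have p2 : 0 ≤ B * μ * ‖z' - z‖ := by positivity
      refine norm_prod_le_iff.2 ⟨?_, norm_prod_le_iff.2 ⟨?_, ?_⟩⟩
      · exact h2.trans (by linarith)
      · exact h3.trans (by linarith)
      · exact h4.trans (by linarith)
    calc _ ≤ ν * ((B + 1) * μ * ‖z' - z‖) := mul_le_mul_of_nonneg_left e hν0
      _ = ν * ((B + 1) * μ) * ‖z' - z‖ := by ring
      _ ≤ _ := mul_le_mul_of_nonneg_right hνμ (norm_nonneg _)
  refine ⟨segLip_of_eventually fun z hz => ?_, segLip_of_eventually fun z hz => ?_,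
    segLip_of_eventually fun z hz => ?_, segLip_of_eventually fun z hz => ?_⟩
  · filter_upwards [eventually_stepArg hD hB hul hvl hα hβ hz] with z' ⟨h0, h1, h2, h3, h4⟩
    refine (h.norm_F_sub_le _ (stepArg_mem hu hv hα hβ h0) _
      (stepArg_mem hu hv hα hβ hz) h1).trans ?_
    calc _ ≤ lam * (B * μ * ‖z' - z‖) + M * (μ * ‖z' - z‖) :=
          add_le_add (mul_le_mul_of_nonneg_left (max_le h2 h3) hlam0)
            (mul_le_mul_of_nonneg_left h4 hM)
      _ = (lam * (B * μ) + M * μ) * ‖z' - z‖ := by ring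
      _ ≤ _ := mul_le_mul_of_nonneg_right hBμ (norm_nonneg _)
  · filter_upwards [eventually_stepArg hD hB hul hvl hα hβ hz] with z' ⟨h0, h1, h2, h3, h4⟩
    refine (h.norm_G_sub_le _ (stepArg_mem hu hv hα hβ h0) _
      (stepArg_mem hu hv hα hβ hz) h1).trans ?_
    calc _ ≤ lam * (B * μ * ‖z' - z‖) + M * (μ * ‖z' - z‖) :=
          add_le_add (mul_le_mul_of_nonneg_left (max_le h2 h3) hlam0)
            (mul_le_mul_of_nonneg_left h4 hM)
      _ = (lam * (B * μ) + M * μ) * ‖z' - z‖ := by ring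
      _ ≤ _ := mul_le_mul_of_nonneg_right hBμ (norm_nonneg _)
  · filter_upwards [hΦ z hz] with z' hz'
    rw [sub_sub_sub_comm]
    exact (norm_sub_le _ _).trans (by linarith)
  · filter_upwards [hΦ z hz] with z' hz'
    rw [add_sub_add_comm]
    exact (norm_add_le _ _).trans (by linarith)

theorem IsLink.norm_Φ_stepArg_le {F G : Pt k n → Euc k} {Φ : Pt k n → Euc n}
    (h : IsLink R lam M ν D F G Φ) (hν : ν ≤ 1 / 3)
    {u v : Euc n → Euc k} (hu : ∀ z ∈ D, ‖u z‖ ≤ R) (hv : ∀ z ∈ D, ‖v z‖ ≤ R)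
    {α β : Euc n → Euc n} (hα : IsShortStep D μ α) (hβ : IsShortStep D μ β) {z : Euc n}
    (hz : z ∈ D) : ‖Φ (stepArg u v α β z)‖ ≤ gap D z / 2 := by
  have h1 := h.norm_Φ_le _ (stepArg_mem hu hv hα hβ hz)
  have h2 : ν * gap D (α z) ≤ 1 / 3 * gap D (α z) :=
    mul_le_mul_of_nonneg_right hν (gap_nonneg _)
  have h3 := gap_le_add (D := D) z (α z)
  have h4 := hα.norm_sub_le z hz
  have h5 : ‖Φ (stepArg u v α β z)‖ ≤ ν * gap D (α z) := h1
  linarith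

/-- Two steps based over the same point `z`. -/
theorem IsLink.step_sub_le {F G : Pt k n → Euc k} {Φ : Pt k n → Euc n}
    (h : IsLink R lam M ν D F G Φ) (hlam0 : 0 ≤ lam) (hM : 0 ≤ M) (hB : 0 ≤ B) (hν0 : 0 ≤ ν)
    {u v u' v' : Euc n → Euc k} (hu : ∀ z ∈ D, ‖u z‖ ≤ R) (hv : ∀ z ∈ D, ‖v z‖ ≤ R)
    (hu' : ∀ z ∈ D, ‖u' z‖ ≤ R) (hv' : ∀ z ∈ D, ‖v' z‖ ≤ R)
    (hul : SegLip D B u') (hvl : SegLip D B v') {α β α' β' : Euc n → Euc n}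
    (hα : IsShortStep D μ α) (hβ : IsShortStep D μ β)
    (hα' : IsShortStep D μ α') (hβ' : IsShortStep D μ β') {δ ρ : ℝ} (hδ : 0 ≤ δ)
    (huu : ∀ z ∈ D, ‖u z - u' z‖ ≤ δ) (hvv : ∀ z ∈ D, ‖v z - v' z‖ ≤ δ) {z : Euc n} (hz : z ∈ D)
    (hαα : ‖α z - α' z‖ ≤ ρ) (hββ : ‖β z - β' z‖ ≤ ρ) :
    ‖F (stepArg u v α β z) - F (stepArg u' v' α' β' z)‖ ≤ lam * (δ + B * ρ) + M * ρ ∧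
    ‖G (stepArg u v α β z) - G (stepArg u' v' α' β' z)‖ ≤ lam * (δ + B * ρ) + M * ρ ∧
    ‖Φ (stepArg u v α β z) - Φ (stepArg u' v' α' β' z)‖ ≤ ν * (δ + (B + 1) * ρ) := by
  have hρ : 0 ≤ ρ := (norm_nonneg _).trans hαα
  have m1 := stepArg_mem hu hv hα hβ hz
  have m2 := stepArg_mem hu' hv' hα' hβ' hz
  have s1 : segment ℝ (α z) (α' z) ⊆ D :=
    segment_subset_of_half_gap hz (hα.norm_sub_le z hz) (hα'.norm_sub_le z hz)
  have s2 : segment ℝ (β z) (β' z) ⊆ D :=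
    segment_subset_of_half_gap hz (hβ.norm_sub_le z hz) (hβ'.norm_sub_le z hz)
  have e1 : ‖u (α z) - u' (α' z)‖ ≤ δ + B * ρ :=
    (hul.norm_sub_le s1 (huu _ (hα.mapsTo hz))).trans
      (add_le_add le_rfl (mul_le_mul_of_nonneg_left hαα hB))
  have e2 : ‖v (β z) - v' (β' z)‖ ≤ δ + B * ρ :=
    (hvl.norm_sub_le s2 (hvv _ (hβ.mapsTo hz))).trans
      (add_le_add le_rfl (mul_le_mul_of_nonneg_left hββ hB))
  refine ⟨(h.norm_F_sub_le _ m1 _ m2 s1).trans (add_le_add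
      (mul_le_mul_of_nonneg_left (max_le e1 e2) hlam0) (mul_le_mul_of_nonneg_left hαα hM)),
    (h.norm_G_sub_le _ m1 _ m2 s1).trans (add_le_add
      (mul_le_mul_of_nonneg_left (max_le e1 e2) hlam0) (mul_le_mul_of_nonneg_left hαα hM)),
    (h.norm_Φ_sub_le _ m1 _ m2 s1).trans (mul_le_mul_of_nonneg_left ?_ hν0)⟩
  have : 0 ≤ B * ρ := mul_nonneg hB hρ
  refine norm_prod_le_iff.2 ⟨?_, norm_prod_le_iff.2 ⟨?_, ?_⟩⟩
  · exact e1.trans (by linarith)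
  · exact e2.trans (by linarith)
  · exact hαα.trans (by linarith)

/-- Candidates for an invariant sequence of graphs: `x i`, `y i` are the graphs, `b i` is the map
of the base from time `i` to time `i + 1` and `a i` is the map back. -/
structure IsCandidate (R B μ : ℝ) (D : Set (Euc n)) (x y : ℤ → Euc n → Euc k)
    (a b : ℤ → Euc n → Euc n) : Prop where
  norm_x_le : ∀ i, ∀ z ∈ D, ‖x i z‖ ≤ R
  norm_y_le : ∀ i, ∀ z ∈ D, ‖y i z‖ ≤ R
  segLip_x : ∀ i, SegLip D B (x i)
  segLip_y : ∀ i, SegLip D B (y i)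
  short_a : ∀ i, IsShortStep D μ (a i)
  short_b : ∀ i, IsShortStep D μ (b i)

/-- The improved map of the base from time `i + 1` back to time `i`. -/
def backStep (Φ : ℤ → Pt k n → Euc n) (x y : ℤ → Euc n → Euc k) (a : ℤ → Euc n → Euc n)
    (i : ℤ) (z : Euc n) : Euc n :=
  z - Φ i (stepArg (x i) (y (i + 1)) (a i) (fun w => w) z)

/-- The improved map of the base from time `i` to time `i + 1`. -/
def fwdStep (Φ : ℤ → Pt k n → Euc n) (x y : ℤ → Euc n → Euc k) (b : ℤ → Euc n → Euc n)
    (i : ℤ) (z : Euc n) : Euc n :=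
  z + Φ i (stepArg (x i) (y (i + 1)) (fun z => z) (b i) z)

/-- The transformed graph `x = x (i + 1)` at time `i + 1`, for the map `a` of the base from time
`i + 1` to time `i`. -/
def backGraph (F : ℤ → Pt k n → Euc k) (x y : ℤ → Euc n → Euc k) (a : ℤ → Euc n → Euc n)
    (i : ℤ) (z : Euc n) : Euc k :=
  F i (stepArg (x i) (y (i + 1)) (a i) (fun w => w) z)

/-- The transformed graph `y = y i` at time `i`, for the map `b` of the base from time `i` to
time `i + 1`. -/
def fwdGraph (G : ℤ → Pt k n → Euc k) (x y : ℤ → Euc n → Euc k) (b : ℤ → Euc n → Euc n)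
    (i : ℤ) (z : Euc n) : Euc k :=
  G i (stepArg (x i) (y (i + 1)) (fun z => z) (b i) z)

theorem IsCandidate.of_tendsto {x y : ℕ → ℤ → Euc n → Euc k} {a b : ℕ → ℤ → Euc n → Euc n}
    {x' y' : ℤ → Euc n → Euc k} {a' b' : ℤ → Euc n → Euc n}
    (h : ∀ m, IsCandidate R B μ D (x m) (y m) (a m) (b m))
    (hx : ∀ i, ∀ z ∈ D, Tendsto (fun m => x m i z) atTop (𝓝 (x' i z)))
    (hy : ∀ i, ∀ z ∈ D, Tendsto (fun m => y m i z) atTop (𝓝 (y' i z)))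
    (ha : ∀ i, ∀ z ∈ D, Tendsto (fun m => a m i z) atTop (𝓝 (a' i z)))
    (hb : ∀ i, ∀ z ∈ D, Tendsto (fun m => b m i z) atTop (𝓝 (b' i z))) :
    IsCandidate R B μ D x' y' a' b' where
  norm_x_le i z hz := le_of_tendsto' (hx i z hz).norm fun m => (h m).norm_x_le i z hz
  norm_y_le i z hz := le_of_tendsto' (hy i z hz).norm fun m => (h m).norm_y_le i z hz
  segLip_x i := SegLip.of_tendsto (fun m => (h m).segLip_x i) (hx i)
  segLip_y i := SegLip.of_tendsto (fun m => (h m).segLip_y i) (hy i)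
  short_a i := ⟨fun z hz => le_of_tendsto' ((ha i z hz).sub_const z).norm
      fun m => ((h m).short_a i).norm_sub_le z hz,
    SegLip.of_tendsto (fun m => ((h m).short_a i).segLip) (ha i)⟩
  short_b i := ⟨fun z hz => le_of_tendsto' ((hb i z hz).sub_const z).norm
      fun m => ((h m).short_b i).norm_sub_le z hz,
    SegLip.of_tendsto (fun m => ((h m).short_b i).segLip) (hb i)⟩

section Transform

variable {F G : ℤ → Pt k n → Euc k} {Φ : ℤ → Pt k n → Euc n}
  {x y x' y' : ℤ → Euc n → Euc k} {a b a' b' : ℤ → Euc n → Euc n}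

theorem IsCandidate.backStep (h : ∀ i, IsLink R lam M ν D (F i) (G i) (Φ i)) (hD : IsOpen D)
    (hlam0 : 0 ≤ lam) (hM : 0 ≤ M) (hB : 0 ≤ B) (hν0 : 0 ≤ ν) (hν : ν ≤ 1 / 3) (hμ : 1 ≤ μ)
    (hBμ : lam * (B * μ) + M * μ ≤ B) (hνμ : ν * ((B + 1) * μ) ≤ μ - 1)
    (hS : IsCandidate R B μ D x y a b) (i : ℤ) : IsShortStep D μ (backStep Φ x y a i) :=
  ⟨fun z hz => by
    have := (h i).norm_Φ_stepArg_le hν (hS.norm_x_le i) (hS.norm_y_le (i + 1))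
      (hS.short_a i) (IsShortStep.id hμ) hz
    rw [_root_.backStep, sub_sub_cancel_left, norm_neg]
    exact this,
  ((h i).segLip_step hD hlam0 hM hB hν0 hμ hBμ hνμ (hS.norm_x_le i) (hS.norm_y_le (i + 1))
    (hS.segLip_x i) (hS.segLip_y (i + 1)) (hS.short_a i) (IsShortStep.id hμ)).2.2.1⟩

theorem IsCandidate.fwdStep (h : ∀ i, IsLink R lam M ν D (F i) (G i) (Φ i)) (hD : IsOpen D)
    (hlam0 : 0 ≤ lam) (hM : 0 ≤ M) (hB : 0 ≤ B) (hν0 : 0 ≤ ν) (hν : ν ≤ 1 / 3) (hμ : 1 ≤ μ)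
    (hBμ : lam * (B * μ) + M * μ ≤ B) (hνμ : ν * ((B + 1) * μ) ≤ μ - 1)
    (hS : IsCandidate R B μ D x y a b) (i : ℤ) : IsShortStep D μ (fwdStep Φ x y b i) :=
  ⟨fun z hz => by
    have := (h i).norm_Φ_stepArg_le hν (hS.norm_x_le i) (hS.norm_y_le (i + 1))
      (IsShortStep.id hμ) (hS.short_b i) hz
    rw [_root_.fwdStep, add_sub_cancel_left]
    exact this,
  ((h i).segLip_step hD hlam0 hM hB hν0 hμ hBμ hνμ (hS.norm_x_le i) (hS.norm_y_le (i + 1))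
    (hS.segLip_x i) (hS.segLip_y (i + 1)) (IsShortStep.id hμ) (hS.short_b i)).2.2.2⟩

/-- The new graphs are computed with the new maps of the base, which makes their dependence on the
old maps of the base as small as `Φ`. -/
theorem IsCandidate.transform (h : ∀ i, IsLink R lam M ν D (F i) (G i) (Φ i)) (hD : IsOpen D)
    (hlam0 : 0 ≤ lam) (hM : 0 ≤ M) (hB : 0 ≤ B) (hν0 : 0 ≤ ν) (hν : ν ≤ 1 / 3) (hμ : 1 ≤ μ)
    (hBμ : lam * (B * μ) + M * μ ≤ B) (hνμ : ν * ((B + 1) * μ) ≤ μ - 1)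
    (hS : IsCandidate R B μ D x y a b) :
    IsCandidate R B μ D (fun i => backGraph F x y (_root_.backStep Φ x y a) (i - 1))
      (fwdGraph G x y (_root_.fwdStep Φ x y b)) (_root_.backStep Φ x y a)
      (_root_.fwdStep Φ x y b) :=
  have ha := hS.backStep h hD hlam0 hM hB hν0 hν hμ hBμ hνμ
  have hb := hS.fwdStep h hD hlam0 hM hB hν0 hν hμ hBμ hνμ
  { norm_x_le := fun i _ hz => (h (i - 1)).norm_F_le _ (stepArg_mem (hS.norm_x_le _)
      (hS.norm_y_le _) (ha _) (IsShortStep.id hμ) hz)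
    norm_y_le := fun i _ hz => (h i).norm_G_le _ (stepArg_mem (hS.norm_x_le _)
      (hS.norm_y_le _) (IsShortStep.id hμ) (hb _) hz)
    segLip_x := fun i => ((h (i - 1)).segLip_step hD hlam0 hM hB hν0 hμ hBμ hνμ
      (hS.norm_x_le _) (hS.norm_y_le _) (hS.segLip_x _) (hS.segLip_y _) (ha _)
      (IsShortStep.id hμ)).1
    segLip_y := fun i => ((h i).segLip_step hD hlam0 hM hB hν0 hμ hBμ hνμ
      (hS.norm_x_le _) (hS.norm_y_le _) (hS.segLip_x _) (hS.segLip_y _) (IsShortStep.id hμ)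
      (hb _)).2.1
    short_a := ha
    short_b := hb }

theorem IsCandidate.transform_sub_le (h : ∀ i, IsLink R lam M ν D (F i) (G i) (Φ i))
    (hD : IsOpen D)
    (hlam0 : 0 ≤ lam) (hM : 0 ≤ M) (hB : 0 ≤ B) (hν0 : 0 ≤ ν) (hν : ν ≤ 1 / 3) (hμ : 1 ≤ μ)
    (hBμ : lam * (B * μ) + M * μ ≤ B) (hνμ : ν * ((B + 1) * μ) ≤ μ - 1)
    (hS : IsCandidate R B μ D x y a b) (hT : IsCandidate R B μ D x' y' a' b')
    {δ : ℝ} (hδ : 0 ≤ δ) (hx : ∀ i, ∀ z ∈ D, ‖x i z - x' i z‖ ≤ δ)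
    (hy : ∀ i, ∀ z ∈ D, ‖y i z - y' i z‖ ≤ δ) (ha : ∀ i, ∀ z ∈ D, ‖a i z - a' i z‖ ≤ δ)
    (hb : ∀ i, ∀ z ∈ D, ‖b i z - b' i z‖ ≤ δ) (i : ℤ) {z : Euc n} (hz : z ∈ D) :
    ‖_root_.backStep Φ x y a i z - _root_.backStep Φ x' y' a' i z‖ ≤ ν * (B + 2) * δ ∧
    ‖_root_.fwdStep Φ x y b i z - _root_.fwdStep Φ x' y' b' i z‖ ≤ ν * (B + 2) * δ ∧
    ‖backGraph F x y (_root_.backStep Φ x y a) i z -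
      backGraph F x' y' (_root_.backStep Φ x' y' a') i z‖ ≤
        lam * (δ + B * (ν * (B + 2) * δ)) + M * (ν * (B + 2) * δ) ∧
    ‖fwdGraph G x y (_root_.fwdStep Φ x y b) i z -
      fwdGraph G x' y' (_root_.fwdStep Φ x' y' b') i z‖ ≤
        lam * (δ + B * (ν * (B + 2) * δ)) + M * (ν * (B + 2) * δ) := by
  have hid : IsShortStep D μ (fun z => z) := IsShortStep.id hμ
  have hρ : 0 ≤ ν * (B + 2) * δ := by positivity
  have za : ‖_root_.backStep Φ x y a i z - _root_.backStep Φ x' y' a' i z‖ ≤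
      ν * (B + 2) * δ := by
    have := ((h i).step_sub_le hlam0 hM hB hν0 (hS.norm_x_le i) (hS.norm_y_le (i + 1))
      (hT.norm_x_le i) (hT.norm_y_le (i + 1)) (hT.segLip_x i) (hT.segLip_y (i + 1))
      (hS.short_a i) hid (hT.short_a i) hid hδ (hx i) (hy (i + 1)) hz (ha i z hz)
      (by simpa using hδ)).2.2
    rw [_root_.backStep, _root_.backStep, sub_sub_sub_cancel_left, norm_sub_rev]
    exact this.trans_eq (by ring)
  have zb : ‖_root_.fwdStep Φ x y b i z - _root_.fwdStep Φ x' y' b' i z‖ ≤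
      ν * (B + 2) * δ := by
    have := ((h i).step_sub_le hlam0 hM hB hν0 (hS.norm_x_le i) (hS.norm_y_le (i + 1))
      (hT.norm_x_le i) (hT.norm_y_le (i + 1)) (hT.segLip_x i) (hT.segLip_y (i + 1))
      hid (hS.short_b i) hid (hT.short_b i) hδ (hx i) (hy (i + 1)) hz (by simpa using hδ)
      (hb i z hz)).2.2
    rw [_root_.fwdStep, _root_.fwdStep, add_sub_add_left_eq_sub]
    exact this.trans_eq (by ring)
  refine ⟨za, zb, ?_, ?_⟩
  · exact ((h i).step_sub_le hlam0 hM hB hν0 (hS.norm_x_le _) (hS.norm_y_le _)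
      (hT.norm_x_le _) (hT.norm_y_le _) (hT.segLip_x _) (hT.segLip_y _)
      (hS.backStep h hD hlam0 hM hB hν0 hν hμ hBμ hνμ i) hid
      (hT.backStep h hD hlam0 hM hB hν0 hν hμ hBμ hνμ i) hid hδ (hx i) (hy (i + 1)) hz za
      (by simpa using hρ)).1
  · exact ((h i).step_sub_le hlam0 hM hB hν0 (hS.norm_x_le _) (hS.norm_y_le _)
      (hT.norm_x_le _) (hT.norm_y_le _) (hT.segLip_x _) (hT.segLip_y _)
      hid (hS.fwdStep h hD hlam0 hM hB hν0 hν hμ hBμ hνμ i)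
      hid (hT.fwdStep h hD hlam0 hM hB hν0 hν hμ hBμ hνμ i) hδ (hx i) (hy (i + 1)) hz
      (by simpa using hρ) zb).2.1

/-- The graphs are found together with the maps of the base, as the fixed point of a contraction,
so that no inverse function has to be taken. -/
theorem exists_transform_fixedPoint (h : ∀ i, IsLink R lam M ν D (F i) (G i) (Φ i))
    (hD : IsOpen D) (hR : 0 ≤ R) (hlam0 : 0 ≤ lam) (hlam1 : lam ≤ 1)
    (hM : 0 ≤ M) (hB : 0 ≤ B) (hν0 : 0 ≤ ν) (hν : ν ≤ 1 / 3) (hμ : 1 ≤ μ)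
    (hBμ : lam * (B * μ) + M * μ ≤ B) (hνμ : ν * ((B + 1) * μ) ≤ μ - 1)
    (hνB : ν * (B + 2) ≤ 1 / 2) (hq : lam + (B + M) * (ν * (B + 2)) < 1)
    (hDb : Bornology.IsBounded D) :
    ∃ (x y : ℤ → Euc n → Euc k) (a b : ℤ → Euc n → Euc n), IsCandidate R B μ D x y a b ∧
      ∀ i, ∀ z ∈ D, backStep Φ x y a i z = a i z ∧ fwdStep Φ x y b i z = b i z ∧
        backGraph F x y a i z = x (i + 1) z ∧ fwdGraph G x y b i z = y i z := by
  set θ : ℝ := max (1 / 2) (lam + (B + M) * (ν * (B + 2))) with hθ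
  have hθ1 : θ < 1 := max_lt (by norm_num) hq
  have hθ0 : 0 ≤ θ := le_max_of_le_left (by norm_num)
  obtain ⟨d, hd⟩ := Metric.isBounded_iff.1 hDb
  let Γ : (ℤ × Euc n → Euc k × Euc k × Euc n × Euc n) →
      ℤ × Euc n → Euc k × Euc k × Euc n × Euc n := fun S q =>
    (backGraph F (fun i z => (S (i, z)).1) (fun i z => (S (i, z)).2.1)
        (backStep Φ (fun i z => (S (i, z)).1) (fun i z => (S (i, z)).2.1)
          (fun i z => (S (i, z)).2.2.1)) (q.1 - 1) q.2,
      fwdGraph G (fun i z => (S (i, z)).1) (fun i z => (S (i, z)).2.1)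
        (fwdStep Φ (fun i z => (S (i, z)).1) (fun i z => (S (i, z)).2.1)
          (fun i z => (S (i, z)).2.2.2)) q.1 q.2,
      backStep Φ (fun i z => (S (i, z)).1) (fun i z => (S (i, z)).2.1)
        (fun i z => (S (i, z)).2.2.1) q.1 q.2,
      fwdStep Φ (fun i z => (S (i, z)).1) (fun i z => (S (i, z)).2.1)
        (fun i z => (S (i, z)).2.2.2) q.1 q.2)
  let Good : (ℤ × Euc n → Euc k × Euc k × Euc n × Euc n) → Prop := fun S =>
    IsCandidate R B μ D (fun i z => (S (i, z)).1) (fun i z => (S (i, z)).2.1)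
      (fun i z => (S (i, z)).2.2.1) (fun i z => (S (i, z)).2.2.2)
  have hΓ : ∀ S, Good S → Good (Γ S) := fun S hS =>
    hS.transform h hD hlam0 hM hB hν0 hν hμ hBμ hνμ
  have hlim : ∀ (S : ℕ → ℤ × Euc n → Euc k × Euc k × Euc n × Euc n)
      (T : ℤ × Euc n → Euc k × Euc k × Euc n × Euc n), (∀ m, Good (S m)) →
      (∀ q ∈ {q : ℤ × Euc n | q.2 ∈ D}, Tendsto (fun m => S m q) atTop (𝓝 (T q))) → Good T :=
    fun S T hS hT => IsCandidate.of_tendsto hS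
      (fun i z hz => (continuous_fst.tendsto _).comp (hT (i, z) hz))
      (fun i z hz => ((continuous_fst.comp continuous_snd).tendsto _).comp (hT (i, z) hz))
      (fun i z hz => ((continuous_fst.comp (continuous_snd.comp continuous_snd)).tendsto _).comp
        (hT (i, z) hz))
      (fun i z hz => ((continuous_snd.comp (continuous_snd.comp continuous_snd)).tendsto _).comp
        (hT (i, z) hz))
  have hcontr : ∀ S T, Good S → Good T → ∀ δ, 0 ≤ δ →
      (∀ q ∈ {q : ℤ × Euc n | q.2 ∈ D}, ‖S q - T q‖ ≤ δ * 1) →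
      ∀ q ∈ {q : ℤ × Euc n | q.2 ∈ D}, ‖Γ S q - Γ T q‖ ≤ θ * δ * 1 := by
    intro S T hS hT δ hδ hST q hq
    have key : ∀ i, ∀ z ∈ D, ‖(S (i, z)).1 - (T (i, z)).1‖ ≤ δ ∧
        ‖(S (i, z)).2.1 - (T (i, z)).2.1‖ ≤ δ ∧ ‖(S (i, z)).2.2.1 - (T (i, z)).2.2.1‖ ≤ δ ∧
        ‖(S (i, z)).2.2.2 - (T (i, z)).2.2.2‖ ≤ δ := by
      intro i z hz
      have := hST (i, z) hz
      rw [mul_one] at this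
      obtain ⟨h1, h2⟩ := norm_prod_le_iff.1 this
      obtain ⟨h2, h3⟩ := norm_prod_le_iff.1 h2
      obtain ⟨h3, h4⟩ := norm_prod_le_iff.1 h3
      exact ⟨h1, h2, h3, h4⟩
    have hsub := fun i => IsCandidate.transform_sub_le h hD hlam0 hM hB hν0 hν hμ hBμ hνμ hS hT hδ
      (fun i z hz => (key i z hz).1) (fun i z hz => (key i z hz).2.1)
      (fun i z hz => (key i z hz).2.2.1) (fun i z hz => (key i z hz).2.2.2) i hq
    have hθa : ν * (B + 2) * δ ≤ θ * δ :=
      mul_le_mul_of_nonneg_right (hνB.trans (le_max_left _ _)) hδ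
    have hθx : lam * (δ + B * (ν * (B + 2) * δ)) + M * (ν * (B + 2) * δ) ≤ θ * δ := by
      have e1 : lam * (B * (ν * (B + 2) * δ)) ≤ 1 * (B * (ν * (B + 2) * δ)) :=
        mul_le_mul_of_nonneg_right hlam1 (by positivity)
      have e2 : (lam + (B + M) * (ν * (B + 2))) * δ ≤ θ * δ :=
        mul_le_mul_of_nonneg_right (le_max_right _ _) hδ
      linarith
    rw [mul_one]
    exact norm_prod_le_iff.2 ⟨(hsub (q.1 - 1)).2.2.1.trans hθx,
      norm_prod_le_iff.2 ⟨(hsub q.1).2.2.2.trans hθx,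
        norm_prod_le_iff.2 ⟨(hsub q.1).1.trans hθa, (hsub q.1).2.1.trans hθa⟩⟩⟩
  have hzero : SegLip D B (fun _ : Euc n => (0 : Euc k)) := fun z z' _ => by
    simpa using mul_nonneg hB (norm_nonneg (z' - z))
  have hid : IsShortStep D μ (fun z => z) := IsShortStep.id hμ
  have hS₀ : Good (fun q => (0, 0, q.2, q.2)) :=
    ⟨fun _ _ _ => by simpa using hR, fun _ _ _ => by simpa using hR, fun _ => hzero,
      fun _ => hzero, fun _ => hid, fun _ => hid⟩
  have hS₁ := hΓ (fun q => (0, 0, q.2, q.2)) hS₀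
  obtain ⟨S, hS, hfix⟩ := exists_fixedPoint_of_contracting Γ Good hlim hΓ hθ0 hθ1 hcontr
    (S₀ := fun q => (0, 0, q.2, q.2))
    (C := max R d) (le_max_of_le_left hR) hS₀ (by
      intro q hq
      rw [mul_one]
      refine norm_prod_le_iff.2 ⟨?_, norm_prod_le_iff.2 ⟨?_, norm_prod_le_iff.2 ⟨?_, ?_⟩⟩⟩
      · refine le_trans ?_ (le_max_left _ _)
        rw [Prod.fst_sub, zero_sub, norm_neg]
        exact hS₁.norm_x_le q.1 q.2 hq
      · refine le_trans ?_ (le_max_left _ _)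
        rw [Prod.snd_sub, Prod.fst_sub, zero_sub, norm_neg]
        exact hS₁.norm_y_le q.1 q.2 hq
      · refine le_trans ?_ (le_max_right _ _)
        rw [Prod.snd_sub, Prod.snd_sub, Prod.fst_sub, ← dist_eq_norm]
        exact hd hq ((hS₁.short_a q.1).mapsTo hq)
      · refine le_trans ?_ (le_max_right _ _)
        rw [Prod.snd_sub, Prod.snd_sub, Prod.snd_sub, ← dist_eq_norm]
        exact hd hq ((hS₁.short_b q.1).mapsTo hq))
  refine ⟨_, _, _, _, hS, fun i z hz => ?_⟩
  have h1 : backStep Φ (fun i z => (S (i, z)).1) (fun i z => (S (i, z)).2.1)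
        (fun i z => (S (i, z)).2.2.1) i z = (S (i, z)).2.2.1 :=
    congrArg (fun p => p.2.2.1) (hfix (i, z) hz)
  have h2 : fwdStep Φ (fun i z => (S (i, z)).1) (fun i z => (S (i, z)).2.1)
        (fun i z => (S (i, z)).2.2.2) i z = (S (i, z)).2.2.2 :=
    congrArg (fun p => p.2.2.2) (hfix (i, z) hz)
  refine ⟨h1, h2, ?_, ?_⟩
  · have h3 := congrArg (fun p => p.1) (hfix (i + 1, z) hz)
    simp only [Γ, add_sub_cancel_right] at h3
    rw [← h3]
    simp only [backGraph, stepArg, h1]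
  · have h3 := congrArg (fun p => p.2.1) (hfix (i, z) hz)
    simp only [Γ] at h3
    conv_rhs => rw [← h3]
    simp only [fwdGraph, stepArg, h2]

/-- Existence of an invariant sequence of Lipschitz graphs. -/
theorem exists_graphsInvariant (h : ∀ i, IsLink R lam M ν D (F i) (G i) (Φ i))
    (hD : IsOpen D) (hDb : Bornology.IsBounded D) (hR : 0 ≤ R) (hlam0 : 0 ≤ lam) (hlam1 : lam ≤ 1)
    (hM : 0 ≤ M) (hB : 0 ≤ B) (hν0 : 0 ≤ ν) (hν : ν ≤ 1 / 3) (hμ : 1 ≤ μ)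
    (hBμ : lam * (B * μ) + M * μ ≤ B) (hνμ : ν * ((B + 1) * μ) ≤ μ - 1)
    (hνB : ν * (B + 2) ≤ 1 / 2) (hq : lam + (B + M) * (ν * (B + 2)) < 1) :
    ∃ (x y : ℤ → Euc n → Euc k) (a b : ℤ → Euc n → Euc n), IsCandidate R B μ D x y a b ∧
      GraphsInvariant R D F G Φ x y ∧
      (∀ i, ∀ z ∈ D, a i (b i z) = z ∧ b i (a i z) = z) ∧
      ∀ i, ∀ z ∈ D, Connects (F i) (G i) (Φ i) (x i z) (y i z) z
        (x (i + 1) (b i z)) (y (i + 1) (b i z)) (b i z) := by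
  obtain ⟨x, y, a, b, hS, hfix⟩ := exists_transform_fixedPoint h hD hR hlam0 hlam1 hM hB hν0 hν hμ
    hBμ hνμ hνB hq hDb
  have hνB' : ν * (B + 1) ≤ 1 / 2 := by linarith
  have hid : IsShortStep D μ (fun z => z) := IsShortStep.id hμ
  have ea : ∀ i, ∀ z ∈ D, z = a i z + Φ i (x i (a i z), y (i + 1) z, a i z) := fun i z hz => by
    have := (hfix i z hz).1
    rw [backStep, sub_eq_iff_eq_add] at this
    exact this
  have eb : ∀ i, ∀ z ∈ D, b i z = z + Φ i (x i z, y (i + 1) (b i z), z) := fun i z hz =>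
    (hfix i z hz).2.1.symm
  have ma : ∀ i, MapsTo (a i) D D := fun i => (hS.short_a i).mapsTo
  have mb : ∀ i, MapsTo (b i) D D := fun i => (hS.short_b i).mapsTo
  have pa : ∀ i, ∀ z ∈ D, (x i (a i z), y (i + 1) z, a i z) ∈ crossSection k n R D :=
    fun i z hz => stepArg_mem (hS.norm_x_le i) (hS.norm_y_le (i + 1)) (hS.short_a i) hid hz
  have pb : ∀ i, ∀ z ∈ D, (x i z, y (i + 1) (b i z), z) ∈ crossSection k n R D :=
    fun i z hz => stepArg_mem (hS.norm_x_le i) (hS.norm_y_le (i + 1)) hid (hS.short_b i) hz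
  -- The base maps are inverse to each other because a step is determined by either of its ends.
  have hinv : ∀ i, ∀ z ∈ D, a i (b i z) = z ∧ b i (a i z) = z := by
    intro i z hz
    constructor
    · have := ((h i).compare (h i) hlam0 hlam1 hM hB hν0 hν hνB' (η := 0) le_rfl
        (by simp) (by simp) (by simp) (hS.segLip_x i) (hS.segLip_y (i + 1))
        (pa i _ (mb i hz)) (pb i z hz) (mb i hz) (ea i _ (mb i hz)) (eb i z hz)
        (by simp) (by simp) (Or.inr rfl)).1
      rw [mul_zero, mul_zero, add_zero] at this
      exact sub_eq_zero.1 (norm_le_zero_iff.1 this)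
    · have := ((h i).compare (h i) hlam0 hlam1 hM hB hν0 hν hνB' (η := 0) le_rfl
        (by simp) (by simp) (by simp) (hS.segLip_x i) (hS.segLip_y (i + 1))
        (pb i _ (ma i hz)) (pa i z hz) (mb i (ma i hz)) (eb i _ (ma i hz)) (ea i z hz)
        (by simp) (by simp) (Or.inl rfl)).2.1
      rw [mul_zero, mul_zero, add_zero] at this
      exact sub_eq_zero.1 (norm_le_zero_iff.1 this)
  have hcon : ∀ i, ∀ z ∈ D, Connects (F i) (G i) (Φ i) (x i z) (y i z) z
      (x (i + 1) (b i z)) (y (i + 1) (b i z)) (b i z) := fun i z hz => by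
    refine ⟨?_, (hfix i z hz).2.2.2.symm, eb i z hz⟩
    have := (hfix i _ (mb i hz)).2.2.1
    rw [backGraph, stepArg, (hinv i z hz).1] at this
    exact this.symm
  refine ⟨x, y, a, b, hS, ⟨hS.norm_x_le, hS.norm_y_le, fun i z hz => ⟨b i z, mb i hz, hcon i z hz⟩,
    fun i z hz => ⟨a i z, ma i hz, ?_⟩⟩, hinv, hcon⟩
  have := hcon i _ (ma i hz)
  rwa [(hinv i z hz).2] at this

end Transform

end Existence

/-! ### Regularity of orbits over the base -/

section Orbits

variable {k n : ℕ}

/-- The linear map `(x, y, z) ↦ (α x, β y, γ z)`. -/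
noncomputable def diagMap (k n : ℕ) (α β γ : ℝ) : Pt k n →L[ℝ] Pt k n :=
  (α • ContinuousLinearMap.fst ℝ (Euc k) (Euc k × Euc n)).prod
    ((β • (ContinuousLinearMap.fst ℝ (Euc k) (Euc n)).comp
        (ContinuousLinearMap.snd ℝ (Euc k) (Euc k × Euc n))).prod
      (γ • (ContinuousLinearMap.snd ℝ (Euc k) (Euc n)).comp
        (ContinuousLinearMap.snd ℝ (Euc k) (Euc k × Euc n))))

@[simp] theorem diagMap_apply (α β γ : ℝ) (p : Pt k n) :
    diagMap k n α β γ p = (α • p.1, β • p.2.1, γ • p.2.2) := rfl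

theorem norm_diagMap_le {α β γ M : ℝ} (hα : |α| ≤ M) (hβ : |β| ≤ M) (hγ : |γ| ≤ M) :
    ‖diagMap k n α β γ‖ ≤ M := by
  have hM : 0 ≤ M := (abs_nonneg α).trans hα
  refine ContinuousLinearMap.opNorm_le_bound _ hM fun p => ?_
  have h1 : ‖p.1‖ ≤ ‖p‖ := norm_fst_le p
  have h2 : ‖p.2.1‖ ≤ ‖p‖ := (norm_fst_le p.2).trans (norm_snd_le p)
  have h3 : ‖p.2.2‖ ≤ ‖p‖ := (norm_snd_le p.2).trans (norm_snd_le p)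
  rw [diagMap_apply]
  refine norm_prod_le_iff.2 ⟨?_, norm_prod_le_iff.2 ⟨?_, ?_⟩⟩ <;>
    rw [norm_smul, Real.norm_eq_abs] <;>
    exact mul_le_mul ‹_› ‹_› (norm_nonneg _) hM

/-- The embedding `(x, y, z) ↦ (x, y, c z, 0)` of directions into the space of arguments. -/
noncomputable def argMap (k n : ℕ) (c : ℝ) : Pt k n →L[ℝ] Arg k n :=
  (ContinuousLinearMap.fst ℝ (Euc k) (Euc k × Euc n)).prod
    (((ContinuousLinearMap.fst ℝ (Euc k) (Euc n)).comp
        (ContinuousLinearMap.snd ℝ (Euc k) (Euc k × Euc n))).prod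
      ((c • (ContinuousLinearMap.snd ℝ (Euc k) (Euc n)).comp
        (ContinuousLinearMap.snd ℝ (Euc k) (Euc k × Euc n))).prod 0))

@[simp] theorem argMap_apply (c : ℝ) (p : Pt k n) :
    argMap k n c p = (p.1, p.2.1, c • p.2.2, 0) := rfl

/-- The weight `μ ^ |m|` of the point of an orbit at time `m`. -/
noncomputable def orbitWeight {J : Type*} (μ : ℝ) (j : J × ℤ) : ℝ := μ ^ j.2.natAbs

/-- The times `m - 1, m, m + 1` that enter the equation for the point of an orbit at time `m`. -/
def orbitNeighbor {J : Type*} (j : J × ℤ) (κ : Fin 3) : J × ℤ := (j.1, j.2 + ((κ : ℕ) : ℤ) - 1)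

/-- The coefficients of the nonlinear terms in the equation for the point of an orbit at time `m`:
`X m` comes from time `m - 1`, `Y (m + 1)` from time `m + 1`, and the increment of `K Z` from time
`m - 1` if `m > 0` and from time `m` if `m < 0`. -/
noncomputable def orbitCoeff (k n : ℕ) (K ε : ℝ) (m : ℤ) : Fin 3 → Pt k n →L[ℝ] Pt k n :=
  ![diagMap k n 1 0 (if 0 < m then ε * K else 0), diagMap k n 0 0 (if m < 0 then -(ε * K) else 0),
    diagMap k n 0 1 0]

/-- The coefficients of the linear terms: `K Z m` is the value at time `m - 1` if `m > 0` and the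
value at time `m + 1` if `m < 0`, up to the increment. -/
noncomputable def orbitTransfer (k n : ℕ) (m : ℤ) : Fin 3 → Pt k n →L[ℝ] Pt k n :=
  ![diagMap k n 0 0 (if 0 < m then 1 else 0), 0, diagMap k n 0 0 (if m < 0 then 1 else 0)]

theorem norm_orbitCoeff_le {K ε M : ℝ} (hε : |ε * K| ≤ M) (hM : 1 ≤ M) (m : ℤ) (κ : Fin 3) :
    ‖orbitCoeff k n K ε m κ‖ ≤ M := by
  have h0 : |(0 : ℝ)| ≤ M := by rw [abs_zero]; linarith
  have h1 : |(1 : ℝ)| ≤ M := by rwa [abs_one]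
  fin_cases κ
  · exact norm_diagMap_le h1 h0 (by split_ifs <;> assumption)
  · exact norm_diagMap_le h0 h0 (by split_ifs <;> simpa only [abs_neg])
  · exact norm_diagMap_le h0 h1 h0

theorem norm_orbitTransfer_le {M : ℝ} (hM : 1 ≤ M) (m : ℤ) (κ : Fin 3) :
    ‖orbitTransfer k n m κ‖ ≤ M := by
  have h0 : |(0 : ℝ)| ≤ M := by rw [abs_zero]; linarith
  have h1 : |(1 : ℝ)| ≤ M := by rwa [abs_one]
  fin_cases κ
  · exact norm_diagMap_le h0 h0 (by split_ifs <;> assumption)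
  · simpa [orbitTransfer] using by linarith
  · exact norm_diagMap_le h0 h0 (by split_ifs <;> assumption)

/-- The equation for an orbit contracts in every norm with weight `ω ^ s`, `1 ≤ s ≤ r + 1`: the
weight `μ ^ (s |m|)` costs at most `μ ^ (r + 1)` in the hyperbolic directions and gains `μ⁻¹` in the
neutral one. -/
theorem weightContracts_orbit {J : Type*} {r s : ℕ} {lam M μ θ K : ℝ} (hM : 0 ≤ M)
    (hlam : 0 ≤ lam) (hμ : 1 ≤ μ) (hK : 1 ≤ K) {T : J × ℤ → Arg k n →L[ℝ] Pt k n}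
    (hx : ∀ j, ∀ v : Pt k n, ‖(T j (argMap k n 1 v)).1‖ ≤
      lam * max ‖v.1‖ ‖v.2.1‖ + M * ‖v.2.2‖)
    (hy : ∀ j, ∀ v : Pt k n, ‖(T j (argMap k n 1 v)).2.1‖ ≤
      lam * max ‖v.1‖ ‖v.2.1‖ + M * ‖v.2.2‖)
    (hz : ∀ j, ∀ v : Pt k n, ‖(T j (argMap k n 1 v)).2.2‖ ≤ M * ‖v‖)
    (ε : J → ℝ) (hε0 : ∀ j, 0 ≤ ε j) (hθ₁ : (lam + M / K) * μ ^ (r + 1) ≤ θ)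
    (hθ₂ : ∀ j, μ⁻¹ + ε j * K * M ≤ θ) (hs : 1 ≤ s) (hsr : s ≤ r + 1) :
    WeightContracts (orbitWeight μ) orbitNeighbor θ s (fun (j : J × ℤ) κ =>
      (orbitCoeff k n K (ε j.1) j.2 κ).comp ((T (orbitNeighbor j κ)).comp (argMap k n K⁻¹)) +
        orbitTransfer k n j.2 κ) := by
  have hμ0 : 0 < μ := one_pos.trans_le hμ
  have hK0 : 0 < K := one_pos.trans_le hK
  rintro ⟨j, m⟩ Q hQ
  have hscale : ∀ q : Pt k n, argMap k n K⁻¹ q = argMap k n 1 (q.1, q.2.1, K⁻¹ • q.2.2) :=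
    fun q => by simp
  have hsn : ∀ q : Pt k n, ‖K⁻¹ • q.2.2‖ ≤ K⁻¹ * ‖q‖ := fun q => by
    rw [norm_smul, Real.norm_of_nonneg (inv_nonneg.2 hK0.le)]
    exact mul_le_mul_of_nonneg_left ((norm_snd_le _).trans (norm_snd_le _)) (inv_nonneg.2 hK0.le)
  have hfst : ∀ q : Pt k n, lam * max ‖q.1‖ ‖q.2.1‖ + M * ‖K⁻¹ • q.2.2‖ ≤ (lam + M / K) * ‖q‖ :=
    fun q => by
      have e1 : max ‖q.1‖ ‖q.2.1‖ ≤ ‖q‖ :=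
        max_le (norm_fst_le q) ((norm_fst_le _).trans (norm_snd_le _))
      calc _ ≤ lam * ‖q‖ + M * (K⁻¹ * ‖q‖) :=
            add_le_add (mul_le_mul_of_nonneg_left e1 hlam) (mul_le_mul_of_nonneg_left (hsn q) hM)
        _ = _ := by ring
  have tx : ∀ i (q : Pt k n), ‖(T i (argMap k n K⁻¹ q)).1‖ ≤ (lam + M / K) * ‖q‖ := fun i q => by
    rw [hscale]; exact (hx i _).trans (hfst q)
  have ty : ∀ i (q : Pt k n), ‖(T i (argMap k n K⁻¹ q)).2.1‖ ≤ (lam + M / K) * ‖q‖ := fun i q => by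
    rw [hscale]; exact (hy i _).trans (hfst q)
  have tz : ∀ i (q : Pt k n), ‖(T i (argMap k n K⁻¹ q)).2.2‖ ≤ M * ‖q‖ := fun i q => by
    rw [hscale]
    refine (hz i _).trans (mul_le_mul_of_nonneg_left ?_ hM)
    refine norm_prod_le_iff.2 ⟨norm_fst_le q, norm_prod_le_iff.2
      ⟨(norm_fst_le q.2).trans (norm_snd_le q), (hsn q).trans ?_⟩⟩
    exact mul_le_of_le_one_left (norm_nonneg _) (inv_le_one_of_one_le₀ hK)
  set W : ℝ := orbitWeight μ (j, m) ^ s with hW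
  have hW0 : 0 ≤ W := by rw [hW, orbitWeight]; positivity
  have hup : ∀ m' : ℤ, m'.natAbs ≤ m.natAbs + 1 → orbitWeight μ ((j, m') : J × ℤ) ^ s ≤
      μ ^ (r + 1) * W := fun m' hm' => by
    have e1 : orbitWeight μ ((j, m') : J × ℤ) ≤ μ * orbitWeight μ (j, m) := by
      rw [orbitWeight, orbitWeight, ← pow_succ']
      exact pow_le_pow_right₀ hμ hm'
    calc _ ≤ (μ * orbitWeight μ (j, m)) ^ s :=
          pow_le_pow_left₀ (by rw [orbitWeight]; positivity) e1 s
      _ = μ ^ s * W := mul_pow _ _ _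
      _ ≤ _ := mul_le_mul_of_nonneg_right (pow_le_pow_right₀ hμ hsr) hW0
  have hdown : ∀ m' : ℤ, m'.natAbs + 1 = m.natAbs → orbitWeight μ ((j, m') : J × ℤ) ^ s ≤
      μ⁻¹ * W := fun m' hm' => by
    have e1 : orbitWeight μ ((j, m') : J × ℤ) = μ⁻¹ * orbitWeight μ (j, m) := by
      rw [orbitWeight, orbitWeight, ← hm', pow_succ]
      field_simp
    rw [e1, mul_pow]
    refine mul_le_mul_of_nonneg_right ?_ hW0
    exact pow_le_of_le_one (inv_nonneg.2 hμ0.le) (inv_le_one_of_one_le₀ hμ) (by omega)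
  have n0 : orbitNeighbor ((j, m) : J × ℤ) 0 = (j, m - 1) := by simp [orbitNeighbor]
  have n1 : orbitNeighbor ((j, m) : J × ℤ) 1 = (j, m) := by simp [orbitNeighbor]
  have n2 : orbitNeighbor ((j, m) : J × ℤ) 2 = (j, m + 1) := by
    simp only [orbitNeighbor, Prod.mk.injEq, true_and]
    rw [show ((2 : Fin 3) : ℕ) = 2 from rfl]; push_cast; ring
  have q0 : ‖Q 0‖ ≤ orbitWeight μ ((j, m - 1) : J × ℤ) ^ s := n0 ▸ hQ 0
  have q1 : ‖Q 1‖ ≤ W := by have := hQ 1; rwa [n1] at this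
  have q2 : ‖Q 2‖ ≤ orbitWeight μ ((j, m + 1) : J × ℤ) ^ s := n2 ▸ hQ 2
  have hc0 : 0 ≤ lam + M / K := by positivity
  have hhyp : ∀ m' : ℤ, m'.natAbs ≤ m.natAbs + 1 → ∀ q : Pt k n,
      ‖q‖ ≤ orbitWeight μ ((j, m') : J × ℤ) ^ s → (lam + M / K) * ‖q‖ ≤ θ * W := fun m' hm' q hq =>
    calc (lam + M / K) * ‖q‖ ≤ (lam + M / K) * (μ ^ (r + 1) * W) :=
          mul_le_mul_of_nonneg_left (hq.trans (hup m' hm')) hc0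
      _ = (lam + M / K) * μ ^ (r + 1) * W := by ring
      _ ≤ _ := mul_le_mul_of_nonneg_right hθ₁ hW0
  have hεK : 0 ≤ ε j * K := mul_nonneg (hε0 j) hK0.le
  have hθW : 0 ≤ θ * W := by
    have : 0 ≤ μ⁻¹ + ε j * K * M := by positivity
    exact mul_nonneg (this.trans (hθ₂ j)) hW0
  have hlast : (μ⁻¹ + ε j * K * M) * W ≤ θ * W := mul_le_mul_of_nonneg_right (hθ₂ j) hW0
  rw [Fin.sum_univ_three]
  beta_reduce
  rw [n0, n1, n2]
  simp only [orbitCoeff, orbitTransfer, add_apply, ContinuousLinearMap.comp_apply,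
    diagMap_apply, Matrix.cons_val_zero, Matrix.cons_val_one, Matrix.cons_val,
    one_smul, zero_smul, Prod.mk_add_mk, add_zero, zero_add]
  refine norm_prod_le_iff.2 ⟨?_, norm_prod_le_iff.2 ⟨?_, ?_⟩⟩
  · exact (tx _ _).trans (hhyp (m - 1) (by omega) _ q0)
  · exact (ty _ _).trans (hhyp (m + 1) (by omega) _ q2)
  · have z0 : ‖(Q 0).2.2‖ ≤ ‖Q 0‖ := (norm_snd_le _).trans (norm_snd_le _)
    have z2 : ‖(Q 2).2.2‖ ≤ ‖Q 2‖ := (norm_snd_le _).trans (norm_snd_le _)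
    rcases lt_trichotomy m 0 with hm | hm | hm
    · simp only [hm, hm.not_gt, if_true, if_false, zero_smul, one_smul, zero_add, add_zero]
      have e2 := q2.trans (hdown (m + 1) (by omega))
      have e1 : ‖-(ε j * K) • (T (j, m) (argMap k n K⁻¹ (Q 1))).2.2‖ ≤ ε j * K * (M * W) := by
        rw [norm_smul, norm_neg, Real.norm_of_nonneg hεK]
        exact mul_le_mul_of_nonneg_left
          ((tz _ _).trans (mul_le_mul_of_nonneg_left q1 hM)) hεK
      refine (norm_add_le _ _).trans ((add_le_add e1 (z2.trans e2)).trans (le_trans ?_ hlast))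
      exact le_of_eq (by ring)
    · subst hm
      simpa using hθW
    · simp only [hm, hm.not_gt, if_true, if_false, zero_smul, one_smul, add_zero]
      have e0 := q0.trans (hdown (m - 1) (by omega))
      have e1 : ‖(ε j * K) • (T (j, m - 1) (argMap k n K⁻¹ (Q 0))).2.2‖ ≤
          ε j * K * (M * W) := by
        rw [norm_smul, Real.norm_of_nonneg hεK]
        refine mul_le_mul_of_nonneg_left
          ((tz _ _).trans (mul_le_mul_of_nonneg_left (e0.trans ?_) hM)) hεK
        exact mul_le_of_le_one_left hW0 (inv_le_one_of_one_le₀ hμ)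
      refine (norm_add_le _ _).trans ((add_le_add e1 (z0.trans e0)).trans (le_trans ?_ hlast))
      exact le_of_eq (by ring)

/-- Families of orbits `(X m z, Y m z, Z m z)`, `m ∈ ℤ`, with `Z 0 z = z`, of maps in cross-form,
indexed by `j ∈ J`. If they are Lipschitz in `z` with weight `μ ^ |m|`, they are of class `C^(r+1)`
in `z`, with bounds uniform in `j`. The unknown at time `m` is the argument
`(X m, Y (m + 1), Z m)` of the cross-form, so that each neighbouring time contributes one term;
`Z` is determined from its value at time `0`, forwards for `m > 0` and backwards for `m < 0`, and
is scaled by a large factor `K`, which makes the dependence of `X` and `Y` on `Z` small. -/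
theorem orbit_weightedCr {J γ : Type*} {r : ℕ} {lam M μ θ K B R : ℝ} {D : Set (Euc n)}
    {𝒦 : Set (Arg k n)}
    (hD : IsOpen D) (hDb : Bornology.IsBounded D) (h𝒦 : UniqueDiffOn ℝ 𝒦) {h : γ → Arg k n → Pt k n}
    (hh : WeightedCr (fun _ => (1 : ℝ)) 𝒦 (r + 1) 0 h)
    (hM : 0 ≤ M) (hlam : 0 ≤ lam) (hB : 0 ≤ B) (hμ : 1 ≤ μ) (hK : 1 ≤ K) (hθ : θ < 1)
    (hx : ∀ c, ∀ p ∈ 𝒦, ∀ v : Pt k n, ‖(fderivWithin ℝ (h c) 𝒦 p (argMap k n 1 v)).1‖ ≤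
      lam * max ‖v.1‖ ‖v.2.1‖ + M * ‖v.2.2‖)
    (hy : ∀ c, ∀ p ∈ 𝒦, ∀ v : Pt k n, ‖(fderivWithin ℝ (h c) 𝒦 p (argMap k n 1 v)).2.1‖ ≤
      lam * max ‖v.1‖ ‖v.2.1‖ + M * ‖v.2.2‖)
    (hz' : ∀ c, ∀ p ∈ 𝒦, ∀ v : Pt k n, ‖(fderivWithin ℝ (h c) 𝒦 p (argMap k n 1 v)).2.2‖ ≤
      M * ‖v‖)
    (ε : J → ℝ) (hε0 : ∀ j, 0 ≤ ε j) (hε1 : ∀ j, ε j ≤ 1)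
    (hθ₁ : (lam + M / K) * μ ^ (r + 1) ≤ θ) (hθ₂ : ∀ j, μ⁻¹ + ε j * K * M ≤ θ)
    (cc : J → ℤ → γ) {X Y : J → ℤ → Euc n → Euc k} {Z : J → ℤ → Euc n → Euc n}
    (hmem : ∀ j m, ∀ z ∈ D, (X j m z, Y j (m + 1) z, Z j m z, ε j) ∈ 𝒦)
    (hXR : ∀ j m, ∀ z ∈ D, ‖X j m z‖ ≤ R) (hYR : ∀ j m, ∀ z ∈ D, ‖Y j m z‖ ≤ R)
    (hZD : ∀ j m, ∀ z ∈ D, Z j m z ∈ D) (hZ0 : ∀ j, ∀ z ∈ D, Z j 0 z = z)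
    (hX : ∀ j m, ∀ z ∈ D,
      X j (m + 1) z = (h (cc j m) (X j m z, Y j (m + 1) z, Z j m z, ε j)).1)
    (hY : ∀ j m, ∀ z ∈ D, Y j m z = (h (cc j m) (X j m z, Y j (m + 1) z, Z j m z, ε j)).2.1)
    (hZ : ∀ j m, ∀ z ∈ D, Z j (m + 1) z =
      Z j m z + ε j • (h (cc j m) (X j m z, Y j (m + 1) z, Z j m z, ε j)).2.2)
    (hXl : ∀ j m, ∀ z ∈ D, ∀ᶠ z' in 𝓝 z, ‖X j m z' - X j m z‖ ≤ B * μ ^ m.natAbs * ‖z' - z‖)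
    (hYl : ∀ j m, ∀ z ∈ D, ∀ᶠ z' in 𝓝 z, ‖Y j m z' - Y j m z‖ ≤ B * μ ^ m.natAbs * ‖z' - z‖)
    (hZl : ∀ j m, ∀ z ∈ D, ∀ᶠ z' in 𝓝 z, ‖Z j m z' - Z j m z‖ ≤ μ ^ m.natAbs * ‖z' - z‖) :
    WeightedCr (fun _ : J => (1 : ℝ)) D (r + 1) 0 (fun j => X j 0) ∧
    WeightedCr (fun _ : J => (1 : ℝ)) D (r + 1) 0 (fun j => Y j 0) := by
  have hμ0 : 0 < μ := one_pos.trans_le hμ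
  have hK0 : 0 < K := one_pos.trans_le hK
  have hω : ∀ j : J × ℤ, 1 ≤ orbitWeight μ j := fun j => one_le_pow₀ hμ
  have hωpos : ∀ j : J × ℤ, 0 < orbitWeight μ j := fun j => one_pos.trans_le (hω j)
  have hnear : ∀ a b : ℤ, a.natAbs ≤ b.natAbs + 1 → μ ^ a.natAbs ≤ μ * μ ^ b.natAbs :=
    fun a b hab => by
      rw [← pow_succ']
      exact pow_le_pow_right₀ hμ hab
  have hσ : ∀ (j : J × ℤ) κ, orbitWeight μ (orbitNeighbor j κ) ≤ μ * orbitWeight μ j :=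
    fun j κ => hnear _ _ (by
      have := κ.isLt
      simp only [orbitNeighbor]; omega)
  have n0 : ∀ j : J × ℤ, orbitNeighbor j 0 = (j.1, j.2 - 1) := fun j => by simp [orbitNeighbor]
  have n1 : ∀ j : J × ℤ, orbitNeighbor j 1 = j := fun j => by simp [orbitNeighbor]
  have n2 : ∀ j : J × ℤ, orbitNeighbor j 2 = (j.1, j.2 + 1) := fun j => by
    simp only [orbitNeighbor, Prod.mk.injEq, true_and]
    rw [show ((2 : Fin 3) : ℕ) = 2 from rfl]; push_cast; ring
  set w : J × ℤ → Euc n → Pt k n := fun j z =>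
    (X j.1 j.2 z, Y j.1 (j.2 + 1) z, K • Z j.1 j.2 z) with hw
  set p : J × ℤ → Euc n → Arg k n := fun j z =>
    (X j.1 j.2 z, Y j.1 (j.2 + 1) z, Z j.1 j.2 z, ε j.1) with hp
  set e₂ : Euc n →L[ℝ] Pt k n := (ContinuousLinearMap.inr ℝ (Euc k) (Euc k × Euc n)).comp
    (ContinuousLinearMap.inr ℝ (Euc k) (Euc n)) with he₂
  set b : J × ℤ → Euc n →L[ℝ] Pt k n := fun j => (if j.2 = 0 then K else 0) • e₂ with hb
  have hbM : ∀ j, ‖b j‖ ≤ max K (K * ‖e₂‖) := fun j => by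
    refine le_max_of_le_right ?_
    rw [hb, norm_smul]
    refine mul_le_mul_of_nonneg_right ?_ (norm_nonneg _)
    split_ifs
    · rw [Real.norm_of_nonneg hK0.le]
    · simpa using hK0.le
  have hAM : ∀ (j : J × ℤ) κ, ‖orbitCoeff k n K (ε j.1) j.2 κ‖ ≤ max K (K * ‖e₂‖) := fun j κ =>
    le_max_of_le_left (norm_orbitCoeff_le (by
      rw [abs_of_nonneg (mul_nonneg (hε0 _) hK0.le)]
      exact mul_le_of_le_one_left hK0.le (hε1 _)) hK _ _)
  have hCM : ∀ (j : J × ℤ) κ, ‖orbitTransfer k n j.2 κ‖ ≤ max K (K * ‖e₂‖) := fun j κ =>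
    le_max_of_le_left (norm_orbitTransfer_le hK _ _)
  have hpK : ∀ j, MapsTo (p j) D 𝒦 := fun j z hz => hmem j.1 j.2 z hz
  have hpw : ∀ j, ∀ z ∈ D, p j z = argMap k n K⁻¹ (w j z) + (0, 0, 0, ε j.1) := fun j z _ => by
    simp [hp, hw, smul_smul, inv_mul_cancel₀ hK0.ne']
  have hweq : ∀ j, ∀ z ∈ D, w j z = b j z + ∑ κ, (orbitCoeff k n K (ε j.1) j.2 κ
      (h (cc (orbitNeighbor j κ).1 (orbitNeighbor j κ).2) (p (orbitNeighbor j κ) z)) +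
      orbitTransfer k n j.2 κ (w (orbitNeighbor j κ) z)) := by
    rintro ⟨j, m⟩ z hz
    have eX := hX j (m - 1) z hz
    have eZ := hZ j (m - 1) z hz
    rw [sub_add_cancel] at eX eZ
    have eY := hY j (m + 1) z hz
    have eZ' := hZ j m z hz
    rw [Fin.sum_univ_three, n0, n1, n2]
    simp only [orbitCoeff, orbitTransfer, diagMap_apply, Matrix.cons_val_zero, Matrix.cons_val_one,
      Matrix.cons_val, zero_apply, one_smul, zero_smul, Prod.mk_add_mk, add_zero, zero_add, hb, hw,
      hp, sub_add_cancel]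
    have hcomp : ∀ c : ℝ, (c • e₂) z = ((0, 0, c • z) : Pt k n) := fun c => by
      simp [he₂]
    rw [hcomp]
    simp only [Prod.mk_add_mk, zero_add, Prod.mk.injEq]
    refine ⟨eX, eY, ?_⟩
    rcases lt_trichotomy m 0 with hm | hm | hm
    · simp only [hm, hm.ne, hm.not_gt, if_true, if_false, zero_smul, one_smul, zero_add, add_zero]
      rw [eZ', smul_add, neg_smul, smul_smul, mul_comm K]
      abel
    · subst hm
      simp [hZ0 j z hz]
    · simp only [hm, hm.ne', hm.not_gt, if_true, if_false, zero_smul, one_smul, zero_add, add_zero]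
      conv_lhs => rw [eZ, smul_add, smul_smul, mul_comm K]
      abel
  have hB₁ : 0 ≤ max (B * μ) K := le_max_of_le_right hK0.le
  have hlip : ∀ j, ∀ z ∈ D, ∀ᶠ z' in 𝓝 z,
      ‖w j z' - w j z‖ ≤ max (B * μ) K * orbitWeight μ j * ‖z' - z‖ := by
    rintro ⟨j, m⟩ z hz
    filter_upwards [hXl j m z hz, hYl j (m + 1) z hz, hZl j m z hz] with z' h1 h2 h3
    have hP : 0 ≤ μ ^ m.natAbs := by positivity
    have hbd : ∀ m' : ℤ, m'.natAbs ≤ m.natAbs + 1 →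
        B * μ ^ m'.natAbs ≤ max (B * μ) K * μ ^ m.natAbs := fun m' hm' =>
      calc B * μ ^ m'.natAbs ≤ B * (μ * μ ^ m.natAbs) :=
            mul_le_mul_of_nonneg_left (hnear _ _ hm') hB
        _ = B * μ * μ ^ m.natAbs := by ring
        _ ≤ _ := mul_le_mul_of_nonneg_right (le_max_left _ _) hP
    refine norm_prod_le_iff.2 ⟨?_, norm_prod_le_iff.2 ⟨?_, ?_⟩⟩
    · exact h1.trans (mul_le_mul_of_nonneg_right (hbd m (by omega)) (norm_nonneg _))
    · exact h2.trans (mul_le_mul_of_nonneg_right (hbd (m + 1) (by omega)) (norm_nonneg _))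
    · change ‖K • Z j m z' - K • Z j m z‖ ≤ _
      rw [← smul_sub, norm_smul, Real.norm_of_nonneg hK0.le, mul_assoc]
      exact (mul_le_mul_of_nonneg_left h3 hK0.le).trans
        (mul_le_mul_of_nonneg_right (le_max_right _ _) (by positivity))
  have hθ0 : 0 ≤ θ := by
    refine le_trans ?_ hθ₁
    positivity
  obtain ⟨Q, hQ, hQW⟩ := exists_hasFDerivAt_weightedCr hD hω hθ0 hθ hμ hσ h𝒦 hh
    (fun j : J × ℤ => cc j.1 j.2) hAM hCM hbM hpK hpw hweq hB₁ hlip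
    (fun z hz s h1 h2 => weightContracts_orbit hM hlam hμ hK
      (T := fun j => fderivWithin ℝ (h (cc j.1 j.2)) 𝒦 (p j z))
      (fun j v => hx _ _ (hpK j hz) v) (fun j v => hy _ _ (hpK j hz) v)
      (fun j v => hz' _ _ (hpK j hz) v) ε hε0 hθ₁ hθ₂ h1 h2)
  obtain ⟨d, hd⟩ := hDb.exists_norm_le
  have hbound : ∀ j, ∀ z ∈ D, ‖w j z‖ ≤ max R (K * d) * orbitWeight μ j ^ 0 := fun j z hz => by
    rw [pow_zero, mul_one]
    refine norm_prod_le_iff.2 ⟨le_max_of_le_left (hXR _ _ z hz), norm_prod_le_iff.2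
      ⟨le_max_of_le_left (hYR _ _ z hz), le_max_of_le_right ?_⟩⟩
    change ‖K • Z j.1 j.2 z‖ ≤ _
    rw [norm_smul, Real.norm_of_nonneg hK0.le]
    exact mul_le_mul_of_nonneg_left (hd _ (hZD _ _ z hz)) hK0.le
  have hwW : WeightedCr (orbitWeight μ) D (r + 1) 0 w :=
    WeightedCr.of_hasFDerivAt hD hQ hω hbound hQW
  have hU := hD.uniqueDiffOn (𝕜 := ℝ)
  have h1 : ∀ _ : J, (1 : ℝ) ≤ 1 := fun _ => le_rfl
  constructor
  · have := (hwW.clm hU hω (ContinuousLinearMap.fst ℝ (Euc k) (Euc k × Euc n))).reindex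
      (fun j : J => (j, (0 : ℤ))) hμ hω h1 (fun j => by simpa [orbitWeight] using hμ)
    exact this
  · have := (hwW.clm hU hω ((ContinuousLinearMap.fst ℝ (Euc k) (Euc n)).comp
      (ContinuousLinearMap.snd ℝ (Euc k) (Euc k × Euc n)))).reindex
      (fun j : J => (j, (-1 : ℤ))) hμ hω h1 (fun j => by simp [orbitWeight])
    exact this

end Orbits

/-! ### Estimates for maps in cross-form -/

section Estimates

variable {k n : ℕ} {R ε₁ lam M : ℝ} {D : Set (Euc n)}

theorem uniqueDiffOn_argDomain (hR : 0 < R) (hε₁ : 0 < ε₁) (hD : IsOpen D) :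
    UniqueDiffOn ℝ (argDomain k n R ε₁ D) := by
  have h : UniqueDiffOn ℝ (closedBall (0 : Euc k) R) :=
    uniqueDiffOn_convex (convex_closedBall 0 R)
      ⟨0, interior_mono ball_subset_closedBall (by
        rw [isOpen_ball.interior_eq]; exact mem_ball_self hR)⟩
  exact h.prod (h.prod (hD.uniqueDiffOn.prod (uniqueDiffOn_Icc hε₁)))

theorem mem_argDomain {x y : Euc k} {z : Euc n} {ε : ℝ} :
    (x, y, z, ε) ∈ argDomain k n R ε₁ D ↔ ‖x‖ ≤ R ∧ ‖y‖ ≤ R ∧ z ∈ D ∧ ε ∈ Icc 0 ε₁ := by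
  simp [argDomain, mem_prod]

theorem segment_subset_argDomain {p q : Arg k n} (hp : p ∈ argDomain k n R ε₁ D)
    (hq : q ∈ argDomain k n R ε₁ D) (hseg : segment ℝ p.2.2.1 q.2.2.1 ⊆ D) :
    segment ℝ p q ⊆ argDomain k n R ε₁ D := by
  rintro _ ⟨a, b, ha, hb, hab, rfl⟩
  exact ⟨convex_closedBall 0 R hp.1 hq.1 ha hb hab,
    convex_closedBall 0 R hp.2.1 hq.2.1 ha hb hab, hseg ⟨a, b, ha, hb, hab, rfl⟩,
    convex_Icc 0 ε₁ hp.2.2.2 hq.2.2.2 ha hb hab⟩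

/-- The mean value inequality, with a bound on the derivative in the direction of the increment
only. -/
theorem norm_sub_le_of_norm_fderivWithin_segment_le {V W : Type*} [NormedAddCommGroup V]
    [NormedSpace ℝ V] [NormedAddCommGroup W] [NormedSpace ℝ W] {u : V → W} {s : Set V}
    (hu : DifferentiableOn ℝ u s) {p q : V} (hseg : segment ℝ q p ⊆ s) {C : ℝ}
    (hC : ∀ w ∈ s, ‖fderivWithin ℝ u s w (p - q)‖ ≤ C) : ‖u p - u q‖ ≤ C := by
  have hγ : ∀ t ∈ Icc (0 : ℝ) 1, q + t • (p - q) ∈ s := fun t ht => hseg (by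
    rw [segment_eq_image']; exact ⟨t, ht, rfl⟩)
  have key := norm_image_sub_le_of_norm_deriv_le_segment_01'
    (f := fun t : ℝ => u (q + t • (p - q)))
    (f' := fun t => fderivWithin ℝ u s (q + t • (p - q)) (p - q)) (C := C)
    (fun t ht => by
      have h1 : HasDerivWithinAt (fun t : ℝ => q + t • (p - q)) (p - q) (Icc 0 1) t := by
        simpa using (((hasDerivAt_id t).smul_const (p - q)).const_add q).hasDerivWithinAt
      exact (hu _ (hγ t ht)).hasFDerivWithinAt.comp_hasDerivWithinAt t h1 hγ)
    (fun t ht => hC _ (hγ t (Ico_subset_Icc_self ht)))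
  simpa using key

/-- The derivative in the hyperbolic directions of a function of the arguments `(x, ȳ, z, ε)` is
that of its restriction to a slice `z, ε = const`. -/
theorem hasFDerivWithinAt_slice {W : Type*} [NormedAddCommGroup W] [NormedSpace ℝ W]
    {u : Arg k n → W} (hu : DifferentiableOn ℝ u (argDomain k n R ε₁ D)) {x y : Euc k} {z : Euc n}
    {ε : ℝ} (hp : (x, y, z, ε) ∈ argDomain k n R ε₁ D) :
    HasFDerivWithinAt (fun q : Euc k × Euc k => u (q.1, q.2, z, ε))
      ((fderivWithin ℝ u (argDomain k n R ε₁ D) (x, y, z, ε)).comp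
        ((ContinuousLinearMap.fst ℝ (Euc k) (Euc k)).prod
          ((ContinuousLinearMap.snd ℝ (Euc k) (Euc k)).prod 0)))
      (closedBall 0 R ×ˢ closedBall 0 R) (x, y) := by
  have hm := mem_argDomain.1 hp
  have h1 : HasFDerivWithinAt (fun q : Euc k × Euc k => ((q.1, q.2, z, ε) : Arg k n))
      ((ContinuousLinearMap.fst ℝ (Euc k) (Euc k)).prod
          ((ContinuousLinearMap.snd ℝ (Euc k) (Euc k)).prod 0))
      (closedBall 0 R ×ˢ closedBall 0 R) (x, y) :=
    (hasFDerivAt_fst.prodMk (hasFDerivAt_snd.prodMk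
      (hasFDerivAt_const ((z, ε) : Euc n × ℝ) _))).hasFDerivWithinAt
  have hmaps : MapsTo (fun q : Euc k × Euc k => ((q.1, q.2, z, ε) : Arg k n))
      (closedBall 0 R ×ˢ closedBall 0 R) (argDomain k n R ε₁ D) := fun q hq =>
    ⟨hq.1, hq.2, hm.2.2.1, hm.2.2.2⟩
  exact (hu _ hp).hasFDerivWithinAt.comp (x, y) h1 hmaps

theorem IsHyperbolicBy.norm_fderivWithin_le {f g : Arg k n → Euc k}
    (h : IsHyperbolicBy R ε₁ D lam f g) (hR : 0 < R)
    (hf : DifferentiableOn ℝ f (argDomain k n R ε₁ D))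
    (hg : DifferentiableOn ℝ g (argDomain k n R ε₁ D)) {p : Arg k n}
    (hp : p ∈ argDomain k n R ε₁ D) (v w : Euc k) :
    ‖fderivWithin ℝ f (argDomain k n R ε₁ D) p (v, w, 0)‖ ≤ lam * max ‖v‖ ‖w‖ ∧
    ‖fderivWithin ℝ g (argDomain k n R ε₁ D) p (v, w, 0)‖ ≤ lam * max ‖v‖ ‖w‖ := by
  obtain ⟨x, y, z, ε⟩ := p
  have hb : UniqueDiffOn ℝ (closedBall (0 : Euc k) R) :=
    uniqueDiffOn_convex (convex_closedBall 0 R)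
      ⟨0, interior_mono ball_subset_closedBall (by
        rw [isOpen_ball.interior_eq]; exact mem_ball_self hR)⟩
  have e := ((hasFDerivWithinAt_slice hf hp).prodMk (hasFDerivWithinAt_slice hg hp)).fderivWithin
    ((hb.prod hb) (x, y) ⟨hp.1, hp.2.1⟩)
  have h1 := h x hp.1 y hp.2.1 z hp.2.2.1 ε hp.2.2.2
  rw [e] at h1
  have h2 := (ContinuousLinearMap.le_of_opNorm_le _ h1 (v, w))
  exact norm_prod_le_iff.1 h2

/-- The quantitative content of the hypotheses on one map in cross-form: bounds of the first
derivatives on the set of arguments, and the decay of the drift towards the boundary of `D`. -/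
structure CrossFormBounds (R ε₁ lam M : ℝ) (D : Set (Euc n)) (f g : Arg k n → Euc k)
    (φ : Arg k n → Euc n) : Prop where
  mapsTo_f : MapsTo f (argDomain k n R ε₁ D) (closedBall 0 R)
  mapsTo_g : MapsTo g (argDomain k n R ε₁ D) (closedBall 0 R)
  diff_f : DifferentiableOn ℝ f (argDomain k n R ε₁ D)
  diff_g : DifferentiableOn ℝ g (argDomain k n R ε₁ D)
  diff_φ : DifferentiableOn ℝ φ (argDomain k n R ε₁ D)
  norm_fderiv_f_le : ∀ p ∈ argDomain k n R ε₁ D,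
    ‖fderivWithin ℝ f (argDomain k n R ε₁ D) p‖ ≤ M
  norm_fderiv_g_le : ∀ p ∈ argDomain k n R ε₁ D,
    ‖fderivWithin ℝ g (argDomain k n R ε₁ D) p‖ ≤ M
  norm_fderiv_φ_le : ∀ p ∈ argDomain k n R ε₁ D,
    ‖fderivWithin ℝ φ (argDomain k n R ε₁ D) p‖ ≤ M
  norm_φ_le : ∀ p ∈ argDomain k n R ε₁ D, ‖φ p‖ ≤ M
  hyperbolic : IsHyperbolicBy R ε₁ D lam f g
  norm_φ_le_gap : ∀ p ∈ argDomain k n R ε₁ D, ‖φ p‖ ≤ M * gap D p.2.2.1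

/-- A function that is Lipschitz on `D` and vanishes on its boundary is bounded by the distance to
the complement of `D`: one integrates along the segment to the nearest point of the complement. -/
theorem norm_le_mul_gap (hD : IsOpen D) (hDb : Bornology.IsBounded D) {φ : Arg k n → Euc n}
    (hφ : DifferentiableOn ℝ φ (argDomain k n R ε₁ D)) (hM : 0 ≤ M)
    (hφM : ∀ p ∈ argDomain k n R ε₁ D, ‖fderivWithin ℝ φ (argDomain k n R ε₁ D) p‖ ≤ M)
    (hφc : ContinuousOn φ (argDomain k n R ε₁ (closure D)))
    (hφ0 : ∀ p ∈ argDomain k n R ε₁ (frontier D), φ p = 0) {p : Arg k n}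
    (hp : p ∈ argDomain k n R ε₁ D) : ‖φ p‖ ≤ M * gap D p.2.2.1 := by
  obtain ⟨x, y, z, ε⟩ := p
  change ‖φ (x, y, z, ε)‖ ≤ M * gap D z
  obtain ⟨hx, hy, hz, hε⟩ := mem_argDomain.1 hp
  rcases eq_empty_or_nonempty Dᶜ with hc | hc
  · -- A bounded set with empty complement exists only in dimension `0`.
    have hsub : Subsingleton (Euc n) := by
      by_contra hn
      rw [not_subsingleton_iff_nontrivial] at hn
      refine NormedSpace.unbounded_univ ℝ (Euc n) ?_
      rwa [← compl_empty, ← hc, compl_compl]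
    rw [Subsingleton.elim (φ (x, y, z, ε)) 0, norm_zero]
    exact mul_nonneg hM (gap_nonneg z)
  obtain ⟨w, hw, hzw⟩ := hD.isClosed_compl.exists_infDist_eq_dist hc z
  have hgap : gap D z = ‖w - z‖ := by rw [gap, hzw, dist_comm, dist_eq_norm]
  have hpos : 0 < ‖w - z‖ := norm_pos_iff.2 (sub_ne_zero.2 fun h => hw (h ▸ hz))
  have hseg : ∀ t ∈ Ico (0 : ℝ) 1, segment ℝ (z + t • (w - z)) z ⊆ D := fun t ht => by
    refine Subset.trans ?_ (ball_infDist_compl_subset (x := z))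
    have hr : 0 < infDist z Dᶜ := by rw [← gap, hgap]; exact hpos
    refine (convex_ball z _).segment_subset ?_ (mem_ball_self hr)
    rw [mem_ball, dist_eq_norm, add_sub_cancel_left, norm_smul, Real.norm_of_nonneg ht.1,
      ← gap, hgap]
    exact mul_lt_of_lt_one_left hpos ht.2
  have hzt : ∀ t ∈ Ico (0 : ℝ) 1, z + t • (w - z) ∈ D := fun t ht =>
    hseg t ht (left_mem_segment ℝ _ _)
  have hcont : Tendsto (fun t : ℝ => z + t • (w - z)) (𝓝[<] 1) (𝓝 w) := by
    have : Continuous fun t : ℝ => z + t • (w - z) := by fun_prop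
    simpa using (this.tendsto 1).mono_left nhdsWithin_le_nhds
  have hev : ∀ᶠ t in 𝓝[<] (1 : ℝ), t ∈ Ico (0 : ℝ) 1 := Ico_mem_nhdsLT one_pos
  have hwc : w ∈ closure D :=
    mem_closure_of_tendsto hcont (hev.mono hzt)
  have hwf : w ∈ frontier D := ⟨hwc, by rwa [hD.interior_eq]⟩
  have hlim : Tendsto (fun t : ℝ => φ (x, y, z + t • (w - z), ε)) (𝓝[<] 1) (𝓝 0) := by
    rw [← hφ0 (x, y, w, ε) (mem_argDomain.2 ⟨hx, hy, hwf, hε⟩)]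
    refine (hφc (x, y, w, ε) (mem_argDomain.2 ⟨hx, hy, hwc, hε⟩)).tendsto.comp
      (tendsto_nhdsWithin_iff.2 ⟨?_, hev.mono fun t ht =>
        mem_argDomain.2 ⟨hx, hy, subset_closure (hzt t ht), hε⟩⟩)
    exact tendsto_const_nhds.prodMk_nhds (tendsto_const_nhds.prodMk_nhds
      (hcont.prodMk_nhds tendsto_const_nhds))
  have hle : ∀ᶠ t in 𝓝[<] (1 : ℝ),
      ‖φ (x, y, z, ε) - φ (x, y, z + t • (w - z), ε)‖ ≤ M * gap D z := by
    filter_upwards [hev] with t ht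
    refine norm_sub_le_of_norm_fderivWithin_segment_le hφ
      (segment_subset_argDomain (mem_argDomain.2 ⟨hx, hy, hzt t ht, hε⟩) hp (hseg t ht))
      fun q hq => (ContinuousLinearMap.le_of_opNorm_le _ (hφM q hq) _).trans
        (mul_le_mul_of_nonneg_left ?_ hM)
    have e : ((x, y, z, ε) : Arg k n) - (x, y, z + t • (w - z), ε) = (0, 0, -(t • (w - z)), 0) := by
      simp
    rw [e, hgap]
    refine norm_prod_le_iff.2 ⟨by simp, norm_prod_le_iff.2 ⟨by simp,
      norm_prod_le_iff.2 ⟨?_, by simp⟩⟩⟩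
    rw [norm_neg, norm_smul, Real.norm_of_nonneg ht.1]
    exact mul_le_of_le_one_left (norm_nonneg _) ht.2.le
  have := le_of_tendsto ((tendsto_const_nhds.sub hlim).norm) hle
  simpa using this

/-- The slice `ε = const` of a function of the arguments `(x, ȳ, z, ε)`. -/
def slice {W : Type*} (u : Arg k n → W) (ε : ℝ) (p : Pt k n) : W := u (p.1, p.2.1, p.2.2, ε)

theorem mem_argDomain_of_mem_crossSection {p : Pt k n} (hp : p ∈ crossSection k n R D) {ε : ℝ}
    (hε : ε ∈ Icc 0 ε₁) : (p.1, p.2.1, p.2.2, ε) ∈ argDomain k n R ε₁ D :=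
  ⟨hp.1, hp.2.1, hp.2.2, hε⟩

namespace CrossFormBounds

variable {f g : Arg k n → Euc k} {φ : Arg k n → Euc n}

theorem norm_fderiv_argMap_le (h : CrossFormBounds R ε₁ lam M D f g φ) (hR : 0 < R) {p : Arg k n}
    (hp : p ∈ argDomain k n R ε₁ D) (v : Pt k n) :
    ‖fderivWithin ℝ f (argDomain k n R ε₁ D) p (argMap k n 1 v)‖ ≤
      lam * max ‖v.1‖ ‖v.2.1‖ + M * ‖v.2.2‖ ∧
    ‖fderivWithin ℝ g (argDomain k n R ε₁ D) p (argMap k n 1 v)‖ ≤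
      lam * max ‖v.1‖ ‖v.2.1‖ + M * ‖v.2.2‖ := by
  have e : argMap k n 1 v = (v.1, v.2.1, 0) + (0, 0, v.2.2, 0) := by simp
  have hn : ‖((0, 0, v.2.2, 0) : Arg k n)‖ ≤ ‖v.2.2‖ :=
    norm_prod_le_iff.2 ⟨by simp, norm_prod_le_iff.2 ⟨by simp, norm_prod_le_iff.2 ⟨le_rfl, by simp⟩⟩⟩
  have hM : 0 ≤ M := (norm_nonneg _).trans (h.norm_φ_le p hp)
  have h1 := h.hyperbolic.norm_fderivWithin_le hR h.diff_f h.diff_g hp v.1 v.2.1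
  rw [e, map_add, map_add]
  exact ⟨(norm_add_le _ _).trans (add_le_add h1.1
      ((ContinuousLinearMap.le_of_opNorm_le _ (h.norm_fderiv_f_le p hp) _).trans
        (mul_le_mul_of_nonneg_left hn hM))),
    (norm_add_le _ _).trans (add_le_add h1.2
      ((ContinuousLinearMap.le_of_opNorm_le _ (h.norm_fderiv_g_le p hp) _).trans
        (mul_le_mul_of_nonneg_left hn hM)))⟩

theorem norm_argMap_le (v : Pt k n) : ‖argMap k n 1 v‖ ≤ ‖v‖ :=
  norm_prod_le_iff.2 ⟨norm_fst_le v, norm_prod_le_iff.2 ⟨(norm_fst_le v.2).trans (norm_snd_le v),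
    norm_prod_le_iff.2 ⟨by simpa using (norm_snd_le v.2).trans (norm_snd_le v), by simp⟩⟩⟩

theorem norm_fderiv_φ_argMap_le (h : CrossFormBounds R ε₁ lam M D f g φ) {p : Arg k n}
    (hp : p ∈ argDomain k n R ε₁ D) (v : Pt k n) :
    ‖fderivWithin ℝ φ (argDomain k n R ε₁ D) p (argMap k n 1 v)‖ ≤ M * ‖v‖ :=
  (ContinuousLinearMap.le_of_opNorm_le _ (h.norm_fderiv_φ_le p hp) _).trans
    (mul_le_mul_of_nonneg_left (norm_argMap_le v) ((norm_nonneg _).trans (h.norm_φ_le p hp)))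

theorem isLink (h : CrossFormBounds R ε₁ lam M D f g φ) (hR : 0 < R) {ε : ℝ}
    (hε : ε ∈ Icc 0 ε₁) :
    IsLink R lam M (ε * M) D (slice f ε) (slice g ε) (fun p => ε • slice φ ε p) := by
  have key : ∀ {p q : Pt k n}, p ∈ crossSection k n R D → q ∈ crossSection k n R D →
      segment ℝ p.2.2 q.2.2 ⊆ D →
      segment ℝ ((q.1, q.2.1, q.2.2, ε) : Arg k n) (p.1, p.2.1, p.2.2, ε) ⊆
        argDomain k n R ε₁ D := fun hp hq hs =>
    segment_subset_argDomain (mem_argDomain_of_mem_crossSection hq hε)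
      (mem_argDomain_of_mem_crossSection hp hε) (by rwa [segment_symm])
  have e : ∀ p q : Pt k n, ((p.1, p.2.1, p.2.2, ε) : Arg k n) - (q.1, q.2.1, q.2.2, ε) =
      argMap k n 1 (p - q) := fun p q => by simp
  refine ⟨fun p hp => ?_, fun p hp => ?_, fun p hp q hq hs => ?_, fun p hp q hq hs => ?_,
    fun p hp q hq hs => ?_, fun p hp => ?_⟩
  · exact mem_closedBall_zero_iff.1 (h.mapsTo_f (mem_argDomain_of_mem_crossSection hp hε))
  · exact mem_closedBall_zero_iff.1 (h.mapsTo_g (mem_argDomain_of_mem_crossSection hp hε))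
  · exact norm_sub_le_of_norm_fderivWithin_segment_le h.diff_f (key hp hq hs) fun w hw => by
      rw [e]; exact (h.norm_fderiv_argMap_le hR hw (p - q)).1
  · exact norm_sub_le_of_norm_fderivWithin_segment_le h.diff_g (key hp hq hs) fun w hw => by
      rw [e]; exact (h.norm_fderiv_argMap_le hR hw (p - q)).2
  · rw [← smul_sub, norm_smul, Real.norm_of_nonneg hε.1, mul_assoc]
    refine mul_le_mul_of_nonneg_left ?_ hε.1
    exact norm_sub_le_of_norm_fderivWithin_segment_le h.diff_φ (key hp hq hs) fun w hw => by
      rw [e]; exact h.norm_fderiv_φ_argMap_le hw (p - q)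
  · rw [norm_smul, Real.norm_of_nonneg hε.1, mul_assoc]
    exact mul_le_mul_of_nonneg_left
      (h.norm_φ_le_gap _ (mem_argDomain_of_mem_crossSection hp hε)) hε.1

/-- The map at `ε` is `M ε`-close to the map at `0`. -/
theorem slice_sub_le (h : CrossFormBounds R ε₁ lam M D f g φ) {ε : ℝ}
    (hε : ε ∈ Icc 0 ε₁) {p : Pt k n} (hp : p ∈ crossSection k n R D) :
    ‖slice f ε p - slice f 0 p‖ ≤ M * ε ∧ ‖slice g ε p - slice g 0 p‖ ≤ M * ε ∧
    ‖ε • slice φ ε p - (0 : ℝ) • slice φ 0 p‖ ≤ M * ε := by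
  have h0 : (0 : ℝ) ∈ Icc 0 ε₁ := ⟨le_rfl, hε.1.trans hε.2⟩
  have hpε := mem_argDomain_of_mem_crossSection hp hε
  have hM : 0 ≤ M := (norm_nonneg _).trans (h.norm_φ_le _ hpε)
  have hseg := segment_subset_argDomain (mem_argDomain_of_mem_crossSection hp h0) hpε
    (by simpa using hp.2.2)
  have e : ‖((p.1, p.2.1, p.2.2, ε) : Arg k n) - (p.1, p.2.1, p.2.2, 0)‖ ≤ ε := by
    simp [abs_of_nonneg hε.1, hε.1]
  refine ⟨norm_sub_le_of_norm_fderivWithin_segment_le h.diff_f hseg fun w hw =>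
      (ContinuousLinearMap.le_of_opNorm_le _ (h.norm_fderiv_f_le w hw) _).trans
        (mul_le_mul_of_nonneg_left e hM),
    norm_sub_le_of_norm_fderivWithin_segment_le h.diff_g hseg fun w hw =>
      (ContinuousLinearMap.le_of_opNorm_le _ (h.norm_fderiv_g_le w hw) _).trans
        (mul_le_mul_of_nonneg_left e hM), ?_⟩
  rw [zero_smul, sub_zero, norm_smul, Real.norm_of_nonneg hε.1, mul_comm]
  exact mul_le_mul_of_nonneg_right (h.norm_φ_le _ hpε) hε.1

end CrossFormBounds

end Estimates

/-! ### Invariant sequences of surfaces and uniform bounds for finitely many maps -/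

section Family

variable {k n : ℕ} {R ε₁ lam M : ℝ} {D : Set (Euc n)}

/-- Invariance of the surfaces as sets, in terms of the functions that define them. -/
theorem isInvariantSeq_iff {ε : ℝ} {T : Letter → Letter → (Pt k n →. Pt k n)}
    {f g : Letter → Letter → Arg k n → Euc k} {φ : Letter → Letter → Arg k n → Euc n}
    (hT : ∀ c c', HasCrossForm R D ε (T c c') (f c c') (g c c') (φ c c')) {ξ : Code}
    {X Y : ℤ → Euc n → Euc k} :
    IsInvariantSeq T ξ (fun i => surface D (X i) (Y i)) ↔
      GraphsInvariant R D (fun i => slice (f (ξ i) (ξ (i + 1))) ε)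
        (fun i => slice (g (ξ i) (ξ (i + 1))) ε) (fun i p => ε • slice (φ (ξ i) (ξ (i + 1))) ε p)
        X Y := by
  constructor
  · intro h
    have hdom : ∀ i, ∀ z ∈ D, ∃ p, p ∈ T (ξ i) (ξ (i + 1)) (X i z, Y i z, z) := fun i z hz =>
      (PFun.mem_dom _ _).1 ((h i).1 ⟨z, hz, rfl⟩)
    have hmem : ∀ i, ∀ z ∈ D, ‖X i z‖ ≤ R ∧ ‖Y i z‖ ≤ R := fun i z hz => by
      obtain ⟨⟨x', y', z'⟩, hp⟩ := hdom i z hz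
      have := mem_crossSection.1 ((hT _ _ _ _ _ _ _ _).1 hp).1
      exact ⟨this.1, this.2.1⟩
    refine ⟨fun i z hz => (hmem i z hz).1, fun i z hz => (hmem i z hz).2, fun i z hz => ?_,
      fun i z' hz' => ?_⟩
    · obtain ⟨p, hp⟩ := hdom i z hz
      have hpi : p ∈ (T (ξ i) (ξ (i + 1))).image (surface D (X i) (Y i)) :=
        ⟨_, ⟨z, hz, rfl⟩, hp⟩
      rw [(h i).2] at hpi
      obtain ⟨z', hz', rfl⟩ := hpi
      exact ⟨z', hz', ((hT _ _ _ _ _ _ _ _).1 hp).2.2⟩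
    · have hp : (X (i + 1) z', Y (i + 1) z', z') ∈
          (T (ξ i) (ξ (i + 1))).image (surface D (X i) (Y i)) := by
        rw [(h i).2]
        exact ⟨z', hz', rfl⟩
      obtain ⟨_, ⟨z, hz, rfl⟩, hp⟩ := hp
      exact ⟨z, hz, ((hT _ _ _ _ _ _ _ _).1 hp).2.2⟩
  · intro h i
    have hmem : ∀ i, ∀ z ∈ D, (X i z, Y i z, z) ∈ crossSection k n R D := fun i z hz =>
      mem_crossSection.2 ⟨h.norm_X_le i z hz, h.norm_Y_le i z hz, hz⟩
    have himg : ∀ z ∈ D, ∃ z' ∈ D,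
        (X (i + 1) z', Y (i + 1) z', z') ∈ T (ξ i) (ξ (i + 1)) (X i z, Y i z, z) := fun z hz => by
      obtain ⟨z', hz', hc⟩ := h.exists_image i z hz
      exact ⟨z', hz', (hT _ _ _ _ _ _ _ _).2 ⟨hmem i z hz, hmem _ z' hz', hc⟩⟩
    refine ⟨?_, Subset.antisymm ?_ ?_⟩
    · rintro _ ⟨z, hz, rfl⟩
      obtain ⟨z', hz', hp⟩ := himg z hz
      exact (PFun.mem_dom _ _).2 ⟨_, hp⟩
    · rintro p ⟨_, ⟨z, hz, rfl⟩, hp⟩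
      obtain ⟨z', hz', hp'⟩ := himg z hz
      exact ⟨z', hz', Part.mem_unique hp' hp⟩
    · rintro _ ⟨z', hz', rfl⟩
      obtain ⟨z, hz, hc⟩ := h.exists_preimage i z' hz'
      exact ⟨_, ⟨z, hz, rfl⟩, (hT _ _ _ _ _ _ _ _).2 ⟨hmem i z hz, hmem _ z' hz', hc⟩⟩

theorem WeightedCr.of_boundedCr {γ V W : Type*} [Finite γ] [NormedAddCommGroup V]
    [NormedSpace ℝ V] [NormedAddCommGroup W] [NormedSpace ℝ W] {r : ℕ} {K : Set V}
    {u : γ → V → W} (h : ∀ c, BoundedCr r (u c) K) :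
    WeightedCr (fun _ : γ => (1 : ℝ)) K r 0 u := by
  choose B hB using fun c => (h c).2
  obtain ⟨A, hA⟩ := (finite_range B).bddAbove
  refine ⟨fun c => (h c).1, max A 0, le_max_right _ _, fun c τ hτ p hp => ?_⟩
  rw [one_pow, mul_one]
  exact (hB c τ hτ p hp).trans ((hA (mem_range_self c)).trans (le_max_left _ _))

theorem WeightedCr.prodMk {γ V W₁ W₂ : Type*} [NormedAddCommGroup V]
    [NormedSpace ℝ V] [NormedAddCommGroup W₁] [NormedSpace ℝ W₁] [NormedAddCommGroup W₂]
    [NormedSpace ℝ W₂] {ω : γ → ℝ} {t s : ℕ} {K : Set V} (hK : UniqueDiffOn ℝ K)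
    (hω : ∀ c, 1 ≤ ω c) {u : γ → V → W₁} {v : γ → V → W₂} (hu : WeightedCr ω K t s u)
    (hv : WeightedCr ω K t s v) : WeightedCr ω K t s (fun c p => (u c p, v c p)) := by
  have := (hu.clm hK hω (ContinuousLinearMap.inl ℝ W₁ W₂)).add hK
    (hv.clm hK hω (ContinuousLinearMap.inr ℝ W₁ W₂))
  simpa using this

theorem WeightedCr.exists_norm_fderivWithin_le {γ V W : Type*} [NormedAddCommGroup V]
    [NormedSpace ℝ V] [NormedAddCommGroup W] [NormedSpace ℝ W] {r : ℕ} (hr : 1 ≤ r) {K : Set V}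
    (hK : UniqueDiffOn ℝ K) {u : γ → V → W} (h : WeightedCr (fun _ : γ => (1 : ℝ)) K r 0 u) :
    ∃ M : ℝ, 0 ≤ M ∧ ∀ c, DifferentiableOn ℝ (u c) K ∧
      ∀ p ∈ K, ‖u c p‖ ≤ M ∧ ‖_root_.fderivWithin ℝ (u c) K p‖ ≤ M := by
  obtain ⟨h1, A, hA, h2⟩ := h
  refine ⟨A, hA, fun c => ⟨(h1 c).differentiableOn (by simp; omega), fun p hp => ⟨?_, ?_⟩⟩⟩
  · simpa using h2 c 0 (Nat.zero_le _) p hp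
  · rw [← norm_iteratedFDerivWithin_one _ (hK p hp)]
    simpa using h2 c 1 hr p hp

theorem finite_letter : Finite Letter :=
  Finite.of_surjective (fun b : Bool => if b then Letter.a else Letter.b)
    fun c => by cases c <;> [exact ⟨true, rfl⟩; exact ⟨false, rfl⟩]

/-- There are only four maps, so their bounds can be taken equal. -/
theorem exists_crossFormBounds {r : ℕ} (hr : 1 ≤ r) (hR : 0 < R) (hε₁ : 0 < ε₁)
    (hDo : IsOpen D) (hDb : Bornology.IsBounded D)
    {f g : Letter → Letter → Arg k n → Euc k} {φ : Letter → Letter → Arg k n → Euc n}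
    (hf : ∀ c c', MapsTo (f c c') (argDomain k n R ε₁ D) (closedBall 0 R))
    (hg : ∀ c c', MapsTo (g c c') (argDomain k n R ε₁ D) (closedBall 0 R))
    (hfr : ∀ c c', BoundedCr r (f c c') (argDomain k n R ε₁ D))
    (hgr : ∀ c c', BoundedCr r (g c c') (argDomain k n R ε₁ D))
    (hφr : ∀ c c', BoundedCr r (φ c c') (argDomain k n R ε₁ D))
    (hyp : ∀ c c', IsHyperbolicBy R ε₁ D lam (f c c') (g c c'))
    (hφc : ∀ c c', ContinuousOn (φ c c') (argDomain k n R ε₁ (closure D)))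
    (hφ0 : ∀ c c', ∀ p ∈ argDomain k n R ε₁ (frontier D), φ c c' p = 0) :
    ∃ M : ℝ, 0 ≤ M ∧ (∀ c c', CrossFormBounds R ε₁ lam M D (f c c') (g c c') (φ c c')) ∧
      WeightedCr (fun _ : Letter × Letter => (1 : ℝ)) (argDomain k n R ε₁ D) r 0
        (fun c p => ((f c.1 c.2 p, g c.1 c.2 p, φ c.1 c.2 p) : Pt k n)) := by
  have := finite_letter
  have hU := uniqueDiffOn_argDomain (k := k) (n := n) hR hε₁ hDo
  have wf := WeightedCr.of_boundedCr fun c : Letter × Letter => hfr c.1 c.2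
  have wg := WeightedCr.of_boundedCr fun c : Letter × Letter => hgr c.1 c.2
  have wφ := WeightedCr.of_boundedCr fun c : Letter × Letter => hφr c.1 c.2
  obtain ⟨Mf, hMf, bf⟩ := wf.exists_norm_fderivWithin_le hr hU
  obtain ⟨Mg, hMg, bg⟩ := wg.exists_norm_fderivWithin_le hr hU
  obtain ⟨Mφ, hMφ, bφ⟩ := wφ.exists_norm_fderivWithin_le hr hU
  have lf : Mf ≤ Mf + Mg + Mφ := by linarith
  have lg : Mg ≤ Mf + Mg + Mφ := by linarith
  have lφ : Mφ ≤ Mf + Mg + Mφ := by linarith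
  refine ⟨Mf + Mg + Mφ, by positivity, fun c c' => ?_,
    wf.prodMk hU (fun _ => le_rfl) (wg.prodMk hU (fun _ => le_rfl) wφ)⟩
  have nφ : ∀ p ∈ argDomain k n R ε₁ D,
      ‖fderivWithin ℝ (φ c c') (argDomain k n R ε₁ D) p‖ ≤ Mf + Mg + Mφ := fun p hp =>
    ((bφ (c, c')).2 p hp).2.trans lφ
  exact
    { mapsTo_f := hf c c'
      mapsTo_g := hg c c'
      diff_f := (bf (c, c')).1
      diff_g := (bg (c, c')).1
      diff_φ := (bφ (c, c')).1
      norm_fderiv_f_le := fun p hp => ((bf (c, c')).2 p hp).2.trans lf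
      norm_fderiv_g_le := fun p hp => ((bg (c, c')).2 p hp).2.trans lg
      norm_fderiv_φ_le := nφ
      norm_φ_le := fun p hp => ((bφ (c, c')).2 p hp).1.trans lφ
      hyperbolic := hyp c c'
      norm_φ_le_gap := fun p hp => norm_le_mul_gap hDo hDb (bφ (c, c')).1 (by positivity) nφ
        (hφc c c') (hφ0 c c') hp }

/-- The orbit of the base through a point at time `i`, forwards by the maps `b` and backwards by
their inverses `a`; `ζ m` is its position at time `i + m`. -/
theorem exists_baseOrbit {μ : ℝ} (hD : IsOpen D) (hμ : 0 ≤ μ) {a b : ℤ → Euc n → Euc n}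
    (ha : ∀ i, IsShortStep D μ (a i)) (hb : ∀ i, IsShortStep D μ (b i))
    (hba : ∀ i, ∀ z ∈ D, b i (a i z) = z) (i : ℤ) :
    ∃ ζ : ℤ → Euc n → Euc n, (∀ z, ζ 0 z = z) ∧ (∀ m, ∀ z ∈ D, ζ m z ∈ D) ∧
      (∀ m, ∀ z ∈ D, ζ (m + 1) z = b (i + m) (ζ m z)) ∧
      ∀ m, ∀ z ∈ D, ∀ᶠ z' in 𝓝 z, ‖ζ m z' - ζ m z‖ ≤ μ ^ m.natAbs * ‖z' - z‖ := by
  obtain ⟨fwd, fwd0, fwd1⟩ : ∃ c : ℕ → Euc n → Euc n, (∀ z, c 0 z = z) ∧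
      ∀ m z, c (m + 1) z = b (i + m) (c m z) :=
    ⟨fun m => m.rec (fun z => z) fun m c z => b (i + m) (c z), fun _ => rfl, fun _ _ => rfl⟩
  obtain ⟨bwd, bwd0, bwd1⟩ : ∃ c : ℕ → Euc n → Euc n, (∀ z, c 0 z = z) ∧
      ∀ m z, c (m + 1) z = a (i - m - 1) (c m z) :=
    ⟨fun m => m.rec (fun z => z) fun m c z => a (i - m - 1) (c z), fun _ => rfl, fun _ _ => rfl⟩
  have good : ∀ (c : ℕ → Euc n → Euc n) (s : ℕ → Euc n → Euc n), (∀ z, c 0 z = z) →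
      (∀ m z, c (m + 1) z = s m (c m z)) → (∀ m, IsShortStep D μ (s m)) →
      ∀ m, ∀ z ∈ D, c m z ∈ D ∧ ∀ᶠ z' in 𝓝 z, ‖c m z' - c m z‖ ≤ μ ^ m * ‖z' - z‖ := by
    intro c s h0 h1 hs m
    induction m with
    | zero =>
      intro z hz
      simp only [h0]
      exact ⟨hz, Eventually.of_forall fun z' => by simp⟩
    | succ m ih =>
      intro z hz
      obtain ⟨i1, i2⟩ := ih z hz
      simp only [h1]
      refine ⟨(hs m).mapsTo i1, ?_⟩
      filter_upwards [i2, (continuousAt_of_eventually_lipschitz i2).eventually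
        ((hs m).segLip.eventually hD i1)] with z' e1 e2
      calc _ ≤ μ * ‖c m z' - c m z‖ := e2
        _ ≤ μ * (μ ^ m * ‖z' - z‖) := mul_le_mul_of_nonneg_left e1 hμ
        _ = _ := by ring
  have gf := good fwd (fun m => b (i + m)) fwd0 fwd1 fun m => hb _
  have gb := good bwd (fun m => a (i - m - 1)) bwd0 bwd1 fun m => ha _
  let ζ : ℤ → Euc n → Euc n := fun m => if 0 ≤ m then fwd m.toNat else bwd (-m).toNat
  have ζf : ∀ m : ℕ, ζ m = fwd m := fun m => by simp [ζ]
  have ζb : ∀ m : ℕ, ζ (-m) = bwd m := fun m => by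
    rcases Nat.eq_zero_or_pos m with rfl | hm
    · funext z
      simp [ζ, fwd0, bwd0]
    · simp [ζ, hm.ne']
  have hcases : ∀ m : ℤ, (∃ l : ℕ, m = l) ∨ ∃ l : ℕ, m = -((l + 1 : ℕ) : ℤ) := fun m => by
    rcases le_or_gt 0 m with h | h
    · exact Or.inl ⟨m.toNat, by omega⟩
    · exact Or.inr ⟨(-m).toNat - 1, by omega⟩
  refine ⟨ζ, fun z => by rw [← Nat.cast_zero, ζf, fwd0], fun m z hz => ?_,
    fun m z hz => ?_, fun m z hz => ?_⟩
  · rcases hcases m with ⟨l, rfl⟩ | ⟨l, rfl⟩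
    · rw [ζf]; exact (gf l z hz).1
    · rw [ζb]; exact (gb _ z hz).1
  · rcases hcases m with ⟨l, rfl⟩ | ⟨l, rfl⟩
    · rw [show (l : ℤ) + 1 = ((l + 1 : ℕ) : ℤ) by push_cast; rfl, ζf, ζf, fwd1]
    · rw [show -((l + 1 : ℕ) : ℤ) + 1 = -(l : ℤ) by push_cast; ring, ζb, ζb]
      rw [bwd1, show i + -((l + 1 : ℕ) : ℤ) = i - l - 1 by push_cast; ring,
        hba _ _ (gb l z hz).1]
  · rcases hcases m with ⟨l, rfl⟩ | ⟨l, rfl⟩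
    · rw [ζf, Int.natAbs_natCast]; exact (gf l z hz).2
    · rw [ζb, Int.natAbs_neg, Int.natAbs_natCast]; exact (gb _ z hz).2

/-- Lipschitz invariant graphs are of class `C^(r+1)`, with uniform bounds: every point of a graph
lies on an orbit, to which `orbit_weightedCr` applies. -/
theorem weightedCr_of_isCandidate {r : ℕ} {B μ K θ ε₀ : ℝ} (hR : 0 < R) (hε₁ : 0 < ε₁)
    (hD : IsOpen D) (hDb : Bornology.IsBounded D) (hM : 0 ≤ M) (hlam : 0 ≤ lam) (hB : 0 ≤ B)
    (hμ : 1 ≤ μ) (hK : 1 ≤ K) (hθ : θ < 1) (hθ₁ : (lam + M / K) * μ ^ (r + 1) ≤ θ)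
    (hθ₂ : ∀ ε ∈ Icc 0 ε₀, μ⁻¹ + ε * K * M ≤ θ) (hε₀ : ε₀ ≤ ε₁) (hε₀' : ε₀ ≤ 1)
    {f g : Letter → Letter → Arg k n → Euc k} {φ : Letter → Letter → Arg k n → Euc n}
    (hb : ∀ c c', CrossFormBounds R ε₁ lam M D (f c c') (g c c') (φ c c'))
    (hh : WeightedCr (fun _ : Letter × Letter => (1 : ℝ)) (argDomain k n R ε₁ D) (r + 1) 0
        (fun c p => ((f c.1 c.2 p, g c.1 c.2 p, φ c.1 c.2 p) : Pt k n)))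
    {x y : Code → ℝ → ℤ → Euc n → Euc k} {a b : Code → ℝ → ℤ → Euc n → Euc n}
    (hxy : ∀ ξ, ∀ ε ∈ Icc 0 ε₀, IsCandidate R B μ D (x ξ ε) (y ξ ε) (a ξ ε) (b ξ ε))
    (hab : ∀ ξ, ∀ ε ∈ Icc 0 ε₀, ∀ i, ∀ z ∈ D, b ξ ε i (a ξ ε i z) = z)
    (hc : ∀ ξ : Code, ∀ ε ∈ Icc 0 ε₀, ∀ i, ∀ z ∈ D,
      Connects (slice (f (ξ i) (ξ (i + 1))) ε) (slice (g (ξ i) (ξ (i + 1))) ε)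
        (fun p => ε • slice (φ (ξ i) (ξ (i + 1))) ε p) (x ξ ε i z) (y ξ ε i z) z
        (x ξ ε (i + 1) (b ξ ε i z)) (y ξ ε (i + 1) (b ξ ε i z)) (b ξ ε i z)) :
    WeightedCr (fun _ : Code × Icc (0 : ℝ) ε₀ × ℤ => (1 : ℝ)) D (r + 1) 0
        (fun j => x j.1 j.2.1 j.2.2) ∧
      WeightedCr (fun _ : Code × Icc (0 : ℝ) ε₀ × ℤ => (1 : ℝ)) D (r + 1) 0
        (fun j => y j.1 j.2.1 j.2.2) := by
  choose ζ ζ0 ζD ζs ζl using fun j : Code × Icc (0 : ℝ) ε₀ × ℤ =>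
    exists_baseOrbit hD (zero_le_one.trans hμ) (hxy j.1 j.2.1 j.2.1.2).short_a
      (hxy j.1 j.2.1 j.2.1.2).short_b (hab j.1 j.2.1 j.2.1.2) j.2.2
  have hU := uniqueDiffOn_argDomain (k := k) (n := n) hR hε₁ hD
  have hfd : ∀ (c : Letter × Letter), ∀ p ∈ argDomain k n R ε₁ D,
      fderivWithin ℝ (fun p => ((f c.1 c.2 p, g c.1 c.2 p, φ c.1 c.2 p) : Pt k n))
        (argDomain k n R ε₁ D) p = (fderivWithin ℝ (f c.1 c.2) (argDomain k n R ε₁ D) p).prod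
          ((fderivWithin ℝ (g c.1 c.2) (argDomain k n R ε₁ D) p).prod
            (fderivWithin ℝ (φ c.1 c.2) (argDomain k n R ε₁ D) p)) := fun c p hp => by
    have h := hb c.1 c.2
    exact ((h.diff_f p hp).hasFDerivWithinAt.prodMk ((h.diff_g p hp).hasFDerivWithinAt.prodMk
      (h.diff_φ p hp).hasFDerivWithinAt)).fderivWithin (hU p hp)
  have hstep : ∀ (j : Code × Icc (0 : ℝ) ε₀ × ℤ) (m : ℤ), ∀ z ∈ D, _ := fun j m z hz =>
    hc j.1 j.2.1 j.2.1.2 (j.2.2 + m) (ζ j m z) (ζD j m z hz)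
  have hLip : ∀ {u : Euc n → Euc k} (j : Code × Icc (0 : ℝ) ε₀ × ℤ) (m : ℤ), SegLip D B u →
      ∀ z ∈ D, ∀ᶠ z' in 𝓝 z,
        ‖u (ζ j m z') - u (ζ j m z)‖ ≤ B * μ ^ m.natAbs * ‖z' - z‖ := by
    intro u j m hu z hz
    filter_upwards [ζl j m z hz, (continuousAt_of_eventually_lipschitz (ζl j m z hz)).eventually
      (hu.eventually hD (ζD j m z hz))] with z' e1 e2
    rw [mul_assoc]
    exact e2.trans (mul_le_mul_of_nonneg_left e1 hB)
  have key := orbit_weightedCr (J := Code × Icc (0 : ℝ) ε₀ × ℤ) hD hDb hU hh hM hlam hB hμ hK hθ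
    (R := R)
    (fun c p hp v => by rw [hfd c p hp]; exact ((hb c.1 c.2).norm_fderiv_argMap_le hR hp v).1)
    (fun c p hp v => by rw [hfd c p hp]; exact ((hb c.1 c.2).norm_fderiv_argMap_le hR hp v).2)
    (fun c p hp v => by rw [hfd c p hp]; exact (hb c.1 c.2).norm_fderiv_φ_argMap_le hp v)
    (fun j => (j.2.1 : ℝ)) (fun j => j.2.1.2.1) (fun j => j.2.1.2.2.trans hε₀') hθ₁
    (fun j => hθ₂ _ j.2.1.2) (fun j m => (j.1 (j.2.2 + m), j.1 (j.2.2 + m + 1)))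
    (X := fun j m z => x j.1 j.2.1 (j.2.2 + m) (ζ j m z))
    (Y := fun j m z => y j.1 j.2.1 (j.2.2 + m) (ζ j m z)) (Z := ζ)
    (fun j m z hz => mem_argDomain.2 ⟨(hxy j.1 _ j.2.1.2).norm_x_le _ _ (ζD j m z hz),
      (hxy j.1 _ j.2.1.2).norm_y_le _ _ (ζD j (m + 1) z hz), ζD j m z hz,
      j.2.1.2.1, j.2.1.2.2.trans hε₀⟩)
    (fun j m z hz => (hxy j.1 _ j.2.1.2).norm_x_le _ _ (ζD j m z hz))
    (fun j m z hz => (hxy j.1 _ j.2.1.2).norm_y_le _ _ (ζD j m z hz)) ζD (fun j z _ => ζ0 j z)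
    (fun j m z hz => by
      rw [ζs j m z hz, ← add_assoc]; exact (hstep j m z hz).1)
    (fun j m z hz => by
      rw [ζs j m z hz, ← add_assoc]; exact (hstep j m z hz).2.1)
    (fun j m z hz => by
      rw [ζs j m z hz, ← add_assoc]; exact (hstep j m z hz).2.2)
    (fun j m z hz => hLip j m ((hxy j.1 _ j.2.1.2).segLip_x _) z hz)
    (fun j m z hz => hLip j m ((hxy j.1 _ j.2.1.2).segLip_y _) z hz) ζl
  simpa only [add_zero, ζ0] using key

end Family

/-! ### Choice of constants and conclusion -/

/-- The growth rate `μ` allowed for orbits, the scale `K` of the slow variable, the contraction rate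
`θ` of the equation for orbits, and the Lipschitz constant `B` of the graphs. They depend only on
`lam`, `M` and the smoothness, and are chosen before `ε` is made small. -/
theorem exists_constants {lam M : ℝ} (hlam0 : 0 ≤ lam) (hlam1 : lam < 1) (hM : 0 ≤ M) (r : ℕ) :
    ∃ μ K θ B : ℝ, 1 < μ ∧ 1 ≤ K ∧ θ < 1 ∧ μ⁻¹ < θ ∧ (lam + M / K) * μ ^ (r + 1) ≤ θ ∧ 0 ≤ B ∧
      lam * (B * μ) + M * μ ≤ B := by
  obtain ⟨μ, hμ1, hμ⟩ : ∃ μ : ℝ, 1 < μ ∧ lam * μ ^ (r + 1) < 1 := by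
    have h : Tendsto (fun μ : ℝ => lam * μ ^ (r + 1)) (𝓝[>] 1) (𝓝 lam) := by
      have : Continuous fun μ : ℝ => lam * μ ^ (r + 1) := by fun_prop
      simpa using (this.tendsto 1).mono_left nhdsWithin_le_nhds
    obtain ⟨μ, h1, h2⟩ := ((h.eventually_lt_const hlam1).and self_mem_nhdsWithin).exists
    exact ⟨μ, h2, h1⟩
  obtain ⟨K, hK1, hK⟩ : ∃ K : ℝ, 1 ≤ K ∧ (lam + M / K) * μ ^ (r + 1) < 1 := by
    have h : Tendsto (fun K : ℝ => (lam + M / K) * μ ^ (r + 1)) atTop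
        (𝓝 ((lam + 0) * μ ^ (r + 1))) :=
      ((tendsto_const_nhds.div_atTop tendsto_id).const_add lam).mul_const _
    rw [add_zero] at h
    obtain ⟨K, h1, h2⟩ := ((h.eventually_lt_const hμ).and (eventually_ge_atTop 1)).exists
    exact ⟨K, h2, h1⟩
  obtain ⟨θ, hθ, hθ1⟩ := exists_between (max_lt (inv_lt_one_of_one_lt₀ hμ1) hK)
  have hlμ : lam * μ < 1 :=
    (mul_le_mul_of_nonneg_left (le_self_pow₀ hμ1.le r.succ_ne_zero) hlam0).trans_lt hμ
  have h1 : 0 < 1 - lam * μ := sub_pos.2 hlμ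
  have hμ0 : 0 < μ := one_pos.trans hμ1
  refine ⟨μ, K, θ, M * μ / (1 - lam * μ), hμ1, hK1, hθ1, (le_max_left _ _).trans_lt hθ,
    ((le_max_right _ _).trans_lt hθ).le, by positivity, le_of_eq ?_⟩
  field_simp
  ring

theorem eventually_mul_lt {d : ℝ} (c : ℝ) (hd : 0 < d) : ∀ᶠ ε in 𝓝 (0 : ℝ), c * ε < d := by
  have : Continuous fun ε : ℝ => c * ε := by fun_prop
  have h := this.tendsto 0
  rw [mul_zero] at h
  exact h.eventually_lt_const hd

theorem mainTheorem5 (k n r : ℕ) (hr : 1 ≤ r) (R lam ε₁ : ℝ) (hR : 0 < R) (hlam : lam < 1)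
    (hε₁ : 0 < ε₁)
    (D : Set (Euc n)) (hDo : IsOpen D) (hDc : IsConnected D) (hDb : Bornology.IsBounded D)
    (T : ℝ → Letter → Letter → (Pt k n →. Pt k n))
    (f g : Letter → Letter → Arg k n → Euc k) (φ : Letter → Letter → Arg k n → Euc n)
    (hT : ∀ ε ∈ Icc 0 ε₁, ∀ c c', HasCrossForm R D ε (T ε c c') (f c c') (g c c') (φ c c'))
    (hf : ∀ c c', MapsTo (f c c') (argDomain k n R ε₁ D) (closedBall 0 R))
    (hg : ∀ c c', MapsTo (g c c') (argDomain k n R ε₁ D) (closedBall 0 R))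
    (hfr : ∀ c c', BoundedCr r (f c c') (argDomain k n R ε₁ D))
    (hgr : ∀ c c', BoundedCr r (g c c') (argDomain k n R ε₁ D))
    (hφr : ∀ c c', BoundedCr r (φ c c') (argDomain k n R ε₁ D))
    (hyp : ∀ c c', IsHyperbolicBy R ε₁ D lam (f c c') (g c c'))
    (hφc : ∀ c c', ContinuousOn (φ c c') (argDomain k n R ε₁ (closure D)))
    (hφ0 : ∀ c c', ∀ p ∈ argDomain k n R ε₁ (frontier D), φ c c' p = 0) :
    ∃ ε₀ C B : ℝ, 0 < ε₀ ∧ ε₀ ≤ ε₁ ∧ 0 ≤ C ∧ lam + C * ε₀ < 1 ∧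
      ∃ x y : Code → ℝ → ℤ → Euc n → Euc k,
        (∀ ξ : Code, ∀ ε ∈ Icc 0 ε₀,
          (∀ i, MapsTo (x ξ ε i) D (closedBall 0 R) ∧ MapsTo (y ξ ε i) D (closedBall 0 R)) ∧
          (∀ i, ContDiffOn ℝ r (x ξ ε i) D ∧ ContDiffOn ℝ r (y ξ ε i) D) ∧
          IsInvariantSeq (T ε) ξ (fun i => surface D (x ξ ε i) (y ξ ε i)) ∧
          (∀ X Y : ℤ → Euc n → Euc k,
            IsInvariantSeq (T ε) ξ (fun i => surface D (X i) (Y i)) →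
              ∀ i, EqOn (X i) (x ξ ε i) D ∧ EqOn (Y i) (y ξ ε i) D) ∧
          (∀ i, ∀ j : ℕ, j ≤ r → ∀ z ∈ D,
            ‖iteratedFDerivWithin ℝ j (x ξ ε i) D z‖ ≤ B ∧
            ‖iteratedFDerivWithin ℝ j (y ξ ε i) D z‖ ≤ B) ∧
          (∀ i, ∀ z ∈ D,
            ‖(x ξ ε i z - x ξ 0 i z, y ξ ε i z - y ξ 0 i z)‖ ≤ C * ε)) ∧
        (∀ ξ₁ ξ₂ : Code, ∀ N : ℕ, (∀ i : ℤ, i.natAbs ≤ N → ξ₁ i = ξ₂ i) →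
          ∀ ε ∈ Icc 0 ε₀, ∀ i : ℤ, i.natAbs ≤ N → ∀ z ∈ D,
            max ‖x ξ₁ ε i z - x ξ₂ ε i z‖ ‖y ξ₁ ε i z - y ξ₂ ε i z‖ ≤
              2 * R * (lam + C * ε) ^ (N - i.natAbs)) := by
  obtain ⟨M, hM, hb, hh⟩ := exists_crossFormBounds hr hR hε₁ hDo hDb hf hg hfr hgr hφr hyp hφc hφ0
  obtain ⟨r, rfl⟩ : ∃ r', r = r' + 1 := ⟨r - 1, by omega⟩
  have hlam0 : 0 ≤ lam := by
    obtain ⟨z, hz⟩ := hDc.nonempty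
    exact (norm_nonneg _).trans (hyp Letter.a Letter.a 0 (mem_closedBall_self hR.le) 0
      (mem_closedBall_self hR.le) z hz 0 ⟨le_rfl, hε₁.le⟩)
  obtain ⟨μ, K, θ, B, hμ, hK, hθ, hμθ, hθ₁, hB, hBμ⟩ := exists_constants hlam0 hlam hM r
  have hμ0 : 0 < μ := one_pos.trans hμ
  have hl1 : 0 < 1 - lam := sub_pos.2 hlam
  set C : ℝ := max (2 * (B + M) * M) (2 * (2 * (B + M) + 1) * M / (1 - lam)) with hC
  have hC0 : 0 ≤ C := le_max_of_le_left (by positivity)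
  obtain ⟨ε₀, hε₀, hε₀1, hε₀', hCε, hsmall⟩ : ∃ ε₀ : ℝ, 0 < ε₀ ∧ ε₀ ≤ ε₁ ∧ ε₀ ≤ 1 ∧
      lam + C * ε₀ < 1 ∧ ∀ ε ∈ Icc 0 ε₀, ε * M ≤ 1 / 3 ∧ ε * M * ((B + 1) * μ) ≤ μ - 1 ∧
        ε * M * (B + 2) ≤ 1 / 2 ∧ lam + (B + M) * (ε * M * (B + 2)) < 1 ∧
        lam + 2 * (B + M) * (ε * M) ≤ (1 + lam) / 2 ∧ μ⁻¹ + ε * K * M ≤ θ := by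
    have ev := (eventually_mul_lt M (show (0 : ℝ) < 1 / 3 by norm_num)).and
      ((eventually_mul_lt (M * ((B + 1) * μ)) (sub_pos.2 hμ)).and
      ((eventually_mul_lt (M * (B + 2)) (show (0 : ℝ) < 1 / 2 by norm_num)).and
      ((eventually_mul_lt ((B + M) * (M * (B + 2))) hl1).and
      ((eventually_mul_lt (2 * (B + M) * M) (half_pos hl1)).and
      ((eventually_mul_lt (K * M) (sub_pos.2 hμθ)).and
      (eventually_mul_lt C hl1))))))
    obtain ⟨δ, hδ, hball⟩ := Metric.eventually_nhds_iff.1 ev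
    have hin : ∀ ε ∈ Icc 0 (min (min ε₁ 1) (δ / 2)), dist ε 0 < δ := fun ε hε => by
      rw [Real.dist_eq, sub_zero, abs_of_nonneg hε.1]
      linarith [hε.2, min_le_right (min ε₁ 1) (δ / 2)]
    have hpos : 0 < min (min ε₁ 1) (δ / 2) := lt_min (lt_min hε₁ one_pos) (half_pos hδ)
    refine ⟨min (min ε₁ 1) (δ / 2), hpos, (min_le_left _ _).trans (min_le_left _ _),
      (min_le_left _ _).trans (min_le_right _ _), ?_, fun ε hε => ?_⟩
    · have := (hball (hin _ ⟨hpos.le, le_rfl⟩)).2.2.2.2.2.2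
      linarith
    · obtain ⟨e1, e2, e3, e4, e5, e6, -⟩ := hball (hin ε hε)
      refine ⟨?_, ?_, ?_, ?_, ?_, ?_⟩ <;> linarith
  have hIcc : ∀ ε ∈ Icc 0 ε₀, ε ∈ Icc 0 ε₁ := fun ε hε => ⟨hε.1, hε.2.trans hε₀1⟩
  have hlink : ∀ ε ∈ Icc 0 ε₀, ∀ (ξ : Code) (i : ℤ), IsLink R lam M (ε * M) D
      (slice (f (ξ i) (ξ (i + 1))) ε) (slice (g (ξ i) (ξ (i + 1))) ε)
      (fun p => ε • slice (φ (ξ i) (ξ (i + 1))) ε p) := fun ε hε ξ i =>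
    (hb _ _).isLink hR (hIcc ε hε)
  have hex : ∀ (ξ : Code) (ε : ℝ), ∃ (x y : ℤ → Euc n → Euc k) (a b : ℤ → Euc n → Euc n),
      ε ∈ Icc 0 ε₀ → IsCandidate R B μ D x y a b ∧
        GraphsInvariant R D (fun i => slice (f (ξ i) (ξ (i + 1))) ε)
          (fun i => slice (g (ξ i) (ξ (i + 1))) ε)
          (fun i p => ε • slice (φ (ξ i) (ξ (i + 1))) ε p) x y ∧
        (∀ i, ∀ z ∈ D, a i (b i z) = z ∧ b i (a i z) = z) ∧
        ∀ i, ∀ z ∈ D, Connects (slice (f (ξ i) (ξ (i + 1))) ε) (slice (g (ξ i) (ξ (i + 1))) ε)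
          (fun p => ε • slice (φ (ξ i) (ξ (i + 1))) ε p) (x i z) (y i z) z
          (x (i + 1) (b i z)) (y (i + 1) (b i z)) (b i z) := by
    intro ξ ε
    by_cases hε : ε ∈ Icc 0 ε₀
    · obtain ⟨s1, s2, s3, s4, -, -⟩ := hsmall ε hε
      obtain ⟨x, y, a, b, h⟩ := exists_graphsInvariant (hlink ε hε ξ) hDo hDb hR.le hlam0 hlam.le hM
        hB (mul_nonneg hε.1 hM) s1 hμ.le hBμ s2 s3 s4
      exact ⟨x, y, a, b, fun _ => h⟩
    · exact ⟨0, 0, 0, 0, fun h => absurd h hε⟩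
  choose x y a b hxy using hex
  obtain ⟨⟨xc, Bx, hBx, hxB⟩, yc, By, hBy, hyB⟩ := weightedCr_of_isCandidate hR hε₁ hDo hDb hM hlam0
    hB hμ.le hK hθ hθ₁ (fun ε hε => (hsmall ε hε).2.2.2.2.2) hε₀1 hε₀' hb hh
    (fun ξ ε hε => (hxy ξ ε hε).1) (fun ξ ε hε i z hz => ((hxy ξ ε hε).2.2.1 i z hz).2)
    (fun ξ ε hε => (hxy ξ ε hε).2.2.2)
  have hνB : ∀ ε ∈ Icc 0 ε₀, ε * M * (B + 1) ≤ 1 / 2 := fun ε hε => by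
    have := (hsmall ε hε).2.2.1
    linarith [mul_nonneg hε.1 hM]
  have hq : ∀ ε ∈ Icc 0 ε₀, lam + 2 * (B + M) * (ε * M) < 1 := fun ε hε => by
    have := (hsmall ε hε).2.2.2.2.1
    linarith
  have h0 : (0 : ℝ) ∈ Icc 0 ε₀ := ⟨le_rfl, hε₀.le⟩
  refine ⟨ε₀, C, max Bx By, hε₀, hε₀1, hC0, hCε, x, y, fun ξ ε hε => ?_,
    fun ξ₁ ξ₂ N hN ε hε i hi z hz => ?_⟩
  · obtain ⟨hcand, hinv, -, -⟩ := hxy ξ ε hε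
    have hν0 : 0 ≤ ε * M := mul_nonneg hε.1 hM
    refine ⟨fun i => ⟨fun z hz => mem_closedBall_zero_iff.2 (hcand.norm_x_le i z hz),
        fun z hz => mem_closedBall_zero_iff.2 (hcand.norm_y_le i z hz)⟩,
      fun i => ⟨xc (ξ, ⟨ε, hε⟩, i), yc (ξ, ⟨ε, hε⟩, i)⟩,
      (isInvariantSeq_iff (hT ε (hIcc ε hε))).2 hinv, fun X Y hXY i => ?_,
      fun i j hj z hz => ?_, fun i z hz => ?_⟩
    · have key := fun z hz => ((isInvariantSeq_iff (hT ε (hIcc ε hε))).1 hXY).norm_sub_le hinv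
        (hlink ε hε ξ) (hlink ε hε ξ) hR.le hlam0 hlam.le hM hB hν0 (hsmall ε hε).1 (hνB ε hε)
        (hq ε hε) (le_refl (0 : ℝ)) (fun i p _ => by simp) (fun i p _ => by simp)
        (fun i p _ => by simp) hcand.segLip_x hcand.segLip_y i (z := z) hz
      simp only [mul_zero, zero_div, norm_le_zero_iff, sub_eq_zero] at key
      exact ⟨fun z hz => (key z hz).1, fun z hz => (key z hz).2⟩
    · have e1 := hxB (ξ, ⟨ε, hε⟩, i) j hj z hz
      have e2 := hyB (ξ, ⟨ε, hε⟩, i) j hj z hz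
      rw [one_pow, mul_one] at e1 e2
      exact ⟨e1.trans (le_max_left _ _), e2.trans (le_max_right _ _)⟩
    · obtain ⟨hcand₀, hinv₀, -, -⟩ := hxy ξ 0 h0
      have key := hinv.norm_sub_le hinv₀ (hlink ε hε ξ)
        (fun i => (hlink 0 h0 ξ i).mono (by rw [zero_mul]; exact hν0)) hR.le hlam0 hlam.le hM hB hν0
        (hsmall ε hε).1 (hνB ε hε) (hq ε hε) (mul_nonneg hM hε.1)
        (fun i p hp => ((hb _ _).slice_sub_le (hIcc ε hε) hp).1)
        (fun i p hp => ((hb _ _).slice_sub_le (hIcc ε hε) hp).2.1)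
        (fun i p hp => ((hb _ _).slice_sub_le (hIcc ε hε) hp).2.2)
        hcand₀.segLip_x hcand₀.segLip_y i hz
      have hle : (2 * (B + M) + 1) * (M * ε) / (1 - (lam + 2 * (B + M) * (ε * M))) ≤ C * ε := by
        have hgap : (1 - lam) / 2 ≤ 1 - (lam + 2 * (B + M) * (ε * M)) := by
          have := (hsmall ε hε).2.2.2.2.1
          linarith
        have hnum : 0 ≤ (2 * (B + M) + 1) * (M * ε) :=
          mul_nonneg (by positivity) (mul_nonneg hM hε.1)
        calc _ ≤ (2 * (B + M) + 1) * (M * ε) / ((1 - lam) / 2) :=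
              div_le_div_of_nonneg_left hnum (half_pos hl1) hgap
          _ = 2 * (2 * (B + M) + 1) * M / (1 - lam) * ε := by field_simp
          _ ≤ C * ε := mul_le_mul_of_nonneg_right (le_max_right _ _) hε.1
      exact norm_prod_le_iff.2 ⟨key.1.trans hle, key.2.trans hle⟩
  · obtain ⟨-, hinv₁, -, -⟩ := hxy ξ₁ ε hε
    obtain ⟨hcand₂, hinv₂, -, -⟩ := hxy ξ₂ ε hε
    have hν0 : 0 ≤ ε * M := mul_nonneg hε.1 hM
    have key := hinv₁.norm_sub_le_pow hinv₂ (hlink ε hε ξ₁) (hlink ε hε ξ₂) hR.le hlam0 hlam.le hM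
      hB hν0 (hsmall ε hε).1 (hνB ε hε) (N := N)
      (fun i h1 h2 => by simp only [hN i h1, hN (i + 1) h2, and_self])
      hcand₂.segLip_x hcand₂.segLip_y (N - i.natAbs) i (by omega) z hz
    have hle : lam + 2 * (B + M) * (ε * M) ≤ lam + C * ε := by
      have := mul_le_mul_of_nonneg_right
        (le_max_left (2 * (B + M) * M) (2 * (2 * (B + M) + 1) * M / (1 - lam))) hε.1
      linarith
    have hpow := mul_le_mul_of_nonneg_left
      (pow_le_pow_left₀ (by positivity) hle (N - i.natAbs)) (by positivity : 0 ≤ 2 * R)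
    exact max_le (key.1.trans hpow) (key.2.trans hpow)
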